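/- **The 2-local qubit-qutrit railroad switch.** A *clock qubit* has an inactive state $|0\rangle$ and an active state $|1\rangle$; a *clock qutrit* has an inactive state $|0\rangle$ and two active states $|L\rangle,|R\rangle$. $|x\rangle_c$ denotes the clock state in which a single clock site is active, in the state $x$. For an active state $x$ of a site and an active state $y$ of another site, the *hop* $x\leftrightarrow y$ is the operator $|y\rangle\langle x|+|x\rangle\langle y|$ acting on these two sites (moving the activity from one to the other). *Switch.* The switch between clock qubits $c$ and $c'$ with control $q_1$, target $q_2$ (work qubits) has an upper track of sites $u_1,\dots,u_5$ and a lower track $l_1,\dots,l_5$, where sites $1,3,5$ are qutrits and $2,4$ are qubits. Its Hamiltonian $H_{23}$ is the sum, over both tracks $x\in\{u,l\}$, of the hops $c\leftrightarrow x_1^L$, $x_1^R\leftrightarrow x_2$, $x_2\leftrightarrow x_3^L$, $x_3^R\leftrightarrow x_4$, $x_4\leftrightarrow x_5^L$, $x_5^R\leftrightarrow c'$ and of the terms $P_{q_1}\otimes(|R\rangle\langle L|+|L\rangle\langle R|)_{x_1}$, $W_{q_2}\otimes(|R\rangle\langle L|+|L\rangle\langle R|)_{x_3}$, $P_{q_1}\otimes(|R\rangle\langle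 L|+|L\rangle\langle R|)_{x_5}$, where $P=|1\rangle\langle1|$, $W=\sigma^x$ on the upper and $P=|0\rangle\langle0|$, $W=1$ on the lower track. The *idle* switch has $W=1$ on both tracks (and only $q_1$ matters). *Computer.* Let $n\ge1$ and let $U=U_L\cdots U_1$, $L\ge1$, be a circuit on $n$ work qubits, each gate being a one-qubit unitary or a CNOT. A *block* for a gate consists, in this order, of a clock qubit $a$; eight successive clock positions joined by hops, where the fourth and fifth positions are the states $L,R$ of one qutrit and the other six are qubits; a clock qubit $c$; and a switch from $c$ to the qubit $a$ of the next block. The transition inside the qutrit of the eight positions is $V_q\otimes|R\rangle\langle L|+V_q^\dagger\otimes|L\rangle\langle R|$; for a one-qubit gate $V$ on $q$ this is where the gate is applied, and the switch is idle with control $q$; for a CNOT, $V=1$ and the switch is the one for that CNOT. Pad the circuit by $2L$ identity gates, and close up $6L$ blocks to a ring: the blocks of the $3L$ gates of the padded circuit, followed by the blocks of their inverses in reverse order (that is, two copies of the clock of the padded circuit with common first and last clock qubits, the second copy being traversed backwards). $H$ is the sum of all terms. The initial state is $|0\cdots0\rangle$ on the work qubits with the first clock qubit as the only active clock site. A measurement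 of all particles in the computational basis *succeeds* if an active clock site is found in one of the $4L$ blocks belonging to the padding. Then: 1. *(Locality and size)* The computer has $114L$ clock sites, and $H$ is a sum of $162L$ time-independent Hermitian terms of norm at most $1$, each acting on a qubit and one further particle that is a qubit or a qutrit. 2. *(Switch)* Let a switch be entered with a normalized work state $\varphi=\varphi_0+\varphi_1$ (the parts with $q_1=0,1$), and let $\varphi'=\varphi_0+\varphi_1'$ be $\mathrm{CNOT}_{q_1q_2}\varphi$ (or $\varphi$ for an idle switch). The twelve vectors $\psi^{(0)}=\varphi\otimes|c\rangle_c$; $\psi^{(1)},\dots,\psi^{(4)}=\varphi_0\otimes|l\rangle_c+\varphi_1\otimes|u\rangle_c$ at the positions $1^L,1^R,2,3^L$; $\psi^{(5)},\dots,\psi^{(8)}=\varphi_0\otimes|l\rangle_c+\varphi'_1\otimes|u\rangle_c$ at the positions $3^R,4,5^L,5^R$; $\psi^{(9)}=\varphi'\otimes|c'\rangle_c$; $\psi^{(1*)}=\varphi_0\otimes|u_1^L\rangle_c+\varphi_1\otimes|l_1^L\rangle_c$; $\psi^{(8*)}=\varphi_0\otimes|u_5^R\rangle_c+\varphi_1'\otimes|l_5^R\rangle_c$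 are orthonormal. Their 12-dimensional span is invariant under the Hamiltonian of the switch, which in this basis is the adjacency matrix of the line $\psi^{(0)},\dots,\psi^{(9)}$ with $\psi^{(1*)}$ attached to $\psi^{(0)}$ and $\psi^{(8*)}$ attached to $\psi^{(9)}$. In particular, the switch of a CNOT leads from $\varphi\otimes|c\rangle_c$ to $(\mathrm{CNOT}_{q_1q_2}\varphi)\otimes|c'\rangle_c$. 3. *(Necklace)* For each normalized initial work state $\varphi$, the vectors $\psi^{(0)},\dots,\psi^{(8)},\psi^{(1*)},\psi^{(8*)}$ of all the switches and the vectors $\varphi_x\otimes|x\rangle_c$ for the clock positions $x$ outside the switches, with $\varphi_x$ the result of applying to $\varphi$ the gates preceding $x$ on the ring, are orthonormal. In this basis $H$ is the adjacency matrix of a necklace: a ring of $9\cdot12L$ nodes with a pendant node attached to every ninth node. 4. *(Output)* Start in the initial state and evolve with $H$. At every time $\tau$ and for every bit string $z$, the probability of success together with the work result $z$ equals the probability of success times $|\langle z|U|0\cdots0\rangle|^2$. 5. *(Running time)* Let $p(T)$ be the probability of success when the time of the measurement is uniformly random in $[0,T]$. There is an integer $k\ge 0$ such that (a) there are constants $C,\delta>0$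 with $p(T)\ge\delta$ for all $n$, all circuits and all $T\ge C L^2\log^k(L+1)$; (b) for every $\varepsilon>0$ there are $C>0$ and $L_0$ with $p(T)\ge\frac23-\varepsilon$ for all $n$, all circuits with $L\ge L_0$ and all $T\ge CL^2\log^k(L+1)$. 6. *(BQP-universality)* For every language in $\mathsf{BQP}$ (decided with error at most $\frac13$ by a polynomial-time uniform family of circuits, one for each input $x$, with gates $H$, $T=\mathrm{diag}(1,e^{i\pi/4})$, CNOT, by measuring the first qubit) there are a polynomial-time uniform family of such circuits, of polynomial size, and constants $C,\delta>0$, $k$ such that, for every $x$, the computer of the circuit for $x$, started in its initial state and measured at a uniformly random time in $[0,CL^2\log^k(L+1)]$, succeeds with probability at least $\delta$ and, given success, the first work qubit gives the right answer with probability at least $\frac23$. -/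

import Mathlib

open scoped Matrix

noncomputable section

namespace Railroad

/-! ### Quantum circuits on `n` work qubits -/

/-- Computational basis strings of `n` qubits. -/
abbrev Bits (n : ℕ) := Fin n → Fin 2

/-- The Pauli matrix `σˣ`. -/
def sigmaX : Matrix (Fin 2) (Fin 2) ℂ := !![0, 1; 1, 0]

/-- The projector `|0⟩⟨0|` of a qubit. -/
def ketbra0 : Matrix (Fin 2) (Fin 2) ℂ := !![1, 0; 0, 0]

/-- The projector `|1⟩⟨1|` of a qubit. -/
def ketbra1 : Matrix (Fin 2) (Fin 2) ℂ := !![0, 0; 0, 1]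

/-- Gates: an arbitrary one-qubit unitary `V` on qubit `q`, or a CNOT with control `q₁` and
target `q₂`. -/
inductive Gate (n : ℕ) where
  | one (V : Matrix.unitaryGroup (Fin 2) ℂ) (q : Fin n)
  | cnot (q₁ q₂ : Fin n) (h : q₁ ≠ q₂)

/-- The operator `A` on qubit `q`, tensored with the identity on the other qubits. -/
def onQubit {n : ℕ} (q : Fin n) (A : Matrix (Fin 2) (Fin 2) ℂ) : Matrix (Bits n) (Bits n) ℂ :=
  fun z z' => if ∀ r, r ≠ q → z r = z' r then A (z q) (z' q) else 0

/-- The classical action of CNOT: flip bit `q₂` if bit `q₁` is `1`. -/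
def cnotBits {n : ℕ} (q₁ q₂ : Fin n) (z : Bits n) : Bits n :=
  if z q₁ = 1 then Function.update z q₂ (1 - z q₂) else z

/-- The CNOT operator with control `q₁` and target `q₂`. -/
def cnotMatrix {n : ℕ} (q₁ q₂ : Fin n) : Matrix (Bits n) (Bits n) ℂ :=
  fun z z' => if z = cnotBits q₁ q₂ z' then 1 else 0

namespace Gate

variable {n : ℕ}

/-- The unitary of a gate on the work register. -/
def unitary : Gate n → Matrix (Bits n) (Bits n) ℂ
  | one V q => onQubit q V
  | cnot q₁ q₂ _ => cnotMatrix q₁ q₂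

/-- The inverse gate. -/
def inv : Gate n → Gate n
  | one V q => one V⁻¹ q
  | cnot q₁ q₂ h => cnot q₁ q₂ h

/-- The identity gate. -/
def idle [NeZero n] : Gate n := one 1 0

end Gate

/-- The work state obtained from `φ` by applying the gates of a list from left to right. -/
def run {n : ℕ} (gs : List (Gate n)) (φ : Bits n → ℂ) : Bits n → ℂ :=
  gs.foldl (fun ψ g => g.unitary *ᵥ ψ) φ

/-- The work state `|00⋯0⟩`. -/
def zeroState (n : ℕ) : Bits n → ℂ := Pi.single 0 1

/-! ### The clock register

The clock register is a ring of `B` blocks.  Going around the ring, block `b` consists of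

* the clock qubit `a b`;
* eight clock positions without a switch, realised by the sites `s b 0, …, s b 6`, where `s b 3` is
  a qutrit (its two active states are two successive positions) and the others are qubits;
* the clock qubit `c b`, where the railroad switch begins;
* the two tracks of the railroad switch, `g b true j` (upper) and `g b false j` (lower), `j < 5`;
  the sites `j = 0, 2, 4` are the qutrits `u₁, u₃, u₅` (or `l₁, l₃, l₅`) and the sites `j = 1, 3`
  are the qubits `u₂, u₄` (or `l₂, l₄`).

The switch of block `b` ends at the clock qubit `a (b + 1)`, cyclically. -/

/-- The sites of the clock register. -/
inductive Site (B : ℕ) where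
  | a (b : Fin B)
  | s (b : Fin B) (j : Fin 7)
  | c (b : Fin B)
  | g (b : Fin B) (up : Bool) (j : Fin 5)
  deriving DecidableEq, Fintype

/-- The block that a clock site belongs to. -/
def Site.block {B : ℕ} : Site B → Fin B
  | .a b => b
  | .s b _ => b
  | .c b => b
  | .g b _ _ => b

/-- The particles of the computer: `n` work qubits and the clock sites. -/
abbrev Particle (n B : ℕ) := Fin n ⊕ Site B

/-- The local dimension of a particle: `2` for a qubit, `3` for a qutrit. -/
def dim {n B : ℕ} : Particle n B → ℕ
  | .inl _ => 2
  | .inr (.a _) => 2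
  | .inr (.s _ j) => if j = 3 then 3 else 2
  | .inr (.c _) => 2
  | .inr (.g _ _ j) => if j.val % 2 = 0 then 3 else 2

/-- Computational basis states of the whole system; the state space is `Cfg n B → ℂ`.
A clock qubit is inactive in state `0` and active in state `1`.  A clock qutrit is inactive in
state `0` and has the two active states `1` (called `L`) and `2` (called `R`). -/
abbrev Cfg (n B : ℕ) := (p : Particle n B) → Fin (dim p)

/-- Operators on the whole system. -/
abbrev Op (n B : ℕ) := Matrix (Cfg n B) (Cfg n B) ℂ

/-- The next block around the ring. -/
def next {B : ℕ} (b : Fin B) : Fin B := ⟨(b.val + 1) % B, Nat.mod_lt _ b.pos⟩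

/-- The previous block around the ring. -/
def prev {B : ℕ} (b : Fin B) : Fin B := ⟨(b.val + (B - 1)) % B, Nat.mod_lt _ b.pos⟩

/-- `A` acts nontrivially only on the particles in `S`: it is the tensor product of an operator on
the particles in `S` and the identity on all the others. -/
def IsLocalOn {n B : ℕ} (S : Set (Particle n B)) (A : Op n B) : Prop :=
  (∀ x y, (∃ p, p ∉ S ∧ x p ≠ y p) → A x y = 0) ∧
  ∀ x y x' y', (∀ p, p ∉ S → x p = y p) → (∀ p, p ∉ S → x' p = y' p) →
    (∀ p ∈ S, x p = x' p ∧ y p = y' p) → A x y = A x' y'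

/-- `A` acts on two particles only: a qubit, and a second particle that is a qubit or a qutrit. -/
def IsTwoLocalQubitQutrit {n B : ℕ} (A : Op n B) : Prop :=
  ∃ p p' : Particle n B, dim p = 2 ∧ (dim p' = 2 ∨ dim p' = 3) ∧ IsLocalOn {p, p'} A

/-! ### The two kinds of 2-local terms -/

/-- The hopping term `|s'^β⟩⟨s^α| + |s^α⟩⟨s'^β|` between the active state `α` of the clock site `s`
and the active state `β` of the clock site `s'`. In terms of the two particles `(s, s')` it is
`|0, β⟩⟨α, 0| + |α, 0⟩⟨0, β|`. -/
def hop {n B : ℕ} (s : Site B) (α : ℕ) (s' : Site B) (β : ℕ) : Op n B :=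
  fun x y =>
    if (∀ p : Particle n B, p ≠ .inr s → p ≠ .inr s' → x p = y p) ∧
      (((y (.inr s)).val = α ∧ (y (.inr s')).val = 0 ∧
          (x (.inr s)).val = 0 ∧ (x (.inr s')).val = β) ∨
        ((x (.inr s)).val = α ∧ (x (.inr s')).val = 0 ∧
          (y (.inr s)).val = 0 ∧ (y (.inr s')).val = β))
    then 1 else 0

/-- The term `A_q ⊗ |R⟩⟨L|_s + A_q† ⊗ |L⟩⟨R|_s` on the work qubit `q` and the clock qutrit `s`. -/
def flipTerm {n B : ℕ} (q : Fin n) (A : Matrix (Fin 2) (Fin 2) ℂ) (s : Site B) : Op n B :=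
  fun x y =>
    if ∀ p : Particle n B, p ≠ .inl q → p ≠ .inr s → x p = y p then
      if (y (.inr s)).val = 1 ∧ (x (.inr s)).val = 2 then A (x (.inl q)) (y (.inl q))
      else if (y (.inr s)).val = 2 ∧ (x (.inr s)).val = 1 then Aᴴ (x (.inl q)) (y (.inl q))
      else 0
    else 0

/-! ### The Hamiltonian of a ring of blocks

Block `b` applies the gate `g`.  A one-qubit gate is applied between the two active states of the
qutrit `s b 3`, and then the switch of the block flips nothing.  A CNOT is applied by the switch of
the block, and then the qutrit `s b 3` applies the identity. -/

namespace Gate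

variable {n : ℕ}

/-- The qubit acted upon by the qutrit in front of the switch. -/
def segQubit : Gate n → Fin n
  | one _ q => q
  | cnot q₁ _ _ => q₁

/-- The one-qubit operator applied by the qutrit in front of the switch. -/
def segMatrix : Gate n → Matrix (Fin 2) (Fin 2) ℂ
  | one V _ => V
  | cnot _ _ _ => 1

/-- The qubit that controls the switch. -/
def control : Gate n → Fin n
  | one _ q => q
  | cnot q₁ _ _ => q₁

/-- The target qubit of the switch. -/
def target : Gate n → Fin n
  | one _ q => q
  | cnot _ q₂ _ => q₂

/-- What the upper track does to the target: `σˣ` for a CNOT. -/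
def flip : Gate n → Matrix (Fin 2) (Fin 2) ℂ
  | one _ _ => 1
  | cnot _ _ _ => sigmaX

/-- What the switch is meant to do to the work register: a CNOT, or nothing. -/
def switchUnitary : Gate n → Matrix (Bits n) (Bits n) ℂ
  | one _ _ => 1
  | cnot q₁ q₂ _ => cnotMatrix q₁ q₂

end Gate

section Ring

variable {n B : ℕ}

/-- The terms of the part of block `b` in front of the switch. -/
def segTerms (g : Gate n) (b : Fin B) : List (Op n B) :=
  [hop (.a b) 1 (.s b 0) 1, hop (.s b 0) 1 (.s b 1) 1, hop (.s b 1) 1 (.s b 2) 1,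
   hop (.s b 2) 1 (.s b 3) 1,
   flipTerm g.segQubit g.segMatrix (.s b 3),
   hop (.s b 3) 2 (.s b 4) 1, hop (.s b 4) 1 (.s b 5) 1, hop (.s b 5) 1 (.s b 6) 1,
   hop (.s b 6) 1 (.c b) 1]

/-- The terms of one track of the switch of block `b`.  The transitions inside the first and the
last qutrit require the control qubit to be in the range of the projector `P`, and the transition
inside the middle qutrit applies `W` to the target qubit. -/
def trackTerms (g : Gate n) (b : Fin B) (up : Bool) (P W : Matrix (Fin 2) (Fin 2) ℂ) :
    List (Op n B) :=
  [hop (.c b) 1 (.g b up 0) 1,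
   flipTerm g.control P (.g b up 0),
   hop (.g b up 0) 2 (.g b up 1) 1, hop (.g b up 1) 1 (.g b up 2) 1,
   flipTerm g.target W (.g b up 2),
   hop (.g b up 2) 2 (.g b up 3) 1, hop (.g b up 3) 1 (.g b up 4) 1,
   flipTerm g.control P (.g b up 4),
   hop (.g b up 4) 2 (.a (next b)) 1]

/-- The terms of the railroad switch of block `b`. -/
def switchTerms (g : Gate n) (b : Fin B) : List (Op n B) :=
  trackTerms g b true ketbra1 g.flip ++ trackTerms g b false ketbra0 1

/-- The qubit-qutrit railroad switch Hamiltonian of block `b`. -/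
def switchHam (g : Gate n) (b : Fin B) : Op n B := (switchTerms g b).sum

/-- All terms of the Hamiltonian of the ring whose block `b` applies the gate `G b`. -/
def ringTerms (G : Fin B → Gate n) : List (Op n B) :=
  (List.finRange B).flatMap fun b => segTerms (G b) b ++ switchTerms (G b) b

/-- The Hamiltonian of the ring. -/
def ringHam (G : Fin B → Gate n) : Op n B := (ringTerms G).sum

/-! ### The distinguished basis -/

/-- `φ ⊗ |s^α⟩_c`: the work register is in the state `φ`, the clock site `s` is in the active state
`α`, and all other clock sites are inactive. -/
def posState (φ : Bits n → ℂ) (s : Site B) (α : ℕ) : Cfg n B → ℂ :=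
  fun x => if ∀ s', (x (.inr s')).val = (if s' = s then α else 0)
    then φ (fun q => x (.inl q)) else 0

/-- The part of the work state `φ` in which qubit `q` has the value `v`. -/
def part (q : Fin n) (v : Fin 2) (φ : Bits n → ℂ) : Bits n → ℂ :=
  fun z => if z q = v then φ z else 0

/-- `φ₀ ⊗ |l^α⟩ + φ₁ ⊗ |u^α⟩`, where `l`, `u` are the `j`-th sites of the lower and upper track and
`φ₀`, `φ₁` are the parts of `φ` in which the control qubit is `0`, `1`. -/
def onTracks (g : Gate n) (b : Fin B) (φ : Bits n → ℂ) (j : Fin 5) (α : ℕ) : Cfg n B → ℂ :=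
  posState (part g.control 0 φ) (.g b false j) α + posState (part g.control 1 φ) (.g b true j) α

/-- `φ₀ ⊗ |u^α⟩ + φ₁ ⊗ |l^α⟩`: the train is on the wrong track. -/
def offTracks (g : Gate n) (b : Fin B) (φ : Bits n → ℂ) (j : Fin 5) (α : ℕ) : Cfg n B → ℂ :=
  posState (part g.control 0 φ) (.g b true j) α + posState (part g.control 1 φ) (.g b false j) α

/-- The twelve basis states of the switch of block `b`, entered with the work state `φ`:
`inl 0, …, inl 9` are the states from one end of the switch to the other, and `inr 0`, `inr 1` are
the two blind-alley states at its two ends. -/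
def switchState (g : Gate n) (b : Fin B) (φ : Bits n → ℂ) : Fin 10 ⊕ Fin 2 → Cfg n B → ℂ
  | .inl 0 => posState φ (.c b) 1
  | .inl 1 => onTracks g b φ 0 1
  | .inl 2 => onTracks g b φ 0 2
  | .inl 3 => onTracks g b φ 1 1
  | .inl 4 => onTracks g b φ 2 1
  | .inl 5 => onTracks g b (g.switchUnitary *ᵥ φ) 2 2
  | .inl 6 => onTracks g b (g.switchUnitary *ᵥ φ) 3 1
  | .inl 7 => onTracks g b (g.switchUnitary *ᵥ φ) 4 1
  | .inl 8 => onTracks g b (g.switchUnitary *ᵥ φ) 4 2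
  | .inl 9 => posState (g.switchUnitary *ᵥ φ) (.a (next b)) 1
  | .inr 0 => offTracks g b φ 0 1
  | .inr 1 => offTracks g b (g.switchUnitary *ᵥ φ) 4 2

/-- The nine basis states of the part of block `b` in front of the switch, entered with the work
state `φ`. -/
def segState (g : Gate n) (b : Fin B) (φ : Bits n → ℂ) : Fin 9 → Cfg n B → ℂ
  | 0 => posState φ (.a b) 1
  | 1 => posState φ (.s b 0) 1
  | 2 => posState φ (.s b 1) 1
  | 3 => posState φ (.s b 2) 1
  | 4 => posState φ (.s b 3) 1
  | 5 => posState (onQubit g.segQubit g.segMatrix *ᵥ φ) (.s b 3) 2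
  | 6 => posState (onQubit g.segQubit g.segMatrix *ᵥ φ) (.s b 4) 1
  | 7 => posState (onQubit g.segQubit g.segMatrix *ᵥ φ) (.s b 5) 1
  | 8 => posState (onQubit g.segQubit g.segMatrix *ᵥ φ) (.s b 6) 1

/-- The work state with which block `b` is entered, if block `0` is entered with `φ`. -/
def workAt (G : Fin B → Gate n) (φ : Bits n → ℂ) (b : Fin B) : Bits n → ℂ :=
  run ((List.ofFn G).take b) φ

/-- The work state with which the switch of block `b` is entered. -/
def switchWorkAt (G : Fin B → Gate n) (φ : Bits n → ℂ) (b : Fin B) : Bits n → ℂ :=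
  onQubit (G b).segQubit (G b).segMatrix *ᵥ workAt G φ b

/-- The basis of the computation with initial work state `φ`, indexed by the nodes of a necklace.
The ring node `inl r` is the state number `r % 18` of block `r / 18`.  The pendant node `inr i` is
the first blind-alley state of block `i / 2` if `i` is odd, and the second blind-alley state of the
block before block `i / 2` if `i` is even. -/
def legalState (G : Fin B → Gate n) (φ : Bits n → ℂ) :
    Fin (9 * (2 * B)) ⊕ Fin (2 * B) → Cfg n B → ℂ
  | .inl r =>
      let b : Fin B := ⟨r.val / 18, by omega⟩
      if h : r.val % 18 < 9 then segState (G b) b (workAt G φ b) ⟨r.val % 18, h⟩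
      else switchState (G b) b (switchWorkAt G φ b) (.inl ⟨r.val % 18 - 9, by omega⟩)
  | .inr i =>
      let b : Fin B := ⟨i.val / 2, by omega⟩
      if i.val % 2 = 1 then switchState (G b) b (switchWorkAt G φ b) (.inr 0)
      else switchState (G (prev b)) (prev b) (switchWorkAt G φ (prev b)) (.inr 1)

end Ring

/-- A finite family of vectors is orthonormal. -/
def IsOrthonormal {ι X : Type} [Fintype X] (f : ι → X → ℂ) : Prop :=
  (∀ i, star (f i) ⬝ᵥ f i = 1) ∧ ∀ i j, i ≠ j → star (f i) ⬝ᵥ f j = 0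

open Classical in
/-- The operator `A` maps each vector of the family `f` to the sum of its neighbours in the graph
`Γ`: in the basis `f`, the restriction of `A` to the span of `f` is the adjacency matrix of `Γ`. -/
def ActsAsAdjacency {ι X : Type} [Fintype ι] [Fintype X] (A : Matrix X X ℂ) (f : ι → X → ℂ)
    (Γ : SimpleGraph ι) : Prop :=
  ∀ i, A *ᵥ f i = ∑ j, (Γ.adjMatrix ℂ) j i • f j

/-- A line of ten nodes, with one pendant node attached to each of its two ends. -/
def comb : SimpleGraph (Fin 10 ⊕ Fin 2) where
  Adj
    | .inl i, .inl j => (SimpleGraph.pathGraph 10).Adj i j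
    | .inl i, .inr k => (k = 0 ∧ i = 0) ∨ (k = 1 ∧ i = 9)
    | .inr k, .inl i => (k = 0 ∧ i = 0) ∨ (k = 1 ∧ i = 9)
    | .inr _, .inr _ => False
  symm := ⟨by rintro (i | k) (j | l) h <;> first | exact h | exact SimpleGraph.Adj.symm h⟩
  loopless := ⟨by rintro (i | k) h <;> first | exact h | exact SimpleGraph.irrefl _ h⟩

/-- The necklace: a ring of `d * M` nodes, with one pendant node attached to every `d`-th node of
the ring. -/
def necklace (d M : ℕ) : SimpleGraph (Fin (d * M) ⊕ Fin M) where
  Adj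
    | .inl r, .inl r' => (SimpleGraph.cycleGraph (d * M)).Adj r r'
    | .inl r, .inr i => r.val = d * i.val
    | .inr i, .inl r => r.val = d * i.val
    | .inr _, .inr _ => False
  symm := ⟨by rintro (i | k) (j | l) h <;> first | exact h | exact SimpleGraph.Adj.symm h⟩
  loopless := ⟨by rintro (i | k) h <;> first | exact h | exact SimpleGraph.irrefl _ h⟩

/-! ### The computer for a given circuit

The circuit `gs` with `L` gates is padded with `2 * L` identity gates, and the clock is doubled: the
computer has two clock tracks for the padded circuit, which share their first clock qubit and
their last one.  Going around the ring from the first clock qubit, one meets the `3 * L` blocks of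
the first copy, and then the `3 * L` blocks of the second copy in reverse order and direction. -/

section Computer

variable {n : ℕ} [NeZero n]

/-- The gates of the ring: those of the padded circuit, followed by the inverses of the gates of
the padded circuit in reverse order. -/
def ringGate (gs : List (Gate n)) (b : Fin (6 * gs.length)) : Gate n :=
  if h : b.val < gs.length then gs[b.val]
  else if h' : b.val < 5 * gs.length then Gate.idle
  else (gs[6 * gs.length - 1 - b.val]'(by omega)).inv

/-- The Hamiltonian of the computer. -/
def computerHam (gs : List (Gate n)) : Op n (6 * gs.length) := ringHam (ringGate gs)

/-- The initial basis state: all work qubits are `0`, and the only active clock site is the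
first clock qubit. -/
def initCfg (n B : ℕ) : Cfg n B
  | .inl _ => (0 : Fin 2)
  | .inr (.a b) => if b.val = 0 then (1 : Fin 2) else (0 : Fin 2)
  | .inr (.s _ j) => ⟨0, by simp only [dim]; split <;> omega⟩
  | .inr (.c _) => (0 : Fin 2)
  | .inr (.g _ _ j) => ⟨0, by simp only [dim]; split <;> omega⟩

/-- The state `exp (-i τ H) |init⟩` of the computer at time `τ`. -/
def stateAt (gs : List (Gate n)) (τ : ℝ) : Cfg n (6 * gs.length) → ℂ :=
  NormedSpace.exp ((-(Complex.I * (τ : ℂ))) • computerHam gs) *ᵥ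
    Pi.single (initCfg n (6 * gs.length)) 1

open Classical in
/-- The probability that a measurement of all particles in the computational basis at time `τ`
gives a result in the event `E`. -/
def probAt (gs : List (Gate n)) (τ : ℝ) (E : Set (Cfg n (6 * gs.length))) : ℝ :=
  ∑ x, if x ∈ E then ‖stateAt gs τ x‖ ^ 2 else 0

/-- The probability of the event `E` if the time of the measurement is chosen uniformly at random
in `[0, T]`. -/
def avgProb (gs : List (Gate n)) (T : ℝ) (E : Set (Cfg n (6 * gs.length))) : ℝ :=
  T⁻¹ * ∫ τ in (0 : ℝ)..T, probAt gs τ E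

/-- Success: an active clock site is found in the success region, which consists of the
blocks of the padding, in both copies (two thirds of all blocks). -/
def success (gs : List (Gate n)) : Set (Cfg n (6 * gs.length)) :=
  {x | ∃ s : Site (6 * gs.length), (x (.inr s)).val ≠ 0 ∧
    gs.length ≤ s.block.val ∧ s.block.val < 5 * gs.length}

/-- The event that the work qubits are found in the basis state `z`. -/
def workIs (gs : List (Gate n)) (z : Bits n) : Set (Cfg n (6 * gs.length)) :=
  {x | ∀ q, x (.inl q) = z q}

/-- The event that the output qubit, which is the work qubit `0`, is found in the state `1`. -/
def outputIsOne (gs : List (Gate n)) : Set (Cfg n (6 * gs.length)) :=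
  {x | x (.inl 0) = (1 : Fin 2)}

/-- The probability that the output qubit of the circuit `gs`, run on `|00⋯0⟩`, is found in the
state `1`. -/
def acceptProb (gs : List (Gate n)) : ℝ :=
  ∑ z : Bits n, if z 0 = 1 then ‖run gs (zeroState n) z‖ ^ 2 else 0

end Computer

/-- The time bound `C L² log(L + 1)^k`. -/
def timeBound (C : ℝ) (k L : ℕ) : ℝ := C * (L : ℝ) ^ 2 * Real.log ((L : ℝ) + 1) ^ k

/-! ### The class BQP -/

/-- The gate set `H`, `T = diag(1, e^{iπ/4})`, CNOT. -/
inductive StdGate (n : ℕ) where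
  | H (q : Fin n)
  | T (q : Fin n)
  | cnot (q₁ q₂ : Fin n) (h : q₁ ≠ q₂)

/-- The Hadamard matrix. -/
def hadamardMatrix : Matrix (Fin 2) (Fin 2) ℂ :=
  (((Real.sqrt 2)⁻¹ : ℝ) : ℂ) • !![1, 1; 1, -1]

/-- The matrix `T = diag(1, e^{iπ/4})`. -/
def tMatrix : Matrix (Fin 2) (Fin 2) ℂ :=
  !![1, 0; 0, Complex.exp ((Real.pi / 4 : ℝ) * Complex.I)]

theorem hadamardMatrix_mem : hadamardMatrix ∈ Matrix.unitaryGroup (Fin 2) ℂ := by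
  have h2 : ((Real.sqrt 2 : ℝ) : ℂ) * ((Real.sqrt 2 : ℝ) : ℂ) = 2 := by
    rw [← Complex.ofReal_mul, Real.mul_self_sqrt (by norm_num)]; norm_num
  have h0 : ((Real.sqrt 2 : ℝ) : ℂ) ≠ 0 := by
    intro h; rw [h] at h2; norm_num at h2
  rw [Matrix.mem_unitaryGroup_iff]
  ext i j
  fin_cases i <;> fin_cases j <;>
    simp [hadamardMatrix, Matrix.mul_apply, Matrix.star_apply, Fin.sum_univ_two] <;>
    field_simp <;> (try simp only [pow_two, h2]) <;> norm_num

theorem tMatrix_mem : tMatrix ∈ Matrix.unitaryGroup (Fin 2) ℂ := by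
  rw [Matrix.mem_unitaryGroup_iff]
  ext i j
  fin_cases i <;> fin_cases j <;>
    simp [tMatrix, Matrix.mul_apply, Matrix.star_apply, Fin.sum_univ_two]
  rw [← Complex.exp_conj, ← Complex.exp_add]
  have h4 : (starRingEnd ℂ) (4 : ℂ) = 4 := map_ofNat _ 4
  simp [h4]

/-- A gate of the standard set as a gate. -/
def StdGate.toGate {n : ℕ} : StdGate n → Gate n
  | H q => .one ⟨hadamardMatrix, hadamardMatrix_mem⟩ q
  | T q => .one ⟨tMatrix, tMatrix_mem⟩ q
  | cnot q₁ q₂ h => .cnot q₁ q₂ h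

/-- A circuit over the standard gate set: at least one qubit (there are `m + 1`) and at least one
gate. -/
structure StdCircuit where
  m : ℕ
  gates : List (StdGate (m + 1))
  ne : gates ≠ []

/-- The gate list of a circuit. -/
def StdCircuit.toGates (c : StdCircuit) : List (Gate (c.m + 1)) := c.gates.map StdGate.toGate

/-- The alphabet in which circuits are written. -/
inductive Symb where
  | h | t | c | one | sep

/-- The unary description of a number. -/
def unary (k : ℕ) : List Symb := List.replicate k .one ++ [.sep]

/-- The description of a gate. -/
def StdGate.encode {n : ℕ} : StdGate n → List Symb
  | H q => .h :: unary q
  | T q => .t :: unary q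
  | cnot q₁ q₂ _ => .c :: (unary q₁ ++ unary q₂)

/-- The description of a circuit: the number of its qubits, and then its gates one by one. -/
def StdCircuit.encode (c : StdCircuit) : List Symb :=
  unary (c.m + 1) ++ c.gates.flatMap StdGate.encode

/-- A uniform family of circuits of polynomial size: a Turing machine computes the description of
the circuit `P x` from `x` in polynomial time. -/
def IsUniform (P : List Bool → StdCircuit) : Prop :=
  Nonempty (Turing.TM2ComputableInPolyTime (id : List Bool → List Bool) StdCircuit.encode P) ∧
  ∃ p : Polynomial ℕ, ∀ x, (P x).m + 1 ≤ p.eval x.length ∧ (P x).gates.length ≤ p.eval x.length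

/-- The class BQP: languages decided with bounded error by a uniform family of circuits. -/
def InBQP (A : Language Bool) : Prop :=
  ∃ P : List Bool → StdCircuit, IsUniform P ∧
    ∀ x, (x ∈ A → 2 / 3 ≤ acceptProb (P x).toGates) ∧
      (x ∉ A → acceptProb (P x).toGates ≤ 1 / 3)

/-- Languages decided with bounded error by the qubit-qutrit Hamiltonian computer. A uniform
polynomial-time program writes down the instance for the input `x`; if it has `L` gates, then
the computer is prepared in its initial product state, evolves for a random time between `0` and
`C L² log(L + 1)^k`, and is measured. The run succeeds with probability at least `δ > 0`, a
constant, and given success the output qubit answers correctly with probability at least `2/3`. -/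
def DecidedByHamiltonianComputer (A : Language Bool) : Prop :=
  ∃ (P : List Bool → StdCircuit) (C δ : ℝ) (k : ℕ), IsUniform P ∧ 0 < C ∧ 0 < δ ∧
    ∀ x, δ ≤ avgProb (P x).toGates (timeBound C k (P x).gates.length) (success (P x).toGates) ∧
      (x ∈ A →
        2 / 3 * avgProb (P x).toGates (timeBound C k (P x).gates.length) (success (P x).toGates) ≤
          avgProb (P x).toGates (timeBound C k (P x).gates.length)
            (success (P x).toGates ∩ outputIsOne (P x).toGates)) ∧
      (x ∉ A →
        avgProb (P x).toGates (timeBound C k (P x).gates.length)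
            (success (P x).toGates ∩ outputIsOne (P x).toGates) ≤
          1 / 3 * avgProb (P x).toGates (timeBound C k (P x).gates.length)
            (success (P x).toGates))

end Railroad

end

open scoped Matrix

noncomputable section

namespace Railroad

/-! ### Gates on the work register -/

section Gates

variable {n : ℕ}

/-! Each term moves the activity of the clock by one position, and a transition inside a qutrit also
applies a one-qubit operator to the work register. So the Hamiltonian stays within the states with
one active clock site, and the proof follows a single chain of such states around the ring. At a
switch the hop out of `c` sends all of `φ` to both tracks. Split by the control bit, this is the sum
of a state on the right track and a state on the wrong track. The projector in the outer qutrit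
annihilates the latter, which is therefore a pendant node; the other end of the switch is the mirror
image (`switchHam_mulVec_switchState`). The gates of the ring multiply to the identity, so the chain
closes up, and the Hamiltonian is the adjacency matrix of a necklace (`actsAsAdjacency_ringHam`).

All basis states have the form `wave`: for each work string `z` exactly one clock position is
active. For fixed `z`, different nodes have different positions. This gives orthonormality, and it
also means that nodes do not interfere in a measurement. Every node in the padding carries the same
work state, the output of the circuit, so the work result is independent of success
(`probAt_success_inter_eq_mul`).

What remains is a quantum walk on a necklace of `M = 12L` cells with ten nodes each. Fourier
transformation over the cells turns it into Hermitian 10 by 10 matrices `bloch z`, where `z` runs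
through the `M`-th roots of unity (`walkAmp_necklace`). The time-averaged probability of a range of
cells is a double sum over momenta of geometric sums times time integrals of overlaps of Bloch
amplitudes.

These integrals are bounded without any knowledge of the eigenvalues. Put `t_z = z + star z`. The
annihilating polynomial of `bloch z` is `P(E) - t_z E` with `P` independent of `z` and `P(0) = -1`.
Hence `bloch z` has a uniformly bounded inverse, and a difference quotient of `P` yields a uniformly
bounded `Y` with `bloch w * Y - Y * bloch z = (t_w - t_z) • 1` (`exists_bloch_sylvester`).
Differentiating `exp (iτ bloch w) Y exp (-iτ bloch z)` in `τ` shows that the integral of the overlap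
is at most a constant over `|t_w - t_z|`, whatever the length of the time interval
(`exists_norm_integral_blochAmp_le`).

For `z`, `w` with momenta `a`, `b` one has `|t_w - t_z| = chord (a - b) * chord (a + b)`. The pairs
`b = a` give the fraction of cells in the range. For `b = -a` the time average does not help, but
the geometric sum does, and these pairs cost at most `1 / √M`. All other pairs together cost `O(M ^
2 / T)`, because the sum of `chord j ^ (-2)` is `O(M ^ 2)`. This is `exists_le_avg_cellsProb`. No
logarithm arises, so the exponent `k = 0` suffices. For BQP the given circuit family itself is used.
-/

theorem onQubit_apply (q : Fin n) (A : Matrix (Fin 2) (Fin 2) ℂ) (z z' : Bits n) :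
    onQubit q A z z' = ∑ v, if z' = Function.update z q v then A (z q) v else 0 := by
  have h : ∀ v, (z' = Function.update z q v) ↔ (∀ r, r ≠ q → z r = z' r) ∧ v = z' q := by
    intro v
    constructor
    · rintro rfl
      refine ⟨fun r hr => by simp [hr], by simp⟩
    · rintro ⟨h1, rfl⟩
      funext r
      by_cases hr : r = q
      · subst hr; simp
      · simp [hr, h1 r hr]
  have h0 : onQubit q A z z' = if ∀ r, r ≠ q → z r = z' r then A (z q) (z' q) else 0 := rfl
  simp only [h0, h]
  by_cases hz : ∀ r, r ≠ q → z r = z' r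
  · rw [if_pos hz, Finset.sum_eq_single (z' q)]
    · rw [if_pos ⟨hz, rfl⟩]
    · exact fun v _ hv => if_neg fun h => hv h.2
    · simp
  · rw [if_neg hz]
    exact (Finset.sum_eq_zero fun v _ => if_neg fun h => hz h.1).symm

theorem onQubit_mulVec (q : Fin n) (A : Matrix (Fin 2) (Fin 2) ℂ) (φ : Bits n → ℂ) (z : Bits n) :
    (onQubit q A *ᵥ φ) z = ∑ v, A (z q) v * φ (Function.update z q v) := by
  simp only [Matrix.mulVec, dotProduct, onQubit_apply, Finset.sum_mul, ite_mul, zero_mul]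
  rw [Finset.sum_comm]
  simp

theorem onQubit_mulVec_mulVec (q : Fin n) (A B : Matrix (Fin 2) (Fin 2) ℂ) (φ : Bits n → ℂ) :
    onQubit q A *ᵥ onQubit q B *ᵥ φ = onQubit q (A * B) *ᵥ φ := by
  funext z
  simp only [onQubit_mulVec, Matrix.mul_apply, Function.update_self, Function.update_idem,
    Fin.sum_univ_two]
  ring

@[simp]
theorem onQubit_one (q : Fin n) : onQubit q (1 : Matrix (Fin 2) (Fin 2) ℂ) = 1 := by
  ext z z'
  by_cases hz : z = z'
  · subst hz; simp [onQubit]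
  · rw [Matrix.one_apply_ne hz, onQubit]
    split_ifs with h
    · refine Matrix.one_apply_ne fun h' => hz (funext fun r => ?_)
      by_cases hr : r = q
      · rw [hr, h']
      · exact h r hr
    · rfl

theorem onQubit_mul (q : Fin n) (A B : Matrix (Fin 2) (Fin 2) ℂ) :
    onQubit q A * onQubit q B = onQubit q (A * B) := by
  apply Matrix.toLin'.injective
  refine LinearMap.ext fun φ => ?_
  simp only [Matrix.toLin'_apply, ← onQubit_mulVec_mulVec, Matrix.mulVec_mulVec]

theorem onQubit_conjTranspose (q : Fin n) (A : Matrix (Fin 2) (Fin 2) ℂ) :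
    (onQubit q A)ᴴ = onQubit q Aᴴ := by
  ext z z'
  simp only [Matrix.conjTranspose_apply, onQubit]
  have : (∀ r, r ≠ q → z' r = z r) ↔ ∀ r, r ≠ q → z r = z' r := by
    simp only [eq_comm]
  simp only [this]
  split_ifs <;> simp

theorem cnotBits_cnotBits {q₁ q₂ : Fin n} (h : q₁ ≠ q₂) (z : Bits n) :
    cnotBits q₁ q₂ (cnotBits q₁ q₂ z) = z := by
  by_cases hz : z q₁ = 1
  · simp [cnotBits, hz, h]
  · simp [cnotBits, hz]

theorem cnotMatrix_mulVec {q₁ q₂ : Fin n} (h : q₁ ≠ q₂) (φ : Bits n → ℂ) (z : Bits n) :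
    (cnotMatrix q₁ q₂ *ᵥ φ) z = φ (cnotBits q₁ q₂ z) := by
  have : ∀ z', (z = cnotBits q₁ q₂ z') ↔ z' = cnotBits q₁ q₂ z := by
    intro z'
    constructor <;> rintro rfl <;> rw [cnotBits_cnotBits h]
  simp [Matrix.mulVec, dotProduct, cnotMatrix, this]

theorem cnotMatrix_mul_self {q₁ q₂ : Fin n} (h : q₁ ≠ q₂) :
    cnotMatrix q₁ q₂ * cnotMatrix q₁ q₂ = 1 := by
  apply Matrix.toLin'.injective
  refine LinearMap.ext fun φ => funext fun z => ?_
  simp [cnotMatrix_mulVec h, cnotBits_cnotBits h]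

theorem cnotMatrix_conjTranspose {q₁ q₂ : Fin n} (h : q₁ ≠ q₂) :
    (cnotMatrix q₁ q₂)ᴴ = cnotMatrix q₁ q₂ := by
  ext z z'
  have : (z' = cnotBits q₁ q₂ z) ↔ z = cnotBits q₁ q₂ z' := by
    constructor <;> rintro rfl <;> rw [cnotBits_cnotBits h]
  simp only [Matrix.conjTranspose_apply, cnotMatrix, this]
  split_ifs <;> simp

theorem unitaryGroup_conjTranspose_mul {m : Type*} [Fintype m] [DecidableEq m]
    (V : Matrix.unitaryGroup m ℂ) : (V : Matrix m m ℂ)ᴴ * V = 1 :=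
  Matrix.mem_unitaryGroup_iff'.1 V.2

theorem unitaryGroup_mul_conjTranspose {m : Type*} [Fintype m] [DecidableEq m]
    (V : Matrix.unitaryGroup m ℂ) : (V : Matrix m m ℂ) * (V : Matrix m m ℂ)ᴴ = 1 :=
  Matrix.mem_unitaryGroup_iff.1 V.2

namespace Gate

theorem segMatrix_conjTranspose_mul (g : Gate n) : g.segMatrixᴴ * g.segMatrix = 1 := by
  cases g with
  | one V q => exact unitaryGroup_conjTranspose_mul V
  | cnot q₁ q₂ h => simp [segMatrix]

theorem segMatrix_mul_conjTranspose (g : Gate n) : g.segMatrix * g.segMatrixᴴ = 1 := by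
  cases g with
  | one V q => exact unitaryGroup_mul_conjTranspose V
  | cnot q₁ q₂ h => simp [segMatrix]

theorem sigmaX_mul_self : sigmaX * sigmaX = 1 := by
  ext i j; fin_cases i <;> fin_cases j <;> simp [sigmaX, Matrix.mul_apply]

theorem sigmaX_conjTranspose : sigmaXᴴ = sigmaX := by
  ext i j; fin_cases i <;> fin_cases j <;> simp [sigmaX]

theorem flip_conjTranspose (g : Gate n) : g.flipᴴ = g.flip := by
  cases g <;> simp [flip, sigmaX_conjTranspose]

theorem flip_mul_self (g : Gate n) : g.flip * g.flip = 1 := by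
  cases g <;> simp [flip, sigmaX_mul_self]

theorem switchUnitary_mul_self (g : Gate n) : g.switchUnitary * g.switchUnitary = 1 := by
  cases g with
  | one V q => simp [switchUnitary]
  | cnot q₁ q₂ h => exact cnotMatrix_mul_self h

theorem switchUnitary_conjTranspose (g : Gate n) : g.switchUnitaryᴴ = g.switchUnitary := by
  cases g with
  | one V q => simp [switchUnitary]
  | cnot q₁ q₂ h => exact cnotMatrix_conjTranspose h

/-- A block has two places where a gate may act, and for each kind of gate one of the two factors is
the identity. -/
theorem unitary_eq (g : Gate n) :
    g.unitary = g.switchUnitary * onQubit g.segQubit g.segMatrix := by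
  cases g <;> simp [unitary, switchUnitary, segMatrix, segQubit]

theorem unitary_conjTranspose_mul (g : Gate n) : g.unitaryᴴ * g.unitary = 1 := by
  rw [unitary_eq, Matrix.conjTranspose_mul, switchUnitary_conjTranspose, Matrix.mul_assoc,
    ← Matrix.mul_assoc g.switchUnitary, switchUnitary_mul_self, Matrix.one_mul,
    onQubit_conjTranspose, onQubit_mul, segMatrix_conjTranspose_mul, onQubit_one]

theorem inv_unitary (g : Gate n) : g.inv.unitary = g.unitaryᴴ := by
  cases g with
  | one V q => simp [inv, unitary, onQubit_conjTranspose, Matrix.star_eq_conjTranspose]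
  | cnot q₁ q₂ h => simp [inv, unitary, cnotMatrix_conjTranspose h]

theorem inv_unitary_mulVec_unitary_mulVec (g : Gate n) (φ : Bits n → ℂ) :
    g.inv.unitary *ᵥ g.unitary *ᵥ φ = φ := by
  rw [inv_unitary, Matrix.mulVec_mulVec, unitary_conjTranspose_mul, Matrix.one_mulVec]

@[simp]
theorem idle_unitary [NeZero n] : (idle : Gate n).unitary = 1 := by
  simp [idle, unitary]

end Gate

/-- An isometry preserves the norm. -/
theorem star_dotProduct_mulVec_self {m : Type*} [Fintype m] [DecidableEq m] {A : Matrix m m ℂ}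
    (hA : Aᴴ * A = 1) (φ : m → ℂ) : star (A *ᵥ φ) ⬝ᵥ (A *ᵥ φ) = star φ ⬝ᵥ φ := by
  rw [Matrix.star_mulVec, ← Matrix.dotProduct_mulVec, Matrix.mulVec_mulVec, hA, Matrix.one_mulVec]

theorem run_nil (φ : Bits n → ℂ) : run [] φ = φ := rfl

theorem run_cons (g : Gate n) (gs : List (Gate n)) (φ : Bits n → ℂ) :
    run (g :: gs) φ = run gs (g.unitary *ᵥ φ) := rfl

theorem run_append (gs gs' : List (Gate n)) (φ : Bits n → ℂ) :
    run (gs ++ gs') φ = run gs' (run gs φ) := by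
  simp [run]

theorem run_normalized (gs : List (Gate n)) {φ : Bits n → ℂ} (hφ : star φ ⬝ᵥ φ = 1) :
    star (run gs φ) ⬝ᵥ run gs φ = 1 := by
  induction gs generalizing φ with
  | nil => exact hφ
  | cons g gs ih =>
    rw [run_cons]
    exact ih (by rw [star_dotProduct_mulVec_self g.unitary_conjTranspose_mul, hφ])

theorem run_reverse_inv (gs : List (Gate n)) (φ : Bits n → ℂ) :
    run (gs.reverse.map Gate.inv) (run gs φ) = φ := by
  induction gs generalizing φ with
  | nil => rfl
  | cons g gs ih =>
    rw [run_cons, List.reverse_cons, List.map_append, run_append, ih]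
    exact g.inv_unitary_mulVec_unitary_mulVec φ

theorem run_replicate_idle [NeZero n] (k : ℕ) (φ : Bits n → ℂ) :
    run (List.replicate k Gate.idle) φ = φ := by
  induction k with
  | zero => rfl
  | succ k ih => rw [List.replicate_succ, run_cons, Gate.idle_unitary, Matrix.one_mulVec, ih]

/-- The inverse of the padding is again made of identity gates, so the two stretches of length `2L`
merge into one of length `4L`. -/
theorem ofFn_ringGate [NeZero n] (gs : List (Gate n)) :
    List.ofFn (ringGate gs) =
      gs ++ List.replicate (4 * gs.length) Gate.idle ++ gs.reverse.map Gate.inv := by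
  apply List.ext_getElem
  · simp; omega
  · intro i h1 h2
    simp only [List.length_ofFn] at h1
    simp only [List.getElem_ofFn, ringGate]
    split_ifs with h h'
    · rw [List.getElem_append_left (by simp; omega), List.getElem_append_left h]
    · rw [List.getElem_append_left (by simp; omega), List.getElem_append_right (by omega)]
      simp
    · rw [List.getElem_append_right (by simp; omega)]
      simp only [List.getElem_map, List.getElem_reverse]
      congr 2
      simp
      omega

theorem run_ofFn_ringGate [NeZero n] (gs : List (Gate n)) (φ : Bits n → ℂ) :
    run (List.ofFn (ringGate gs)) φ = φ := by
  rw [ofFn_ringGate, run_append, run_append, run_replicate_idle, run_reverse_inv]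

theorem workAt_normalized {B : ℕ} (G : Fin B → Gate n) {φ : Bits n → ℂ} (hφ : star φ ⬝ᵥ φ = 1)
    (b : Fin B) : star (workAt G φ b) ⬝ᵥ workAt G φ b = 1 :=
  run_normalized _ hφ

theorem seg_normalized (g : Gate n) {φ : Bits n → ℂ} (hφ : star φ ⬝ᵥ φ = 1) :
    star (onQubit g.segQubit g.segMatrix *ᵥ φ) ⬝ᵥ (onQubit g.segQubit g.segMatrix *ᵥ φ) = 1 := by
  rw [star_dotProduct_mulVec_self, hφ]
  rw [onQubit_conjTranspose, onQubit_mul, g.segMatrix_conjTranspose_mul, onQubit_one]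

theorem switchUnitary_normalized (g : Gate n) {φ : Bits n → ℂ} (hφ : star φ ⬝ᵥ φ = 1) :
    star (g.switchUnitary *ᵥ φ) ⬝ᵥ (g.switchUnitary *ᵥ φ) = 1 := by
  rw [star_dotProduct_mulVec_self, hφ]
  rw [g.switchUnitary_conjTranspose, g.switchUnitary_mul_self]

/-- The block after `b` is entered with the output of block `b`. -/
theorem workAt_next {B : ℕ} (G : Fin B → Gate n) (φ : Bits n → ℂ)
    (hG : run (List.ofFn G) φ = φ) (b : Fin B) :
    workAt G φ (next b) = (G b).switchUnitary *ᵥ switchWorkAt G φ b := by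
  have key : run ((List.ofFn G).take (b + 1)) φ =
      (G b).switchUnitary *ᵥ switchWorkAt G φ b := by
    rw [switchWorkAt, Matrix.mulVec_mulVec, ← Gate.unitary_eq, List.take_add_one, run_append,
      workAt]
    simp [run_cons, run_nil]
  rw [← key, workAt]
  by_cases hb : b.val + 1 = B
  -- After the last block the ring returns to block `0`, which is consistent because the gates of
  -- the ring restore `φ`.
  · rw [List.take_of_length_le (l := List.ofFn G) (i := b + 1) (by simp; omega), hG]
    simp [next, hb, run_nil]
  · have : (next b).val = b + 1 := Nat.mod_eq_of_lt (by omega)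
    rw [this]

/-- Inside the padding the work register holds the output of the circuit. -/
theorem workAt_padding [NeZero n] (gs : List (Gate n)) (φ : Bits n → ℂ) {b : Fin (6 * gs.length)}
    (h1 : gs.length ≤ b.val) (h2 : b.val ≤ 5 * gs.length) :
    workAt (ringGate gs) φ b = run gs φ := by
  rw [workAt, ofFn_ringGate, List.append_assoc, List.take_append, run_append,
    List.take_of_length_le h1, List.take_append_of_le_length (by simp; omega),
    List.take_replicate, run_replicate_idle]

theorem ringGate_padding [NeZero n] (gs : List (Gate n)) {b : Fin (6 * gs.length)}
    (h1 : gs.length ≤ b.val) (h2 : b.val < 5 * gs.length) : ringGate gs b = Gate.idle := by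
  rw [ringGate, dif_neg (by omega), dif_pos h2]

theorem switchWorkAt_padding [NeZero n] (gs : List (Gate n)) (φ : Bits n → ℂ)
    {b : Fin (6 * gs.length)} (h1 : gs.length ≤ b.val) (h2 : b.val < 5 * gs.length) :
    switchWorkAt (ringGate gs) φ b = run gs φ := by
  rw [switchWorkAt, workAt_padding gs φ h1 h2.le, ringGate_padding gs h1 h2]
  simp [Gate.idle, Gate.segMatrix]

end Gates

/-! ### Action of the 2-local terms -/

section Terms

variable {n B : ℕ}

theorem dim_pos (p : Particle n B) : 0 < dim p := by
  rcases p with q | (b | ⟨b, j⟩ | b | ⟨b, u, j⟩) <;> simp only [dim] <;> (try split) <;> norm_num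

theorem dim_eq_two_or_three (p : Particle n B) : dim p = 2 ∨ dim p = 3 := by
  rcases p with q | (b | ⟨b, j⟩ | b | ⟨b, u, j⟩) <;> simp only [dim] <;> (try split) <;> simp

theorem mulVec_apply {m k : Type*} [Fintype k] (A : Matrix m k ℂ) (v : k → ℂ) (x : m) :
    (A *ᵥ v) x = ∑ y, A x y * v y := rfl

/-- The state of the work qubit `q`. -/
def workBit (x : Cfg n B) (q : Fin n) : Fin 2 := x (.inl q)

/-- Put the clock site `s` into the state `α`. -/
def setClock (x : Cfg n B) (s : Site B) (α : ℕ) : Cfg n B :=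
  Function.update x (.inr s) ⟨α % dim (.inr s : Particle n B), Nat.mod_lt _ (dim_pos _)⟩

/-- Put the work qubit `q` into the state `v`. -/
def setWork (x : Cfg n B) (q : Fin n) (v : Fin 2) : Cfg n B :=
  Function.update x (.inl q) v

theorem setClock_self (x : Cfg n B) {s : Site B} {α : ℕ} (h : α < dim (.inr s : Particle n B)) :
    (setClock x s α (.inr s)).val = α := by
  simp [setClock, Nat.mod_eq_of_lt h]

theorem setClock_ne (x : Cfg n B) {s : Site B} {α : ℕ} {p : Particle n B} (h : p ≠ .inr s) :
    setClock x s α p = x p := by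
  simp [setClock, h]

theorem workBit_setWork (x : Cfg n B) (q : Fin n) (v : Fin 2) : workBit (setWork x q v) q = v :=
  Function.update_self (β := fun p : Particle n B => Fin (dim p)) _ _ _

theorem setWork_ne (x : Cfg n B) {q : Fin n} {v : Fin 2} {p : Particle n B} (h : p ≠ .inl q) :
    setWork x q v p = x p :=
  Function.update_of_ne h _ _

theorem workBit_setClock (x : Cfg n B) (s : Site B) (α : ℕ) (q : Fin n) :
    workBit (setClock x s α) q = workBit x q :=
  setClock_ne _ (by simp)

theorem setClock_setClock (x : Cfg n B) (s : Site B) (α β : ℕ) :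
    setClock (setClock x s α) s β = setClock x s β := by
  simp [setClock]

theorem setClock_comm (x : Cfg n B) {s s' : Site B} (h : s ≠ s') (α β : ℕ) :
    setClock (setClock x s α) s' β = setClock (setClock x s' β) s α :=
  Function.update_comm (by simpa using h) _ _ _

theorem setClock_setWork (x : Cfg n B) (s : Site B) (q : Fin n) (α : ℕ) (v : Fin 2) :
    setClock (setWork x q v) s α = setWork (setClock x s α) q v := by
  exact Function.update_comm (by simp) _ _ _

theorem setWork_setWork (x : Cfg n B) (q : Fin n) (v w : Fin 2) :
    setWork (setWork x q v) q w = setWork x q w :=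
  Function.update_idem (β := fun p : Particle n B => Fin (dim p)) _ _ _

theorem setClock_eq_self {x : Cfg n B} {s : Site B} {α : ℕ} (h : (x (.inr s)).val = α) :
    setClock x s α = x := by
  rw [setClock, Function.update_eq_iff]
  refine ⟨Fin.ext ?_, fun _ _ => rfl⟩
  rw [← h]
  exact Nat.mod_eq_of_lt (x (.inr s)).isLt

theorem setWork_eq_self (x : Cfg n B) (q : Fin n) : setWork x q (workBit x q) = x :=
  Function.update_eq_self _ _

/-- The two sites of a hop, and their active states, are admissible. -/
structure HopOK (n : ℕ) (s : Site B) (α : ℕ) (s' : Site B) (β : ℕ) : Prop where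
  ne : s ≠ s'
  left_ne : α ≠ 0
  right_ne : β ≠ 0
  left_lt : α < dim (.inr s : Particle n B)
  right_lt : β < dim (.inr s' : Particle n B)

theorem hop_apply (s : Site B) (α : ℕ) (s' : Site B) (β : ℕ) (x y : Cfg n B) :
    hop s α s' β x y =
    if (∀ p : Particle n B, p ≠ .inr s → p ≠ .inr s' → x p = y p) ∧
      (((y (.inr s)).val = α ∧ (y (.inr s')).val = 0 ∧
          (x (.inr s)).val = 0 ∧ (x (.inr s')).val = β) ∨
        ((x (.inr s)).val = α ∧ (x (.inr s')).val = 0 ∧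
          (y (.inr s)).val = 0 ∧ (y (.inr s')).val = β))
    then 1 else 0 := rfl

theorem flipTerm_apply (q : Fin n) (A : Matrix (Fin 2) (Fin 2) ℂ) (s : Site B) (x y : Cfg n B) :
    flipTerm q A s x y =
    if ∀ p : Particle n B, p ≠ .inl q → p ≠ .inr s → x p = y p then
      if (y (.inr s)).val = 1 ∧ (x (.inr s)).val = 2 then A (workBit x q) (workBit y q)
      else if (y (.inr s)).val = 2 ∧ (x (.inr s)).val = 1 then Aᴴ (workBit x q) (workBit y q)
      else 0
    else 0 := rfl

/-- For each row of a hop this singles out the only column with a nonzero entry, so that the sum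
over configurations collapses to one value of the state. -/
theorem eq_setClock_setClock_iff {s s' : Site B} {α β : ℕ} (hs : s ≠ s')
    (hα : α < dim (.inr s : Particle n B)) (hβ : β < dim (.inr s' : Particle n B))
    (x y : Cfg n B) :
    y = setClock (setClock x s α) s' β ↔
      (∀ p : Particle n B, p ≠ .inr s → p ≠ .inr s' → x p = y p) ∧
        (y (.inr s)).val = α ∧ (y (.inr s')).val = β := by
  have hs' : (.inr s : Particle n B) ≠ .inr s' := by simpa using hs
  constructor
  · rintro rfl
    refine ⟨fun p h1 h2 => by rw [setClock_ne _ h2, setClock_ne _ h1], ?_, setClock_self _ hβ⟩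
    rw [setClock_ne _ hs', setClock_self _ hα]
  · rintro ⟨h1, h2, h3⟩
    funext p
    by_cases hp : p = .inr s'
    · subst hp
      exact Fin.ext (by rw [setClock_self _ hβ, h3])
    · rw [setClock_ne _ hp]
      by_cases hp' : p = .inr s
      · subst hp'
        exact Fin.ext (by rw [setClock_self _ hα, h2])
      · rw [setClock_ne _ hp', h1 p hp' hp]

theorem eq_setClock_setWork_iff {s : Site B} {q : Fin n} {α : ℕ} {v : Fin 2}
    (hα : α < dim (.inr s : Particle n B)) (x y : Cfg n B) :
    y = setClock (setWork x q v) s α ↔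
      (∀ p : Particle n B, p ≠ .inl q → p ≠ .inr s → x p = y p) ∧
        v = workBit y q ∧ (y (.inr s)).val = α := by
  constructor
  · rintro rfl
    refine ⟨fun p h1 h2 => by rw [setClock_ne _ h2, setWork_ne _ h1], ?_, setClock_self _ hα⟩
    rw [workBit_setClock, workBit_setWork]
  · rintro ⟨h1, h2, h3⟩
    funext p
    by_cases hp : p = .inr s
    · subst hp
      exact Fin.ext (by rw [setClock_self _ hα, h3])
    · rw [setClock_ne _ hp]
      by_cases hp' : p = .inl q
      · subst hp'
        exact h2.symm.trans (workBit_setWork x q v).symm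
      · rw [setWork_ne _ hp', h1 p hp' hp]

/-- The conditions `α ≠ 0` and `β ≠ 0` make the two directions of the hop exclusive: a row belongs
to at most one of them. -/
theorem hop_mulVec {s s' : Site B} {α β : ℕ} (h : HopOK n s α s' β) (Ψ : Cfg n B → ℂ)
    (x : Cfg n B) :
    ((hop s α s' β : Op n B) *ᵥ Ψ) x =
      if (x (.inr s)).val = 0 ∧ (x (.inr s')).val = β then
        Ψ (setClock (setClock x s α) s' 0)
      else if (x (.inr s)).val = α ∧ (x (.inr s')).val = 0 then
        Ψ (setClock (setClock x s 0) s' β)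
      else 0 := by
  have e1 := eq_setClock_setClock_iff (n := n) h.ne h.left_lt (dim_pos (.inr s')) x
  have e2 := eq_setClock_setClock_iff (n := n) h.ne (dim_pos (.inr s)) h.right_lt x
  have h0 := h.left_ne
  have h0' := h.right_ne
  simp only [mulVec_apply, hop_apply]
  split_ifs with h1 h2
  · rw [Finset.sum_eq_single (setClock (setClock x s α) s' 0)]
    · rw [if_pos, one_mul]
      obtain ⟨a, b, c⟩ := (e1 _).1 rfl
      exact ⟨a, Or.inl ⟨b, c, h1.1, h1.2⟩⟩
    · intro y _ hy
      rw [if_neg, zero_mul]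
      rintro ⟨a, ⟨b, c, -⟩ | ⟨b, -⟩⟩
      · exact hy ((e1 y).2 ⟨a, b, c⟩)
      · omega
    · simp
  · rw [Finset.sum_eq_single (setClock (setClock x s 0) s' β)]
    · rw [if_pos, one_mul]
      obtain ⟨a, b, c⟩ := (e2 _).1 rfl
      exact ⟨a, Or.inr ⟨h2.1, h2.2, b, c⟩⟩
    · intro y _ hy
      rw [if_neg, zero_mul]
      rintro ⟨a, ⟨-, -, b, -⟩ | ⟨-, -, b, c⟩⟩
      · omega
      · exact hy ((e2 y).2 ⟨a, b, c⟩)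
    · simp
  · refine Finset.sum_eq_zero fun y _ => ?_
    rw [if_neg, zero_mul]
    rintro ⟨a, ⟨-, -, b, c⟩ | ⟨b, c, -⟩⟩
    · exact h1 ⟨b, c⟩
    · exact h2 ⟨b, c⟩

theorem flipTerm_mulVec {q : Fin n} (A : Matrix (Fin 2) (Fin 2) ℂ) {s : Site B}
    (hs : dim (.inr s : Particle n B) = 3) (Ψ : Cfg n B → ℂ) (x : Cfg n B) :
    (flipTerm q A s *ᵥ Ψ) x =
      if (x (.inr s)).val = 2 then ∑ v, A (workBit x q) v * Ψ (setClock (setWork x q v) s 1)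
      else if (x (.inr s)).val = 1 then
        ∑ v, Aᴴ (workBit x q) v * Ψ (setClock (setWork x q v) s 2)
      else 0 := by
  have key : ∀ (A' : Matrix (Fin 2) (Fin 2) ℂ) (α : ℕ), α < 3 →
      (∑ y : Cfg n B, (if (∀ p : Particle n B, p ≠ .inl q → p ≠ .inr s → x p = y p) ∧
        (y (.inr s)).val = α then A' (workBit x q) (workBit y q) else 0) * Ψ y) =
      ∑ v, A' (workBit x q) v * Ψ (setClock (setWork x q v) s α) := by
    intro A' α hα
    have e := fun v y => eq_setClock_setWork_iff (q := q) (v := v) (hs ▸ hα) x y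
    have : ∀ y : Cfg n B, (if (∀ p : Particle n B, p ≠ .inl q → p ≠ .inr s → x p = y p) ∧
        (y (.inr s)).val = α then A' (workBit x q) (workBit y q) else 0) * Ψ y =
        ∑ v, if y = setClock (setWork x q v) s α then A' (workBit x q) v * Ψ y else 0 := by
      intro y
      simp only [e]
      by_cases h1 : (∀ p : Particle n B, p ≠ .inl q → p ≠ .inr s → x p = y p) ∧
        (y (.inr s)).val = α
      · rw [if_pos h1, Finset.sum_eq_single (workBit y q)]
        · rw [if_pos ⟨h1.1, rfl, h1.2⟩]
        · exact fun v _ hv => if_neg fun h => hv h.2.1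
        · simp
      · rw [if_neg h1, zero_mul]
        exact (Finset.sum_eq_zero fun v _ => if_neg fun h => h1 ⟨h.1, h.2.2⟩).symm
    simp only [this]
    rw [Finset.sum_comm]
    exact Finset.sum_congr rfl fun v _ => by simp
  rw [mulVec_apply]
  split_ifs with h1 h2
  · rw [← key A 1 (by norm_num)]
    refine Finset.sum_congr rfl fun y _ => ?_
    rw [flipTerm_apply]
    simp only [h1, and_true, ite_and]
    simp
  · rw [← key Aᴴ 2 (by norm_num)]
    refine Finset.sum_congr rfl fun y _ => ?_
    rw [flipTerm_apply]
    simp only [h2, and_true, ite_and]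
    simp
  · simp [flipTerm_apply, h1, h2]

/-! ### Locality, hermiticity and norm of the terms -/

theorem isHermitian_hop (s : Site B) (α : ℕ) (s' : Site B) (β : ℕ) :
    (hop s α s' β : Op n B).IsHermitian := by
  ext x y
  rw [Matrix.conjTranspose_apply, hop_apply, hop_apply]
  simp only [eq_comm (a := x _) (b := y _), apply_ite star, star_one, star_zero]
  congr 1
  rw [eq_iff_iff]
  tauto

theorem isHermitian_flipTerm (q : Fin n) (A : Matrix (Fin 2) (Fin 2) ℂ) (s : Site B) :
    (flipTerm q A s : Op n B).IsHermitian := by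
  ext x y
  rw [Matrix.conjTranspose_apply, flipTerm_apply, flipTerm_apply]
  simp only [eq_comm (a := x _) (b := y _)]
  by_cases h : ∀ p : Particle n B, p ≠ .inl q → p ≠ .inr s → y p = x p
  · rw [if_pos h, if_pos h]
    by_cases h1 : (x (.inr s)).val = 1 ∧ (y (.inr s)).val = 2
    · rw [if_pos h1, if_neg (by omega), if_pos h1.symm, Matrix.conjTranspose_apply]
    · rw [if_neg h1]
      by_cases h2 : (x (.inr s)).val = 2 ∧ (y (.inr s)).val = 1
      · rw [if_pos h2, if_pos h2.symm, Matrix.conjTranspose_apply, star_star]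
      · rw [if_neg h2, if_neg (by tauto), if_neg (by tauto), star_zero]
  · rw [if_neg h, if_neg h, star_zero]

theorem isLocalOn_hop (s : Site B) (α : ℕ) (s' : Site B) (β : ℕ) :
    IsLocalOn {.inr s, .inr s'} (hop s α s' β : Op n B) := by
  constructor
  · rintro x y ⟨p, hp, hxy⟩
    simp only [Set.mem_insert_iff, Set.mem_singleton_iff, not_or] at hp
    rw [hop_apply, if_neg fun h => hxy (h.1 p hp.1 hp.2)]
  · intro x y x' y' h1 h2 h3
    simp only [Set.mem_insert_iff, Set.mem_singleton_iff, not_or, forall_eq_or_imp, forall_eq,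
      and_imp] at h1 h2 h3
    rw [hop_apply, hop_apply, h3.1.1, h3.1.2, h3.2.1, h3.2.2]
    exact if_congr (and_congr (iff_of_true h1 h2) Iff.rfl) rfl rfl

theorem isLocalOn_flipTerm (q : Fin n) (A : Matrix (Fin 2) (Fin 2) ℂ) (s : Site B) :
    IsLocalOn {.inl q, .inr s} (flipTerm q A s : Op n B) := by
  constructor
  · rintro x y ⟨p, hp, hxy⟩
    simp only [Set.mem_insert_iff, Set.mem_singleton_iff, not_or] at hp
    rw [flipTerm_apply, if_neg fun h => hxy (h p hp.1 hp.2)]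
  · intro x y x' y' h1 h2 h3
    simp only [Set.mem_insert_iff, Set.mem_singleton_iff, not_or, forall_eq_or_imp, forall_eq,
      and_imp] at h1 h2 h3
    have e1 : workBit x q = workBit x' q := h3.1.1
    have e2 : workBit y q = workBit y' q := h3.1.2
    rw [flipTerm_apply, flipTerm_apply, e1, e2, h3.2.1, h3.2.2]
    exact if_congr (iff_of_true h1 h2) rfl rfl

/-- A Hermitian matrix whose square is diagonal with entries between `0` and `1` is a contraction
of the Euclidean space. -/
theorem norm_toEuclideanCLM_le_one {m : Type*} [Fintype m] [DecidableEq m] {A : Matrix m m ℂ}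
    (hA : A.IsHermitian) (r : m → ℝ) (hr : ∀ x, r x ≤ 1)
    (h : ∀ (v : m → ℂ) (x : m), (A *ᵥ A *ᵥ v) x = r x * v x) :
    ‖Matrix.toEuclideanCLM (𝕜 := ℂ) A‖ ≤ 1 := by
  refine ContinuousLinearMap.opNorm_le_bound _ zero_le_one fun v => ?_
  rw [one_mul]
  refine le_of_sq_le_sq ?_ (norm_nonneg _)
  have e : ∀ w : EuclideanSpace ℂ m, ((‖w‖ ^ 2 : ℝ) : ℂ) = star w.ofLp ⬝ᵥ w.ofLp := by
    intro w
    rw [EuclideanSpace.norm_sq_eq]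
    push_cast
    refine Finset.sum_congr rfl fun i _ => ?_
    rw [← Complex.conj_mul']
    rfl
  -- Hermiticity turns the squared norm of `A v` into the expectation of `A ^ 2` in `v`, and `A ^ 2`
  -- is diagonal.
  have h1 : ((‖Matrix.toEuclideanCLM (𝕜 := ℂ) A v‖ ^ 2 : ℝ) : ℂ) =
      ((∑ x, r x * ‖v.ofLp x‖ ^ 2 : ℝ) : ℂ) := by
    rw [e, Matrix.ofLp_toEuclideanCLM, Matrix.star_mulVec, ← Matrix.dotProduct_mulVec, hA.eq]
    push_cast
    refine Finset.sum_congr rfl fun i _ => ?_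
    rw [h, ← Complex.conj_mul']
    simp only [Pi.star_apply, RCLike.star_def]
    ring
  rw [Complex.ofReal_inj.1 h1, EuclideanSpace.norm_sq_eq]
  exact Finset.sum_le_sum fun x _ => mul_le_of_le_one_left (by positivity) (hr x)

/-- A hop exchanges two groups of basis vectors and kills the others, so its square is a diagonal
projector. -/
theorem norm_hop_le {s s' : Site B} {α β : ℕ} (h : HopOK n s α s' β) :
    ‖Matrix.toEuclideanCLM (𝕜 := ℂ) (hop s α s' β : Op n B)‖ ≤ 1 := by
  refine norm_toEuclideanCLM_le_one (isHermitian_hop s α s' β)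
    (fun x => if (x (.inr s)).val = 0 ∧ (x (.inr s')).val = β ∨
      (x (.inr s)).val = α ∧ (x (.inr s')).val = 0 then 1 else 0)
    (fun x => by split_ifs <;> norm_num) fun v x => ?_
  have hs : (.inr s : Particle n B) ≠ .inr s' := by simpa using h.ne
  have h0 := h.left_ne
  have h0' := h.right_ne
  have e : ∀ γ δ γ' δ', setClock (setClock (setClock (setClock x s γ) s' δ) s γ') s' δ' =
      setClock (setClock x s γ') s' δ' := by
    intro γ δ γ' δ'
    rw [setClock_comm _ h.ne γ δ, setClock_setClock, setClock_comm _ h.ne.symm, setClock_setClock]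
  rw [hop_mulVec h]
  split_ifs with h1 h2 h3 h4
  · rw [hop_mulVec h, if_neg, if_pos, e, setClock_eq_self h1.1, setClock_eq_self h1.2]
    · simp
    · rw [setClock_self _ (dim_pos _), setClock_ne _ hs, setClock_self _ h.left_lt]
      exact ⟨rfl, rfl⟩
    · rw [setClock_self _ (dim_pos _)]
      omega
  · tauto
  · rw [hop_mulVec h, if_pos, e, setClock_eq_self h3.1, setClock_eq_self h3.2]
    · simp
    · rw [setClock_self _ h.right_lt, setClock_ne _ hs, setClock_self _ (dim_pos _)]
      exact ⟨rfl, rfl⟩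
  · tauto
  · tauto
  · simp

/-- The square acts as `A * Aᴴ` on the state `R` of the qutrit, as `Aᴴ * A` on `L`, and as zero on
the inactive state. Allowing diagonal products instead of the identity covers the projectors of the
switch as well as the unitaries. -/
theorem norm_flipTerm_le {q : Fin n} {A : Matrix (Fin 2) (Fin 2) ℂ} {s : Site B}
    (hs : dim (.inr s : Particle n B) = 3) {d d' : Fin 2 → ℝ} (hd : ∀ v, d v ≤ 1)
    (hd' : ∀ v, d' v ≤ 1) (hA : A * Aᴴ = Matrix.diagonal fun v => (d v : ℂ))
    (hA' : Aᴴ * A = Matrix.diagonal fun v => (d' v : ℂ)) :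
    ‖Matrix.toEuclideanCLM (𝕜 := ℂ) (flipTerm q A s : Op n B)‖ ≤ 1 := by
  refine norm_toEuclideanCLM_le_one (isHermitian_flipTerm q A s)
    (fun x => if (x (.inr s)).val = 2 then d (workBit x q) else
      if (x (.inr s)).val = 1 then d' (workBit x q) else 0)
    (fun x => by split_ifs <;> simp [hd, hd']) fun v x => ?_
  have h1 : 1 < dim (.inr s : Particle n B) := by omega
  have h2 : 2 < dim (.inr s : Particle n B) := by omega
  have e : ∀ w w' γ γ', setClock (setWork (setClock (setWork x q w) s γ) q w') s γ' =
      setClock (setWork x q w') s γ' := by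
    intro w w' γ γ'
    rw [← setClock_setWork, setWork_setWork, setClock_setClock]
  have key : ∀ (A A' : Matrix (Fin 2) (Fin 2) ℂ) (d : Fin 2 → ℝ) (γ γ' : ℕ),
      A * A' = Matrix.diagonal (fun v => (d v : ℂ)) → (x (.inr s)).val = γ' →
      ∑ w, A (workBit x q) w * ∑ w', A' w w' *
        v (setClock (setWork (setClock (setWork x q w) s γ) q w') s γ') =
      d (workBit x q) * v x := by
    intro A A' d γ γ' hA hγ
    simp only [e, Finset.mul_sum, ← mul_assoc]
    rw [Finset.sum_comm]
    simp only [← Finset.sum_mul, ← Matrix.mul_apply, hA]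
    rw [Finset.sum_eq_single (workBit x q)]
    · rw [Matrix.diagonal_apply_eq, setWork_eq_self, setClock_eq_self hγ]
    · intro w _ hw
      rw [Matrix.diagonal_apply_ne _ (Ne.symm hw), zero_mul]
    · simp
  have e' : ∀ w γ, workBit (setClock (setWork x q w) s γ) q = w := by
    intro w γ
    rw [workBit_setClock, workBit_setWork]
  rw [flipTerm_mulVec A hs]
  split_ifs with h3 h4
  · rw [← key A Aᴴ d 1 2 hA h3]
    refine Finset.sum_congr rfl fun w _ => ?_
    rw [flipTerm_mulVec A hs, if_neg, if_pos, e']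
    · rw [setClock_self _ h1]
    · rw [setClock_self _ h1]; norm_num
  · rw [← key Aᴴ A d' 2 1 hA' h4]
    refine Finset.sum_congr rfl fun w _ => ?_
    rw [flipTerm_mulVec A hs, if_pos, e']
    rw [setClock_self _ h2]
  · simp

/-- The properties that every term of the Hamiltonian has. -/
def IsGoodTerm (A : Op n B) : Prop :=
  A.IsHermitian ∧ ‖Matrix.toEuclideanCLM (𝕜 := ℂ) A‖ ≤ 1 ∧ IsTwoLocalQubitQutrit A

theorem isGoodTerm_hop {s s' : Site B} {α β : ℕ} (h : HopOK n s α s' β)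
    (hd : dim (.inr s : Particle n B) = 2 ∨ dim (.inr s' : Particle n B) = 2) :
    IsGoodTerm (hop s α s' β : Op n B) := by
  refine ⟨isHermitian_hop _ _ _ _, norm_hop_le h, ?_⟩
  rcases hd with hd | hd
  · exact ⟨.inr s, .inr s', hd, dim_eq_two_or_three _, isLocalOn_hop _ _ _ _⟩
  · exact ⟨.inr s', .inr s, hd, dim_eq_two_or_three _, by
      rw [Set.pair_comm]; exact isLocalOn_hop _ _ _ _⟩

theorem isGoodTerm_flipTerm {q : Fin n} {A : Matrix (Fin 2) (Fin 2) ℂ} {s : Site B}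
    (hs : dim (.inr s : Particle n B) = 3) {d d' : Fin 2 → ℝ} (hd : ∀ v, d v ≤ 1)
    (hd' : ∀ v, d' v ≤ 1) (hA : A * Aᴴ = Matrix.diagonal fun v => (d v : ℂ))
    (hA' : Aᴴ * A = Matrix.diagonal fun v => (d' v : ℂ)) :
    IsGoodTerm (flipTerm q A s : Op n B) :=
  ⟨isHermitian_flipTerm _ _ _, norm_flipTerm_le hs hd hd' hA hA',
    .inl q, .inr s, rfl, Or.inr hs, isLocalOn_flipTerm _ _ _⟩

theorem isGoodTerm_flipTerm_of_unitary {q : Fin n} {A : Matrix (Fin 2) (Fin 2) ℂ} {s : Site B}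
    (hs : dim (.inr s : Particle n B) = 3) (hA : A * Aᴴ = 1) (hA' : Aᴴ * A = 1) :
    IsGoodTerm (flipTerm q A s : Op n B) :=
  isGoodTerm_flipTerm (d := 1) (d' := 1) hs (by simp) (by simp) (by simp [hA]) (by simp [hA'])

theorem ketbra0_conjTranspose : ketbra0ᴴ = ketbra0 := by
  ext i j; fin_cases i <;> fin_cases j <;> simp [ketbra0]

theorem ketbra1_conjTranspose : ketbra1ᴴ = ketbra1 := by
  ext i j; fin_cases i <;> fin_cases j <;> simp [ketbra1]

theorem ketbra0_mul_self :
    ketbra0 * ketbra0 = Matrix.diagonal fun v => ((![1, 0] v : ℝ) : ℂ) := by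
  ext i j; fin_cases i <;> fin_cases j <;> simp [ketbra0, Matrix.mul_apply]

theorem ketbra1_mul_self :
    ketbra1 * ketbra1 = Matrix.diagonal fun v => ((![0, 1] v : ℝ) : ℂ) := by
  ext i j; fin_cases i <;> fin_cases j <;> simp [ketbra1, Matrix.mul_apply]

theorem isGoodTerm_flipTerm_ketbra0 {q : Fin n} {s : Site B}
    (hs : dim (.inr s : Particle n B) = 3) : IsGoodTerm (flipTerm q ketbra0 s : Op n B) :=
  isGoodTerm_flipTerm (d := ![1, 0]) (d' := ![1, 0]) hs
    (fun v => by fin_cases v <;> simp) (fun v => by fin_cases v <;> simp)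
    (by rw [ketbra0_conjTranspose, ketbra0_mul_self])
    (by rw [ketbra0_conjTranspose, ketbra0_mul_self])

theorem isGoodTerm_flipTerm_ketbra1 {q : Fin n} {s : Site B}
    (hs : dim (.inr s : Particle n B) = 3) : IsGoodTerm (flipTerm q ketbra1 s : Op n B) :=
  isGoodTerm_flipTerm (d := ![0, 1]) (d' := ![0, 1]) hs
    (fun v => by fin_cases v <;> simp) (fun v => by fin_cases v <;> simp)
    (by rw [ketbra1_conjTranspose, ketbra1_mul_self])
    (by rw [ketbra1_conjTranspose, ketbra1_mul_self])

theorem isGoodTerm_segTerms (g : Gate n) (b : Fin B) : ∀ A ∈ segTerms g b, IsGoodTerm A := by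
  simp only [segTerms, List.forall_mem_cons, List.not_mem_nil, false_imp_iff, implies_true,
    and_true]
  refine ⟨?_, ?_, ?_, ?_, isGoodTerm_flipTerm_of_unitary (by simp [dim])
    g.segMatrix_mul_conjTranspose g.segMatrix_conjTranspose_mul, ?_, ?_, ?_, ?_⟩ <;>
  exact isGoodTerm_hop ⟨by simp, by simp, by simp, by simp [dim], by simp [dim]⟩ (by simp [dim])

theorem isGoodTerm_trackTerms (g : Gate n) (b : Fin B) (up : Bool)
    {P W : Matrix (Fin 2) (Fin 2) ℂ}
    (hP : ∀ s : Site B, dim (.inr s : Particle n B) = 3 → IsGoodTerm (flipTerm g.control P s))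
    (hW : W * Wᴴ = 1) (hW' : Wᴴ * W = 1) :
    ∀ A ∈ trackTerms g b up P W, IsGoodTerm A := by
  simp only [trackTerms, List.forall_mem_cons, List.not_mem_nil, false_imp_iff, implies_true,
    and_true]
  refine ⟨?_, hP _ (by simp [dim]), ?_, ?_, isGoodTerm_flipTerm_of_unitary (by simp [dim]) hW hW',
    ?_, ?_, hP _ (by simp [dim]), ?_⟩ <;>
  exact isGoodTerm_hop ⟨by simp, by simp, by simp, by simp [dim], by simp [dim]⟩ (by simp [dim])

theorem isGoodTerm_ringTerms (G : Fin B → Gate n) : ∀ A ∈ ringTerms G, IsGoodTerm A := by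
  intro A hA
  simp only [ringTerms, switchTerms, List.mem_flatMap, List.mem_append] at hA
  obtain ⟨b, -, hA | hA | hA⟩ := hA
  · exact isGoodTerm_segTerms _ _ A hA
  · exact isGoodTerm_trackTerms _ _ _ (fun s hs => isGoodTerm_flipTerm_ketbra1 hs)
      (by rw [Gate.flip_conjTranspose, Gate.flip_mul_self])
      (by rw [Gate.flip_conjTranspose, Gate.flip_mul_self]) A hA
  · exact isGoodTerm_trackTerms _ _ _ (fun s hs => isGoodTerm_flipTerm_ketbra0 hs)
      (by simp) (by simp) A hA

theorem length_ringTerms (G : Fin B → Gate n) : (ringTerms G).length = 27 * B := by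
  simp [ringTerms, segTerms, switchTerms, trackTerms, List.length_flatMap, mul_comm]

/-- The clock sites as a sum type. -/
def siteEquiv (B : ℕ) : Site B ≃ Fin B ⊕ (Fin B × Fin 7) ⊕ Fin B ⊕ (Fin B × Bool × Fin 5) where
  toFun
    | .a b => .inl b
    | .s b j => .inr (.inl (b, j))
    | .c b => .inr (.inr (.inl b))
    | .g b u j => .inr (.inr (.inr (b, u, j)))
  invFun
    | .inl b => .a b
    | .inr (.inl (b, j)) => .s b j
    | .inr (.inr (.inl b)) => .c b
    | .inr (.inr (.inr (b, u, j))) => .g b u j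
  left_inv s := by cases s <;> rfl
  right_inv s := by rcases s with _ | _ | _ | _ <;> rfl

theorem card_site (B : ℕ) : Fintype.card (Site B) = 19 * B := by
  rw [Fintype.card_congr (siteEquiv B)]
  simp
  ring

end Terms

/-! ### Action of the terms on states with a single active clock site -/

section Action

variable {n B : ℕ}

/-- The state of the clock register. -/
def clock (x : Cfg n B) (s : Site B) : ℕ := (x (.inr s)).val

theorem clock_setClock (x : Cfg n B) {s : Site B} {α : ℕ} (h : α < dim (.inr s : Particle n B)) :
    clock (setClock x s α) = Function.update (clock x) s α := by
  funext s'
  by_cases hs : s' = s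
  · subst hs
    simp [clock, setClock_self _ h]
  · simp [clock, hs, setClock_ne]

theorem clock_setWork (x : Cfg n B) (q : Fin n) (v : Fin 2) : clock (setWork x q v) = clock x := by
  funext s
  simp [clock, setWork_ne]

theorem workBit_setWork_eq (x : Cfg n B) (q : Fin n) (v : Fin 2) :
    workBit (setWork x q v) = Function.update (workBit x) q v := by
  funext r
  by_cases hr : r = q
  · subst hr
    simp [workBit_setWork]
  · have : workBit (setWork x q v) r = workBit x r := setWork_ne x (by simpa using hr)
    rw [this, Function.update_of_ne hr]

theorem workBit_setClock_eq (x : Cfg n B) (s : Site B) (α : ℕ) :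
    workBit (setClock x s α) = workBit x :=
  funext fun q => workBit_setClock x s α q

theorem posState_apply (φ : Bits n → ℂ) (s : Site B) (α : ℕ) (x : Cfg n B) :
    posState φ s α x = if clock x = Pi.single s α then φ (workBit x) else 0 := by
  have : (∀ s', (x (.inr s')).val = if s' = s then α else 0) ↔ clock x = Pi.single s α := by
    rw [funext_iff]
    simp only [Pi.single_apply]
    rfl
  rw [posState]
  exact if_congr this rfl rfl

theorem posState_add (φ ψ : Bits n → ℂ) (s : Site B) (α : ℕ) :
    posState (φ + ψ) s α = posState φ s α + posState ψ s α := by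
  funext x
  simp only [posState_apply, Pi.add_apply]
  split_ifs <;> simp

theorem posState_zero (s : Site B) (α : ℕ) : posState (0 : Bits n → ℂ) s α = 0 := by
  funext x
  simp [posState_apply]

/-- The new value at `s` is nonzero, so `s` must be the one active site after the update; before it,
only `s'` was active. This is the clock part of a hop on a state with one active site, and the
opposite direction follows by exchanging the two sites. -/
theorem update_update_eq_single_iff {S : Type*} [DecidableEq S] {X : S → ℕ} {s s' t : S}
    {α β γ : ℕ} (hs : s ≠ s') (h0 : α ≠ 0) :
    ((X s = 0 ∧ X s' = β) ∧ Function.update (Function.update X s α) s' 0 = Pi.single t γ) ↔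
      (t = s ∧ γ = α) ∧ X = Pi.single s' β := by
  constructor
  · rintro ⟨⟨a, b⟩, d⟩
    have d1 := congr_fun d s
    rw [Function.update_of_ne hs, Function.update_self] at d1
    have ht : t = s := by
      by_contra ht
      rw [Pi.single_eq_of_ne (Ne.symm ht)] at d1
      exact h0 d1
    subst ht
    rw [Pi.single_eq_same] at d1
    refine ⟨⟨rfl, d1.symm⟩, funext fun u => ?_⟩
    by_cases hu : u = s'
    · rw [hu, b, Pi.single_eq_same]
    · rw [Pi.single_eq_of_ne hu]
      by_cases hu' : u = t
      · rw [hu', a]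
      · have := congr_fun d u
        rwa [Function.update_of_ne hu, Function.update_of_ne hu', Pi.single_eq_of_ne hu'] at this
  · rintro ⟨⟨rfl, rfl⟩, rfl⟩
    refine ⟨⟨Pi.single_eq_of_ne hs _, Pi.single_eq_same _ _⟩, funext fun u => ?_⟩
    by_cases hu : u = s'
    · subst hu
      rw [Function.update_self, Pi.single_eq_of_ne hs.symm]
    · rw [Function.update_of_ne hu]
      by_cases hu' : u = t
      · subst hu'
        rw [Function.update_self, Pi.single_eq_same]
      · rw [Function.update_of_ne hu', Pi.single_eq_of_ne hu, Pi.single_eq_of_ne hu']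

/-- Bridges the nested conditional of `hop_mulVec` and the sum in `hop_mulVec_posState`; the
exclusiveness of the two branches allows the sum. -/
theorem ite_ite_eq_add {p₁ p₂ q₁ q₂ a₁ a₂ b₁ b₂ : Prop} [Decidable p₁] [Decidable p₂]
    [Decidable q₁] [Decidable q₂] [Decidable a₁] [Decidable a₂] [Decidable b₁] [Decidable b₂]
    (h : p₁ → ¬p₂) (h₁ : p₁ ∧ a₁ ↔ q₁ ∧ b₁) (h₂ : p₂ ∧ a₂ ↔ q₂ ∧ b₂) (c : ℂ) :
    (if p₁ then (if a₁ then c else 0) else if p₂ then (if a₂ then c else 0) else 0) =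
      (if q₁ then (if b₁ then c else 0) else 0) + if q₂ then (if b₂ then c else 0) else 0 := by
  simp only [← ite_and, ← h₁, ← h₂]
  by_cases hp : p₁
  · simp [hp, h hp]
  · simp [hp]

theorem hop_mulVec_posState {s s' t : Site B} {α β γ : ℕ} (φ : Bits n → ℂ) (hs : s ≠ s')
    (h0 : α ≠ 0) (h0' : β ≠ 0) (h1 : α < dim (.inr s : Particle n B))
    (h1' : β < dim (.inr s' : Particle n B)) :
    (hop s α s' β : Op n B) *ᵥ posState φ t γ =
      (if t = s ∧ γ = α then posState φ s' β else 0) +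
        if t = s' ∧ γ = β then posState φ s α else 0 := by
  funext x
  rw [hop_mulVec ⟨hs, h0, h0', h1, h1'⟩, Pi.add_apply, posState_apply, posState_apply,
    clock_setClock _ (dim_pos _), clock_setClock _ h1, clock_setClock _ h1',
    clock_setClock _ (dim_pos _)]
  simp only [workBit_setClock_eq, ite_apply, posState_apply, Pi.zero_apply]
  refine ite_ite_eq_add (fun h h' => h0 (h'.1.symm.trans h.1))
    (update_update_eq_single_iff (X := clock x) hs h0) ?_ _
  rw [Function.update_comm hs, and_comm (a := _ = α)]
  exact update_update_eq_single_iff (X := clock x) hs.symm h0'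

theorem update_eq_single_iff {S : Type*} [DecidableEq S] {X : S → ℕ} {s t : S}
    {α β γ : ℕ} (h0 : α ≠ 0) :
    (X s = β ∧ Function.update X s α = Pi.single t γ) ↔
      (t = s ∧ γ = α) ∧ X = Pi.single s β := by
  constructor
  · rintro ⟨a, d⟩
    have d1 := congr_fun d s
    rw [Function.update_self] at d1
    have ht : t = s := by
      by_contra ht
      rw [Pi.single_eq_of_ne (Ne.symm ht)] at d1
      exact h0 d1
    subst ht
    rw [Pi.single_eq_same] at d1
    refine ⟨⟨rfl, d1.symm⟩, funext fun u => ?_⟩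
    by_cases hu : u = t
    · rw [hu, a, Pi.single_eq_same]
    · have := congr_fun d u
      rw [Function.update_of_ne hu, Pi.single_eq_of_ne hu] at this
      rw [this, Pi.single_eq_of_ne hu]
  · rintro ⟨⟨rfl, rfl⟩, rfl⟩
    refine ⟨Pi.single_eq_same _ _, ?_⟩
    simp [Pi.single]

theorem flipTerm_mulVec_posState {q : Fin n} {A : Matrix (Fin 2) (Fin 2) ℂ} {s t : Site B} {γ : ℕ}
    (φ : Bits n → ℂ) (hs : dim (.inr s : Particle n B) = 3) :
    (flipTerm q A s : Op n B) *ᵥ posState φ t γ =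
      (if t = s ∧ γ = 1 then posState (onQubit q A *ᵥ φ) s 2 else 0) +
        if t = s ∧ γ = 2 then posState (onQubit q Aᴴ *ᵥ φ) s 1 else 0 := by
  funext x
  have key : ∀ (A : Matrix (Fin 2) (Fin 2) ℂ) (α β : ℕ), α < 3 → α ≠ 0 → (x (.inr s)).val = β →
      ∑ v, A (workBit x q) v * posState φ t γ (setClock (setWork x q v) s α) =
        if t = s ∧ γ = α then posState (onQubit q A *ᵥ φ) s β x else 0 := by
    intro A α β hα hα' hβ
    have e := update_eq_single_iff (X := clock x) (s := s) (t := t) (β := β) (γ := γ) hα'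
    have hc : clock x s = β := hβ
    simp only [hc, true_and] at e
    simp only [posState_apply, clock_setClock _ (hs ▸ hα : α < dim (.inr s : Particle n B)),
      clock_setWork, workBit_setClock_eq, workBit_setWork_eq, e]
    by_cases h1 : t = s ∧ γ = α
    · by_cases h2 : clock x = Pi.single s β
      · rw [if_pos h1, if_pos h2, onQubit_mulVec]
        simp only [h1, h2, and_self, if_true]
      · simp only [h1, h2, and_false, if_false, mul_zero, Finset.sum_const_zero, ite_self]
    · simp only [h1, false_and, if_false, mul_zero, Finset.sum_const_zero]
  rw [flipTerm_mulVec A hs, Pi.add_apply]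
  simp only [ite_apply, Pi.zero_apply]
  have hne : ∀ (φ : Bits n → ℂ) β, (x (.inr s)).val ≠ β → posState φ s β x = 0 := by
    intro φ β h
    rw [posState_apply, if_neg]
    intro h'
    apply h
    have := congr_fun h' s
    rwa [Pi.single_eq_same] at this
  by_cases h2 : (x (.inr s)).val = 2
  · rw [if_pos h2, key A 1 2 (by norm_num) one_ne_zero h2, hne _ 1 (by omega), ite_self, add_zero]
  · rw [if_neg h2, hne _ 2 h2, ite_self, zero_add]
    by_cases h1 : (x (.inr s)).val = 1
    · rw [if_pos h1, key Aᴴ 2 1 (by norm_num) two_ne_zero h1]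
    · rw [if_neg h1, hne _ 1 h1, ite_self]

theorem dim_a (b : Fin B) : dim (.inr (.a b) : Particle n B) = 2 := by simp only [dim]

theorem dim_c (b : Fin B) : dim (.inr (.c b) : Particle n B) = 2 := by simp only [dim]

theorem dim_s (b : Fin B) (j : Fin 7) :
    dim (.inr (.s b j) : Particle n B) = if j = 3 then 3 else 2 := by
  simp only [dim]

theorem dim_g (b : Fin B) (u : Bool) (j : Fin 5) :
    dim (.inr (.g b u j) : Particle n B) = if j.val % 2 = 0 then 3 else 2 := by
  simp only [dim]

/-! ### Action of the Hamiltonians of the parts of a block -/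

theorem segTerms_sum_mulVec_of_block_ne (g : Gate n) {b : Fin B} (φ : Bits n → ℂ) {t : Site B}
    (α : ℕ) (hb : t.block ≠ b) : (segTerms g b).sum *ᵥ posState φ t α = 0 := by
  have h1 : ∀ s : Site B, s.block = b → t ≠ s := by
    rintro s rfl rfl
    exact hb rfl
  have ha := h1 (.a b) rfl
  have hc := h1 (.c b) rfl
  have hs := fun j => h1 (.s b j) rfl
  simp [segTerms, Matrix.add_mulVec, hop_mulVec_posState, flipTerm_mulVec_posState, dim_a, dim_s, dim_c, ha, hc, hs]

theorem segTerms_sum_mulVec_c (g : Gate n) (b : Fin B) (φ : Bits n → ℂ) :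
    (segTerms g b).sum *ᵥ posState φ (.c b) 1 = posState φ (.s b 6) 1 := by
  simp [segTerms, Matrix.add_mulVec, hop_mulVec_posState, flipTerm_mulVec_posState, dim_a, dim_s,
    dim_c]

theorem segTerms_sum_mulVec_g (g : Gate n) (b b' : Fin B) (φ : Bits n → ℂ) (u : Bool) (j : Fin 5)
    (α : ℕ) : (segTerms g b).sum *ᵥ posState φ (.g b' u j) α = 0 := by
  simp [segTerms, Matrix.add_mulVec, hop_mulVec_posState, flipTerm_mulVec_posState, dim_a, dim_s,
    dim_c]

/-- The part of a block in front of the switch, together with its two neighbours at the right end: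
a path of ten states. -/
def segPath (g : Gate n) (b : Fin B) (φ : Bits n → ℂ) (i : ℕ) : Cfg n B → ℂ :=
  if h : i < 9 then segState g b φ ⟨i, h⟩
  else posState (onQubit g.segQubit g.segMatrix *ᵥ φ) (.c b) 1

theorem segTerms_sum_mulVec_segState (g : Gate n) (b : Fin B) (φ : Bits n → ℂ) (i : Fin 9) :
    (segTerms g b).sum *ᵥ segState g b φ i =
      (if i = 0 then 0 else segPath g b φ (i - 1)) + segPath g b φ (i + 1) := by
  -- The backward transition in the middle qutrit undoes the gate, which is why the work state
  -- depends only on the position along the path.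
  have e : onQubit g.segQubit g.segMatrixᴴ *ᵥ onQubit g.segQubit g.segMatrix *ᵥ φ = φ := by
    rw [onQubit_mulVec_mulVec, g.segMatrix_conjTranspose_mul, onQubit_one, Matrix.one_mulVec]
  fin_cases i <;>
  simp [segPath, segState, segTerms, Matrix.add_mulVec, hop_mulVec_posState,
    flipTerm_mulVec_posState, dim_a, dim_s, dim_c, e, add_comm, -Matrix.mulVec_mulVec]

theorem trackTerms_sum_mulVec_of_ne (g : Gate n) {b : Fin B} (u : Bool)
    (P W : Matrix (Fin 2) (Fin 2) ℂ) (φ : Bits n → ℂ) {t : Site B} (α : ℕ) (hc : t ≠ .c b)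
    (hg : ∀ j, t ≠ .g b u j) (ha : t ≠ .a (next b)) :
    (trackTerms g b u P W).sum *ᵥ posState φ t α = 0 := by
  simp [trackTerms, Matrix.add_mulVec, hop_mulVec_posState, flipTerm_mulVec_posState, dim_a, dim_g,
    dim_c, ha, hc, hg]

theorem trackTerms_sum_mulVec_c (g : Gate n) (b : Fin B) (u : Bool)
    (P W : Matrix (Fin 2) (Fin 2) ℂ) (φ : Bits n → ℂ) :
    (trackTerms g b u P W).sum *ᵥ posState φ (.c b) 1 = posState φ (.g b u 0) 1 := by
  simp [trackTerms, Matrix.add_mulVec, hop_mulVec_posState, flipTerm_mulVec_posState, dim_a, dim_g,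
    dim_c]

theorem trackTerms_sum_mulVec_a (g : Gate n) (b : Fin B) (u : Bool)
    (P W : Matrix (Fin 2) (Fin 2) ℂ) (φ : Bits n → ℂ) :
    (trackTerms g b u P W).sum *ᵥ posState φ (.a (next b)) 1 = posState φ (.g b u 4) 2 := by
  simp [trackTerms, Matrix.add_mulVec, hop_mulVec_posState, flipTerm_mulVec_posState, dim_a, dim_g,
    dim_c]

/-- The states along a track: the state `i + 1` of the path is reached from the state `i`. -/
def trackPos (b : Fin B) (u : Bool) : Fin 8 → Site B × ℕ
  | 0 => (.g b u 0, 1)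
  | 1 => (.g b u 0, 2)
  | 2 => (.g b u 1, 1)
  | 3 => (.g b u 2, 1)
  | 4 => (.g b u 2, 2)
  | 5 => (.g b u 3, 1)
  | 6 => (.g b u 4, 1)
  | 7 => (.g b u 4, 2)

theorem trackTerms_sum_mulVec_g (g : Gate n) (b : Fin B) (u : Bool)
    (P W : Matrix (Fin 2) (Fin 2) ℂ) (φ : Bits n → ℂ) (hP : Pᴴ = P) (hW : Wᴴ = W) (i : Fin 8) :
    (trackTerms g b u P W).sum *ᵥ posState φ (trackPos b u i).1 (trackPos b u i).2 =
      match i with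
      | 0 => posState φ (.c b) 1 + posState (onQubit g.control P *ᵥ φ) (.g b u 0) 2
      | 1 => posState (onQubit g.control P *ᵥ φ) (.g b u 0) 1 + posState φ (.g b u 1) 1
      | 2 => posState φ (.g b u 0) 2 + posState φ (.g b u 2) 1
      | 3 => posState φ (.g b u 1) 1 + posState (onQubit g.target W *ᵥ φ) (.g b u 2) 2
      | 4 => posState (onQubit g.target W *ᵥ φ) (.g b u 2) 1 + posState φ (.g b u 3) 1
      | 5 => posState φ (.g b u 2) 2 + posState φ (.g b u 4) 1
      | 6 => posState φ (.g b u 3) 1 + posState (onQubit g.control P *ᵥ φ) (.g b u 4) 2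
      | 7 => posState (onQubit g.control P *ᵥ φ) (.g b u 4) 1 + posState φ (.a (next b)) 1 := by
  fin_cases i <;>
  simp [trackPos, trackTerms, Matrix.add_mulVec, hop_mulVec_posState,
    flipTerm_mulVec_posState, dim_a, dim_g, dim_c, hP, hW, add_comm]

end Action

/-! ### The railroad switch -/

section Switch

variable {n B : ℕ}

theorem part_add_part (q : Fin n) (φ : Bits n → ℂ) : part q 0 φ + part q 1 φ = φ := by
  funext z
  rcases (by decide : ∀ v : Fin 2, v = 0 ∨ v = 1) (z q) with h | h <;> simp [part, h]

theorem onQubit_ketbra0_mulVec (q : Fin n) (φ : Bits n → ℂ) :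
    onQubit q ketbra0 *ᵥ φ = part q 0 φ := by
  funext z
  rw [onQubit_mulVec, part, Fin.sum_univ_two]
  rcases (by decide : ∀ v : Fin 2, v = 0 ∨ v = 1) (z q) with h | h
  · have : Function.update z q 0 = z := by rw [← h, Function.update_eq_self]
    simp [ketbra0, h, this]
  · simp [ketbra0, h]

theorem onQubit_ketbra1_mulVec (q : Fin n) (φ : Bits n → ℂ) :
    onQubit q ketbra1 *ᵥ φ = part q 1 φ := by
  funext z
  rw [onQubit_mulVec, part, Fin.sum_univ_two]
  rcases (by decide : ∀ v : Fin 2, v = 0 ∨ v = 1) (z q) with h | h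
  · simp [ketbra1, h]
  · have : Function.update z q 1 = z := by rw [← h, Function.update_eq_self]
    simp [ketbra1, h, this]

theorem part_part (q : Fin n) (v w : Fin 2) (φ : Bits n → ℂ) :
    part q v (part q w φ) = if v = w then part q v φ else 0 := by
  funext z
  by_cases h : v = w
  · subst h
    simp only [part, if_true]
    split_ifs <;> rfl
  · rw [if_neg h]
    simp only [part, Pi.zero_apply]
    split_ifs with h1 h2
    · exact absurd (h1.symm.trans h2) h
    · rfl
    · rfl

/-- A CNOT does nothing when its control is `0`. This is why the lower track may carry the identity
in its middle qutrit. -/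
theorem part_zero_switchUnitary (g : Gate n) (φ : Bits n → ℂ) :
    part g.control 0 (g.switchUnitary *ᵥ φ) = part g.control 0 φ := by
  cases g with
  | one V q => simp [Gate.switchUnitary]
  | cnot q₁ q₂ h =>
    funext z
    change (if z q₁ = 0 then _ else _) = if z q₁ = 0 then _ else _
    refine if_ctx_congr Iff.rfl (fun hz => ?_) fun _ => rfl
    rw [Gate.switchUnitary, cnotMatrix_mulVec h]
    simp [cnotBits, hz]

/-- With the control known to be `1`, the uncontrolled flip on the upper track already is the CNOT.
The control and the target differ, so the flip leaves the control part intact. -/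
theorem onQubit_flip_mulVec_part (g : Gate n) (φ : Bits n → ℂ) :
    onQubit g.target g.flip *ᵥ part g.control 1 φ = part g.control 1 (g.switchUnitary *ᵥ φ) := by
  cases g with
  | one V q => simp [Gate.switchUnitary, Gate.flip]
  | cnot q₁ q₂ h =>
    funext z
    simp only [part, Gate.control, Gate.switchUnitary, Gate.target, Gate.flip,
      cnotMatrix_mulVec h, onQubit_mulVec, Function.update_of_ne h]
    split_ifs with hz
    · rcases (by decide : ∀ v : Fin 2, v = 0 ∨ v = 1) (z q₂) with h | h <;>
        simp [sigmaX, cnotBits, hz, h]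
    · simp

theorem onQubit_flip_mulVec_part_switchUnitary (g : Gate n) (φ : Bits n → ℂ) :
    onQubit g.target g.flip *ᵥ part g.control 1 (g.switchUnitary *ᵥ φ) = part g.control 1 φ := by
  rw [onQubit_flip_mulVec_part, Matrix.mulVec_mulVec, g.switchUnitary_mul_self, Matrix.one_mulVec]

theorem switchHam_mulVec (g : Gate n) (b : Fin B) (v : Cfg n B → ℂ) :
    switchHam g b *ᵥ v = (trackTerms g b true ketbra1 g.flip).sum *ᵥ v +
      (trackTerms g b false ketbra0 1).sum *ᵥ v := by
  rw [switchHam, switchTerms, List.sum_append, Matrix.add_mulVec]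

/-- The hops out of `c` ignore the control and put all of `φ` on each track. Regrouping the four
resulting parts gives one state with every part on its own track and one with the parts exchanged.
-/
theorem switchHam_mulVec_c (g : Gate n) (b : Fin B) (φ : Bits n → ℂ) :
    switchHam g b *ᵥ posState φ (.c b) 1 = onTracks g b φ 0 1 + offTracks g b φ 0 1 := by
  rw [switchHam_mulVec, trackTerms_sum_mulVec_c, trackTerms_sum_mulVec_c, onTracks, offTracks]
  conv_lhs => rw [← part_add_part g.control φ, posState_add, posState_add]
  abel

theorem switchHam_mulVec_a (g : Gate n) (b : Fin B) (φ : Bits n → ℂ) :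
    switchHam g b *ᵥ posState φ (.a (next b)) 1 = onTracks g b φ 4 2 + offTracks g b φ 4 2 := by
  rw [switchHam_mulVec, trackTerms_sum_mulVec_a, trackTerms_sum_mulVec_a, onTracks, offTracks]
  conv_lhs => rw [← part_add_part g.control φ, posState_add, posState_add]
  abel

/-- The two tracks of a switch have only their end qubits in common. -/
theorem trackTerms_sum_mulVec_other (g : Gate n) (b b' : Fin B) {u u' : Bool} (hu : u' ≠ u)
    (P W : Matrix (Fin 2) (Fin 2) ℂ) (φ : Bits n → ℂ) (j : Fin 5) (α : ℕ) :
    (trackTerms g b u P W).sum *ᵥ posState φ (.g b' u' j) α = 0 :=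
  trackTerms_sum_mulVec_of_ne _ _ _ _ _ _ (by simp) (by simp [hu]) (by simp)

theorem switchHam_mulVec_track_false (g : Gate n) (b : Fin B) (φ : Bits n → ℂ) (i : Fin 8) :
    switchHam g b *ᵥ posState φ (trackPos b false i).1 (trackPos b false i).2 =
      match i with
      | 0 => posState φ (.c b) 1 + posState (part g.control 0 φ) (.g b false 0) 2
      | 1 => posState (part g.control 0 φ) (.g b false 0) 1 + posState φ (.g b false 1) 1
      | 2 => posState φ (.g b false 0) 2 + posState φ (.g b false 2) 1
      | 3 => posState φ (.g b false 1) 1 + posState φ (.g b false 2) 2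
      | 4 => posState φ (.g b false 2) 1 + posState φ (.g b false 3) 1
      | 5 => posState φ (.g b false 2) 2 + posState φ (.g b false 4) 1
      | 6 => posState φ (.g b false 3) 1 + posState (part g.control 0 φ) (.g b false 4) 2
      | 7 => posState (part g.control 0 φ) (.g b false 4) 1 + posState φ (.a (next b)) 1 := by
  rw [switchHam_mulVec, trackTerms_sum_mulVec_g _ _ _ _ _ _ ketbra0_conjTranspose (by simp),
    onQubit_ketbra0_mulVec, onQubit_one, Matrix.one_mulVec]
  fin_cases i <;> exact (congrArg (· + _)
    (trackTerms_sum_mulVec_other g b b (by decide) _ _ _ _ _)).trans (zero_add _)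

theorem switchHam_mulVec_track_true (g : Gate n) (b : Fin B) (φ : Bits n → ℂ) (i : Fin 8) :
    switchHam g b *ᵥ posState φ (trackPos b true i).1 (trackPos b true i).2 =
      match i with
      | 0 => posState φ (.c b) 1 + posState (part g.control 1 φ) (.g b true 0) 2
      | 1 => posState (part g.control 1 φ) (.g b true 0) 1 + posState φ (.g b true 1) 1
      | 2 => posState φ (.g b true 0) 2 + posState φ (.g b true 2) 1
      | 3 => posState φ (.g b true 1) 1 + posState (onQubit g.target g.flip *ᵥ φ) (.g b true 2) 2
      | 4 => posState (onQubit g.target g.flip *ᵥ φ) (.g b true 2) 1 + posState φ (.g b true 3) 1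
      | 5 => posState φ (.g b true 2) 2 + posState φ (.g b true 4) 1
      | 6 => posState φ (.g b true 3) 1 + posState (part g.control 1 φ) (.g b true 4) 2
      | 7 => posState (part g.control 1 φ) (.g b true 4) 1 + posState φ (.a (next b)) 1 := by
  rw [switchHam_mulVec, trackTerms_sum_mulVec_g _ _ _ _ _ _ ketbra1_conjTranspose
    g.flip_conjTranspose, onQubit_ketbra1_mulVec]
  fin_cases i <;> exact (congrArg (_ + ·)
    (trackTerms_sum_mulVec_other g b b (by decide) _ _ _ _ _)).trans (add_zero _)

/-- The sum of the neighbours of a state of the switch. -/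
def switchNeighbours (g : Gate n) (b : Fin B) (φ : Bits n → ℂ) : Fin 10 ⊕ Fin 2 → Cfg n B → ℂ
  | .inl 0 => switchState g b φ (.inl 1) + switchState g b φ (.inr 0)
  | .inl 9 => switchState g b φ (.inl 8) + switchState g b φ (.inr 1)
  | .inl i => switchState g b φ (.inl (i - 1)) + switchState g b φ (.inl (i + 1))
  | .inr 0 => switchState g b φ (.inl 0)
  | .inr 1 => switchState g b φ (.inl 9)

theorem switchHam_mulVec_switchState (g : Gate n) (b : Fin B) (φ : Bits n → ℂ)
    (i : Fin 10 ⊕ Fin 2) :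
    switchHam g b *ᵥ switchState g b φ i = switchNeighbours g b φ i := by
  have hpart : ∀ (ψ : Bits n → ℂ) s α, posState (part g.control 0 ψ) s α +
      posState (part g.control 1 ψ) s α = (posState ψ s α : Cfg n B → ℂ) := by
    intro ψ s α
    rw [← posState_add, part_add_part]
  have t0 := fun φ i => switchHam_mulVec_track_false g b φ i
  have t1 := fun φ i => switchHam_mulVec_track_true g b φ i
  have e0 := fun φ => t0 φ 0
  have e1 := fun φ => t0 φ 1
  have e2 := fun φ => t0 φ 2
  have e3 := fun φ => t0 φ 3
  have e4 := fun φ => t0 φ 4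
  have e5 := fun φ => t0 φ 5
  have e6 := fun φ => t0 φ 6
  have e7 := fun φ => t0 φ 7
  have f0 := fun φ => t1 φ 0
  have f1 := fun φ => t1 φ 1
  have f2 := fun φ => t1 φ 2
  have f3 := fun φ => t1 φ 3
  have f4 := fun φ => t1 φ 4
  have f5 := fun φ => t1 φ 5
  have f6 := fun φ => t1 φ 6
  have f7 := fun φ => t1 φ 7
  simp only [trackPos] at e0 e1 e2 e3 e4 e5 e6 e7 f0 f1 f2 f3 f4 f5 f6 f7
  rcases i with i | i <;> fin_cases i
  · exact switchHam_mulVec_c g b φ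
  -- On the right track the projector acts as the identity, and the two backward hops recombine the
  -- parts into `φ` at `c`.
  · simp [switchState, switchNeighbours, onTracks, Matrix.mulVec_add, e0, f0, part_part,
      ← hpart φ]
    abel
  · simp [switchState, switchNeighbours, onTracks, Matrix.mulVec_add, e1, f1, part_part]
    abel
  · simp [switchState, switchNeighbours, onTracks, Matrix.mulVec_add, e2, f2]
    abel
  -- This transition and its reverse in the next case are where the CNOT is applied and undone.
  · simp [switchState, switchNeighbours, onTracks, Matrix.mulVec_add, e3, f3,
      part_zero_switchUnitary, onQubit_flip_mulVec_part, -Matrix.mulVec_mulVec]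
    abel
  · simp [switchState, switchNeighbours, onTracks, Matrix.mulVec_add, e4, f4,
      part_zero_switchUnitary, onQubit_flip_mulVec_part_switchUnitary, -Matrix.mulVec_mulVec]
    abel
  · simp [switchState, switchNeighbours, onTracks, Matrix.mulVec_add, e5, f5]
    abel
  · simp [switchState, switchNeighbours, onTracks, Matrix.mulVec_add, e6, f6, part_part]
    abel
  · simp [switchState, switchNeighbours, onTracks, Matrix.mulVec_add, e7, f7, part_part,
      ← hpart (g.switchUnitary *ᵥ φ)]
    abel
  · exact switchHam_mulVec_a g b _
  -- On the wrong track the projector meets the opposite value of the control and gives zero, so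
  -- only the hop back to the end of the switch survives. The last case is the same at the other
  -- end.
  · simp [switchState, switchNeighbours, offTracks, Matrix.mulVec_add, e0, f0, part_part,
      posState_zero, ← hpart φ]
  · simp [switchState, switchNeighbours, offTracks, Matrix.mulVec_add, e7, f7, part_part,
      posState_zero, ← hpart (g.switchUnitary *ᵥ φ)]

open Classical in
theorem actsAsAdjacency_switch (g : Gate n) (b : Fin B) (φ : Bits n → ℂ) :
    ActsAsAdjacency (switchHam g b) (switchState g b φ) comb := by
  intro i
  rw [switchHam_mulVec_switchState]
  simp only [SimpleGraph.adjMatrix_apply, ite_smul, one_smul, zero_smul, Fintype.sum_sum_type]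
  rcases i with i | i
  · have h : ∀ (f : Fin 10 → Cfg n B → ℂ), (∑ x, if comb.Adj (.inl x) (.inl i) then f x else 0) =
        ∑ x, if x.val + 1 = i.val ∨ i.val + 1 = x.val then f x else 0 := by
      intro f
      refine Finset.sum_congr rfl fun x _ => if_congr ?_ rfl rfl
      exact SimpleGraph.pathGraph_adj
    have h' : ∀ k, comb.Adj (.inr k) (.inl i) ↔ (k = 0 ∧ i = 0) ∨ (k = 1 ∧ i = 9) :=
      fun k => Iff.rfl
    rw [h (fun x => switchState g b φ (.inl x))]
    simp only [h']
    fin_cases i <;> simp [switchNeighbours, Fin.sum_univ_succ]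
  · have h : ∀ k, comb.Adj (.inl k) (.inr i) ↔ (i = 0 ∧ k = 0) ∨ (i = 1 ∧ k = 9) :=
      fun k => Iff.rfl
    have h' : ∀ k, comb.Adj (.inr k) (.inr i) ↔ False := fun k => Iff.rfl
    simp only [h, h']
    fin_cases i <;> simp [switchNeighbours]

end Switch

/-! ### Superpositions of states with a single active clock site -/

section Wave

variable {n B : ℕ}

/-- The configuration with work bits `z` and the clock position `p` as the only active one. -/
def cfgOf (z : Bits n) (p : Site B × ℕ) : Cfg n B
  | .inl q => z q
  | .inr s => ⟨(Pi.single p.1 p.2 : Site B → ℕ) s % dim (.inr s : Particle n B),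
      Nat.mod_lt _ (dim_pos _)⟩

/-- An active state of a clock site. -/
def IsPos (n : ℕ) (p : Site B × ℕ) : Prop := p.2 ≠ 0 ∧ p.2 < dim (.inr p.1 : Particle n B)

theorem workBit_cfgOf (z : Bits n) (p : Site B × ℕ) : workBit (cfgOf z p) = z := rfl

theorem clock_cfgOf (z : Bits n) {p : Site B × ℕ} (hp : IsPos n p) :
    clock (cfgOf z p) = Pi.single p.1 p.2 := by
  funext s
  change (Pi.single p.1 p.2 : Site B → ℕ) s % dim (.inr s : Particle n B) = _
  apply Nat.mod_eq_of_lt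
  by_cases hs : s = p.1
  · subst hs
    rw [Pi.single_eq_same]
    exact hp.2
  · rw [Pi.single_eq_of_ne hs]
    exact dim_pos _

theorem eq_cfgOf {x : Cfg n B} {p : Site B × ℕ} (h : clock x = Pi.single p.1 p.2) :
    x = cfgOf (workBit x) p := by
  funext q
  rcases q with q | s
  · rfl
  · apply Fin.ext
    change clock x s = (Pi.single p.1 p.2 : Site B → ℕ) s % dim (.inr s : Particle n B)
    rw [← h]
    exact (Nat.mod_eq_of_lt (x (.inr s)).isLt).symm

theorem single_pos_inj {p q : Site B × ℕ} (hp : p.2 ≠ 0)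
    (h : (Pi.single p.1 p.2 : Site B → ℕ) = Pi.single q.1 q.2) : p = q := by
  have h1 := congr_fun h p.1
  rw [Pi.single_eq_same] at h1
  by_cases hs : p.1 = q.1
  · rw [hs, Pi.single_eq_same] at h1
    exact Prod.ext hs h1
  · rw [Pi.single_eq_of_ne hs] at h1
    exact absurd h1 hp

/-- The work register has the amplitudes `w`, and the active clock position `p z` may depend on the
work bits `z`. -/
def wave (w : Bits n → ℂ) (p : Bits n → Site B × ℕ) : Cfg n B → ℂ := fun x =>
  if clock x = Pi.single (p (workBit x)).1 (p (workBit x)).2 then w (workBit x) else 0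

theorem posState_eq_wave (φ : Bits n → ℂ) (s : Site B) (α : ℕ) :
    posState φ s α = wave φ fun _ => (s, α) :=
  funext fun x => posState_apply φ s α x

theorem onTracks_eq_wave (g : Gate n) (b : Fin B) (φ : Bits n → ℂ) (j : Fin 5) (α : ℕ) :
    onTracks g b φ j α = wave φ fun z => (.g b (decide (z g.control = 1)) j, α) := by
  funext x
  rw [onTracks, Pi.add_apply, posState_apply, posState_apply, wave]
  rcases (by decide : ∀ v : Fin 2, v = 0 ∨ v = 1) (workBit x g.control) with h | h <;>
    simp [part, h]

theorem offTracks_eq_wave (g : Gate n) (b : Fin B) (φ : Bits n → ℂ) (j : Fin 5) (α : ℕ) :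
    offTracks g b φ j α = wave φ fun z => (.g b (!decide (z g.control = 1)) j, α) := by
  funext x
  rw [offTracks, Pi.add_apply, posState_apply, posState_apply, wave]
  rcases (by decide : ∀ v : Fin 2, v = 0 ∨ v = 1) (workBit x g.control) with h | h <;>
    simp [part, h]

variable {ι : Type}

theorem wave_cfgOf [DecidableEq ι] (w : ι → Bits n → ℂ) {p : ι → Bits n → Site B × ℕ} (hp : ∀ i z, IsPos n (p i z))
    (hinj : ∀ z, Function.Injective fun i => p i z) (i j : ι) (z : Bits n) :
    wave (w j) (p j) (cfgOf z (p i z)) = if i = j then w i z else 0 := by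
  rw [wave, workBit_cfgOf, clock_cfgOf z (hp i z)]
  by_cases h : i = j
  · subst h; simp
  · rw [if_neg h, if_neg]
    exact fun h' => h (hinj z (single_pos_inj (hp i z).1 h'))

/-- The pairs of a node and a work string embed injectively into the configurations: the work string
can be read off, and then the active position determines the node. Outside this image all waves
vanish, so the sum runs over the pairs only. -/
theorem sum_cfg_eq [Fintype ι] {R : Type*} [AddCommMonoid R] {p : ι → Bits n → Site B × ℕ}
    (hp : ∀ i z, IsPos n (p i z)) (hinj : ∀ z, Function.Injective fun i => p i z)
    (w : ι → Bits n → ℂ) (F : Cfg n B → R) (hF : ∀ x, (∀ i, wave (w i) (p i) x = 0) → F x = 0) :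
    ∑ x, F x = ∑ i, ∑ z, F (cfgOf z (p i z)) := by
  rw [← Fintype.sum_prod_type']
  symm
  refine Fintype.sum_of_injective (fun k : ι × Bits n => cfgOf k.2 (p k.1 k.2)) ?_ _ _ ?_
    fun _ => rfl
  · rintro ⟨i, z⟩ ⟨j, z'⟩ h
    have hz : z = z' := congrArg workBit h
    subst hz
    have hc := congrArg clock h
    simp only [clock_cfgOf z (hp _ z)] at hc
    rw [hinj z (single_pos_inj (hp i z).1 hc)]
  · intro x hx
    refine hF x fun i => if_neg fun h => hx ⟨(i, workBit x), (eq_cfgOf h).symm⟩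

/-- Distinct waves have disjoint supports, which needs injectivity of the positions only for each
fixed `z`. This matters because a wrong-track state and its right-track counterpart use the same two
sites, with the roles of the control values exchanged. -/
theorem isOrthonormal_wave [Fintype ι] [DecidableEq ι] {p : ι → Bits n → Site B × ℕ} (hp : ∀ i z, IsPos n (p i z))
    (hinj : ∀ z, Function.Injective fun i => p i z) {w : ι → Bits n → ℂ}
    (hw : ∀ i, star (w i) ⬝ᵥ w i = 1) : IsOrthonormal fun i => wave (w i) (p i) := by
  have key : ∀ i j, star (wave (w i) (p i)) ⬝ᵥ wave (w j) (p j) =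
      if i = j then 1 else 0 := by
    intro i j
    rw [dotProduct, sum_cfg_eq hp hinj w _ fun x hx => by simp [hx]]
    simp only [Pi.star_apply, wave_cfgOf w hp hinj]
    rw [Finset.sum_eq_single i (fun k _ hk => by simp [hk]) (by simp)]
    by_cases h : i = j
    · subst h
      simpa [dotProduct] using hw i
    · simp [h]
  exact ⟨fun i => by simp [key], fun i j h => by simp [key, h]⟩

open Classical in
-- At any configuration at most one wave of the superposition is nonzero, so probabilities add
-- without interference.
theorem sum_norm_sq_superposition [Fintype ι] [DecidableEq ι] {p : ι → Bits n → Site B × ℕ} (hp : ∀ i z, IsPos n (p i z))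
    (hinj : ∀ z, Function.Injective fun i => p i z) (w : ι → Bits n → ℂ) (c : ι → ℂ)
    (P : Cfg n B → Prop) :
    ∑ x, (if P x then ‖∑ i, c i * wave (w i) (p i) x‖ ^ 2 else 0) =
      ∑ i, ∑ z, if P (cfgOf z (p i z)) then ‖c i‖ ^ 2 * ‖w i z‖ ^ 2 else 0 := by
  rw [sum_cfg_eq hp hinj w _ fun x hx => by simp [hx]]
  refine Finset.sum_congr rfl fun i _ => Finset.sum_congr rfl fun z _ => if_congr Iff.rfl ?_ rfl
  simp [wave_cfgOf w hp hinj, mul_pow]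

end Wave

/-! ### The states of the switch and of the computer as waves -/

section Legal

variable {n B : ℕ}

theorem next_prev (b : Fin B) : next (prev b) = b := by
  obtain ⟨v, hv⟩ := b
  apply Fin.ext
  simp only [next, prev]
  rw [Nat.mod_add_mod, show v + (B - 1) + 1 = v + B by omega, Nat.add_mod_right,
    Nat.mod_eq_of_lt hv]

theorem prev_next (b : Fin B) : prev (next b) = b := by
  obtain ⟨v, hv⟩ := b
  apply Fin.ext
  simp only [next, prev]
  rw [Nat.mod_add_mod, show v + 1 + (B - 1) = v + B by omega, Nat.add_mod_right,
    Nat.mod_eq_of_lt hv]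

/-- The work states of the states of the switch. -/
def switchWork (g : Gate n) (φ : Bits n → ℂ) : Fin 10 ⊕ Fin 2 → Bits n → ℂ
  | .inl i => if i.val < 5 then φ else g.switchUnitary *ᵥ φ
  | .inr k => if k = 0 then φ else g.switchUnitary *ᵥ φ

/-- The clock positions of the states of the switch. -/
def switchPos (g : Gate n) (b : Fin B) (i : Fin 10 ⊕ Fin 2) (z : Bits n) : Site B × ℕ :=
  match i with
  | .inl 0 => (.c b, 1)
  | .inl 1 => (.g b (decide (z g.control = 1)) 0, 1)
  | .inl 2 => (.g b (decide (z g.control = 1)) 0, 2)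
  | .inl 3 => (.g b (decide (z g.control = 1)) 1, 1)
  | .inl 4 => (.g b (decide (z g.control = 1)) 2, 1)
  | .inl 5 => (.g b (decide (z g.control = 1)) 2, 2)
  | .inl 6 => (.g b (decide (z g.control = 1)) 3, 1)
  | .inl 7 => (.g b (decide (z g.control = 1)) 4, 1)
  | .inl 8 => (.g b (decide (z g.control = 1)) 4, 2)
  | .inl 9 => (.a (next b), 1)
  | .inr 0 => (.g b (!decide (z g.control = 1)) 0, 1)
  | .inr 1 => (.g b (!decide (z g.control = 1)) 4, 2)

theorem switchState_eq_wave (g : Gate n) (b : Fin B) (φ : Bits n → ℂ) (i : Fin 10 ⊕ Fin 2) :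
    switchState g b φ i = wave (switchWork g φ i) (switchPos g b i) := by
  rcases i with i | i <;> fin_cases i
  · exact posState_eq_wave _ _ _
  iterate 8 exact onTracks_eq_wave _ _ _ _ _
  · exact posState_eq_wave _ _ _
  iterate 2 exact offTracks_eq_wave _ _ _ _ _

theorem isPos_switchPos (g : Gate n) (b : Fin B) (i : Fin 10 ⊕ Fin 2) (z : Bits n) :
    IsPos n (switchPos g b i z) := by
  rcases i with i | i <;> fin_cases i <;> simp [IsPos, switchPos, dim]

theorem switchPos_injective (g : Gate n) (b : Fin B) (z : Bits n) :
    Function.Injective fun i => switchPos g b i z := by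
  rintro (i | i) (j | j) h <;> fin_cases i <;> fin_cases j <;> simp [switchPos] at h ⊢

theorem switchWork_normalized (g : Gate n) {φ : Bits n → ℂ} (hφ : star φ ⬝ᵥ φ = 1)
    (i : Fin 10 ⊕ Fin 2) : star (switchWork g φ i) ⬝ᵥ switchWork g φ i = 1 := by
  rcases i with i | i <;> simp only [switchWork] <;> split_ifs
  · exact hφ
  · exact switchUnitary_normalized g hφ
  · exact hφ
  · exact switchUnitary_normalized g hφ

theorem isOrthonormal_switchState (g : Gate n) (b : Fin B) {φ : Bits n → ℂ}
    (hφ : star φ ⬝ᵥ φ = 1) : IsOrthonormal (switchState g b φ) := by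
  have := isOrthonormal_wave (isPos_switchPos g b) (switchPos_injective g b)
    (switchWork_normalized g hφ)
  simpa only [← switchState_eq_wave] using this

theorem IsOrthonormal.linearIndependent {ι X : Type} [Fintype ι] [Fintype X] {f : ι → X → ℂ}
    (hf : IsOrthonormal f) : LinearIndependent ℂ f := by
  rw [Fintype.linearIndependent_iff]
  intro c hc i
  have h := congrArg (star (f i) ⬝ᵥ ·) hc
  simp only [dotProduct_sum, dotProduct_smul, dotProduct_zero] at h
  rwa [Finset.sum_eq_single i (fun j _ hj => by rw [hf.2 i j hj.symm, smul_zero]) (by simp),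
    hf.1, smul_eq_mul, mul_one] at h

theorem ActsAsAdjacency.mulVec_mem_span {ι X : Type} [Fintype ι] [Fintype X] {A : Matrix X X ℂ}
    {f : ι → X → ℂ} {Γ : SimpleGraph ι} (h : ActsAsAdjacency A f Γ) {v : X → ℂ}
    (hv : v ∈ Submodule.span ℂ (Set.range f)) : A *ᵥ v ∈ Submodule.span ℂ (Set.range f) := by
  induction hv using Submodule.span_induction with
  | mem x hx =>
    obtain ⟨i, rfl⟩ := hx
    rw [h i]
    exact Submodule.sum_mem _ fun j _ =>
      Submodule.smul_mem _ _ (Submodule.subset_span ⟨j, rfl⟩)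
  | zero => simp
  | add x y _ _ hx hy => rw [Matrix.mulVec_add]; exact Submodule.add_mem _ hx hy
  | smul c x _ hx => rw [Matrix.mulVec_smul]; exact Submodule.smul_mem _ _ hx

/-- The work states of the part of a block in front of the switch. -/
def segWork (g : Gate n) (φ : Bits n → ℂ) (i : Fin 9) : Bits n → ℂ :=
  if i.val < 5 then φ else onQubit g.segQubit g.segMatrix *ᵥ φ

/-- The clock positions of the part of a block in front of the switch. -/
def segPos (b : Fin B) : Fin 9 → Site B × ℕ
  | 0 => (.a b, 1)
  | 1 => (.s b 0, 1)
  | 2 => (.s b 1, 1)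
  | 3 => (.s b 2, 1)
  | 4 => (.s b 3, 1)
  | 5 => (.s b 3, 2)
  | 6 => (.s b 4, 1)
  | 7 => (.s b 5, 1)
  | 8 => (.s b 6, 1)

theorem segState_eq_wave (g : Gate n) (b : Fin B) (φ : Bits n → ℂ) (i : Fin 9) :
    segState g b φ i = wave (segWork g φ i) fun _ => segPos b i := by
  fin_cases i <;> exact posState_eq_wave _ _ _

/-- The work states of the basis of the computation. -/
def legalWork (G : Fin B → Gate n) (φ : Bits n → ℂ) :
    Fin (9 * (2 * B)) ⊕ Fin (2 * B) → Bits n → ℂ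
  | .inl r =>
      let b : Fin B := ⟨r.val / 18, by omega⟩
      if h : r.val % 18 < 9 then segWork (G b) (workAt G φ b) ⟨r.val % 18, h⟩
      else switchWork (G b) (switchWorkAt G φ b) (.inl ⟨r.val % 18 - 9, by omega⟩)
  | .inr i =>
      let b : Fin B := ⟨i.val / 2, by omega⟩
      if i.val % 2 = 1 then switchWork (G b) (switchWorkAt G φ b) (.inr 0)
      else switchWork (G (prev b)) (switchWorkAt G φ (prev b)) (.inr 1)

/-- The clock positions of the basis of the computation. -/
def legalPos (G : Fin B → Gate n) (i : Fin (9 * (2 * B)) ⊕ Fin (2 * B)) (z : Bits n) :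
    Site B × ℕ :=
  match i with
  | .inl r =>
      let b : Fin B := ⟨r.val / 18, by omega⟩
      if h : r.val % 18 < 9 then segPos b ⟨r.val % 18, h⟩
      else switchPos (G b) b (.inl ⟨r.val % 18 - 9, by omega⟩) z
  | .inr i =>
      let b : Fin B := ⟨i.val / 2, by omega⟩
      if i.val % 2 = 1 then switchPos (G b) b (.inr 0) z
      else switchPos (G (prev b)) (prev b) (.inr 1) z

theorem legalPos_inl_of_lt (G : Fin B → Gate n) {r : Fin (9 * (2 * B))} (h : r.val % 18 < 9) :
    legalPos G (.inl r) = fun _ => segPos ⟨r.val / 18, by omega⟩ ⟨r.val % 18, h⟩ := by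
  funext z
  simp only [legalPos, dif_pos h]

theorem legalPos_inl_of_not_lt (G : Fin B → Gate n) {r : Fin (9 * (2 * B))}
    (h : ¬r.val % 18 < 9) :
    legalPos G (.inl r) = switchPos (G ⟨r.val / 18, by omega⟩) ⟨r.val / 18, by omega⟩
      (.inl ⟨r.val % 18 - 9, by omega⟩) := by
  funext z
  simp only [legalPos, dif_neg h]

theorem legalPos_inr_of_odd (G : Fin B → Gate n) {i : Fin (2 * B)} (h : i.val % 2 = 1) :
    legalPos G (.inr i) = switchPos (G ⟨i.val / 2, by omega⟩) ⟨i.val / 2, by omega⟩ (.inr 0) := by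
  funext z
  simp only [legalPos, if_pos h]

theorem legalPos_inr_of_not_odd (G : Fin B → Gate n) {i : Fin (2 * B)} (h : ¬i.val % 2 = 1) :
    legalPos G (.inr i) = switchPos (G (prev ⟨i.val / 2, by omega⟩)) (prev ⟨i.val / 2, by omega⟩)
      (.inr 1) := by
  funext z
  simp only [legalPos, if_neg h]

theorem legalState_eq_wave (G : Fin B → Gate n) (φ : Bits n → ℂ)
    (i : Fin (9 * (2 * B)) ⊕ Fin (2 * B)) :
    legalState G φ i = wave (legalWork G φ i) (legalPos G i) := by
  rcases i with r | i
  · by_cases h : r.val % 18 < 9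
    · rw [legalPos_inl_of_lt G h]
      simp only [legalState, legalWork, dif_pos h, segState_eq_wave]
    · rw [legalPos_inl_of_not_lt G h]
      simp only [legalState, legalWork, dif_neg h, switchState_eq_wave]
  · by_cases h : i.val % 2 = 1
    · rw [legalPos_inr_of_odd G h]
      simp only [legalState, legalWork, if_pos h, switchState_eq_wave]
    · rw [legalPos_inr_of_not_odd G h]
      simp only [legalState, legalWork, if_neg h, switchState_eq_wave]

theorem isPos_segPos (b : Fin B) (i : Fin 9) : IsPos n (segPos b i) := by
  fin_cases i <;> simp [IsPos, segPos, dim]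

theorem isPos_legalPos (G : Fin B → Gate n) (i : Fin (9 * (2 * B)) ⊕ Fin (2 * B)) (z : Bits n) :
    IsPos n (legalPos G i z) := by
  rcases i with r | i <;> simp only [legalPos] <;> split_ifs <;>
    first | exact isPos_segPos _ _ | exact isPos_switchPos _ _ _ _

theorem legalWork_normalized (G : Fin B → Gate n) {φ : Bits n → ℂ} (hφ : star φ ⬝ᵥ φ = 1)
    (i : Fin (9 * (2 * B)) ⊕ Fin (2 * B)) : star (legalWork G φ i) ⬝ᵥ legalWork G φ i = 1 := by
  have h1 := workAt_normalized G hφ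
  have h2 : ∀ b, star (switchWorkAt G φ b) ⬝ᵥ switchWorkAt G φ b = 1 :=
    fun b => seg_normalized _ (h1 b)
  rcases i with r | i <;> simp only [legalWork] <;> split_ifs
  · rw [segWork]
    split_ifs
    · exact h1 _
    · exact seg_normalized _ (h1 _)
  · exact switchWork_normalized _ (h2 _) _
  · exact switchWork_normalized _ (h2 _) _
  · exact switchWork_normalized _ (h2 _) _

/-- The number of a clock position within its block. -/
def posCode : Site B × ℕ → ℕ
  | (.a _, _) => 0
  | (.s _ j, α) => ![1, 2, 3, 3 + α, 6, 7, 8] j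
  | (.c _, _) => 9
  | (.g _ _ j, α) => ![9 + α, 12, 12 + α, 15, 15 + α] j

theorem posCode_segPos (b : Fin B) (i : Fin 9) : posCode (segPos b i) = i := by
  fin_cases i <;> rfl

theorem block_segPos (b : Fin B) (i : Fin 9) : (segPos b i).1.block = b := by
  fin_cases i <;> rfl

theorem posCode_switchPos (g : Gate n) (b : Fin B) (z : Bits n) {i : Fin 10} (hi : i.val < 9) :
    posCode (switchPos g b (.inl i) z) = i + 9 := by
  fin_cases i <;> first | rfl | simp at hi

theorem block_switchPos (g : Gate n) (b : Fin B) (z : Bits n) {i : Fin 10} (hi : i.val < 9) :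
    (switchPos g b (.inl i) z).1.block = b := by
  fin_cases i <;> first | rfl | simp at hi

theorem posCode_legalPos (G : Fin B → Gate n) (r : Fin (9 * (2 * B))) (z : Bits n) :
    posCode (legalPos G (.inl r) z) = r % 18 := by
  by_cases h : r.val % 18 < 9
  · simp only [legalPos, dif_pos h, posCode_segPos]
  · simp only [legalPos, dif_neg h]
    rw [posCode_switchPos _ _ _ (by simp only; omega)]
    simp only
    omega

theorem block_legalPos (G : Fin B → Gate n) (r : Fin (9 * (2 * B))) (z : Bits n) :
    (legalPos G (.inl r) z).1.block.val = r / 18 := by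
  by_cases h : r.val % 18 < 9
  · simp only [legalPos, dif_pos h, block_segPos]
  · simp only [legalPos, dif_neg h]
    rw [block_switchPos _ _ _ (by simp only; omega)]

/-- A pendant node has code `10` or `17` in its block, just like the ring nodes at the first and
last active states of the tracks. Equal positions would thus force both nodes into one switch, where
for fixed `z` they lie on opposite tracks. -/
theorem legalPos_inl_ne_inr (G : Fin B → Gate n) (z : Bits n) (r : Fin (9 * (2 * B)))
    (i : Fin (2 * B)) : legalPos G (.inl r) z ≠ legalPos G (.inr i) z := by
  intro h
  have h1 := posCode_legalPos G r z
  have h2 := block_legalPos G r z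
  rw [h] at h1 h2
  by_cases hi : i.val % 2 = 1
  · rw [legalPos_inr_of_odd G hi] at h h1 h2
    have h1' : 10 = r.val % 18 := h1
    have h2' : (⟨i.val / 2, by omega⟩ : Fin B) = ⟨r.val / 18, by omega⟩ := Fin.ext h2
    rw [legalPos_inl_of_not_lt G (by omega), h2'] at h
    exact Sum.inl_ne_inr (switchPos_injective _ _ _ h)
  · rw [legalPos_inr_of_not_odd G hi] at h h1 h2
    have h1' : 17 = r.val % 18 := h1
    have h2' : prev (⟨i.val / 2, by omega⟩ : Fin B) = ⟨r.val / 18, by omega⟩ := Fin.ext h2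
    rw [legalPos_inl_of_not_lt G (by omega), h2'] at h
    exact Sum.inl_ne_inr (switchPos_injective _ _ _ h)

/-- Block and code recover the number of a ring node, and the code tells the two kinds of pendant
nodes apart. For a pendant node at the far end the block is that of the preceding switch, and `next`
recovers the index. -/
theorem legalPos_injective (G : Fin B → Gate n) (z : Bits n) :
    Function.Injective fun i => legalPos G i z := by
  rintro (r | i) (r' | i') h
  · have h1 := posCode_legalPos G r z
    have h2 := block_legalPos G r z
    have h3 := posCode_legalPos G r' z
    have h4 := block_legalPos G r' z
    simp only at h
    rw [h] at h1 h2
    congr 1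
    apply Fin.ext
    omega
  · exact absurd h (legalPos_inl_ne_inr G z r i')
  · exact absurd h.symm (legalPos_inl_ne_inr G z r' i)
  · have h1 := congrArg posCode h
    have h2 := congrArg (fun p => p.1.block) h
    by_cases hi : i.val % 2 = 1 <;> by_cases hi' : i'.val % 2 = 1
    · simp only [legalPos, if_pos hi, if_pos hi'] at h2
      have h3 : i.val / 2 = i'.val / 2 := congrArg Fin.val h2
      congr 1
      apply Fin.ext
      omega
    · simp only [legalPos, if_pos hi, if_neg hi'] at h1
      exact absurd h1 (by decide : ¬(10 = 17))
    · simp only [legalPos, if_neg hi, if_pos hi'] at h1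
      exact absurd h1 (by decide : ¬(17 = 10))
    · simp only [legalPos, if_neg hi, if_neg hi'] at h2
      have h3 : i.val / 2 = i'.val / 2 := by
        have := congrArg next h2
        rw [show (switchPos _ (prev _) (.inr 1) z).1.block = prev ⟨i.val / 2, _⟩ from rfl,
          show (switchPos _ (prev _) (.inr 1) z).1.block = prev ⟨i'.val / 2, _⟩ from rfl,
          next_prev, next_prev] at this
        exact congrArg Fin.val this
      congr 1
      apply Fin.ext
      omega

theorem isOrthonormal_legalState (G : Fin B → Gate n) {φ : Bits n → ℂ} (hφ : star φ ⬝ᵥ φ = 1) :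
    IsOrthonormal (legalState G φ) := by
  have := isOrthonormal_wave (isPos_legalPos G) (legalPos_injective G) (legalWork_normalized G hφ)
  simpa only [← legalState_eq_wave] using this

end Legal

/-! ### The Hamiltonian of the ring is the adjacency matrix of a necklace -/

section Necklace

variable {n B : ℕ}

theorem ringHam_mulVec (G : Fin B → Gate n) (v : Cfg n B → ℂ) :
    ringHam G *ᵥ v = ∑ b, ((segTerms (G b) b).sum *ᵥ v + switchHam (G b) b *ᵥ v) := by
  have : ringHam G = ∑ b, ((segTerms (G b) b).sum + switchHam (G b) b) := by
    rw [ringHam, ringTerms, Fin.sum_univ_def, List.flatMap, List.sum_flatten, List.map_map]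
    simp [Function.comp_def, switchHam]
  rw [this, Matrix.sum_mulVec]
  simp only [Matrix.add_mulVec]

theorem switchHam_mulVec_eq_zero (g : Gate n) {b : Fin B} (φ : Bits n → ℂ) {t : Site B} (α : ℕ)
    (hc : t ≠ .c b) (hg : ∀ u j, t ≠ .g b u j) (ha : t ≠ .a (next b)) :
    switchHam g b *ᵥ posState φ t α = 0 := by
  rw [switchHam_mulVec, trackTerms_sum_mulVec_of_ne _ _ _ _ _ _ hc (hg _) ha,
    trackTerms_sum_mulVec_of_ne _ _ _ _ _ _ hc (hg _) ha, add_zero]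

theorem ringHam_mulVec_a (G : Fin B → Gate n) (b : Fin B) (φ : Bits n → ℂ) :
    ringHam G *ᵥ posState φ (.a (next b)) 1 =
      (segTerms (G (next b)) (next b)).sum *ᵥ posState φ (.a (next b)) 1 +
        switchHam (G b) b *ᵥ posState φ (.a (next b)) 1 := by
  rw [ringHam_mulVec, Finset.sum_add_distrib]
  congr 1
  · refine Finset.sum_eq_single (next b) (fun b' _ hb => ?_) (by simp)
    exact segTerms_sum_mulVec_of_block_ne _ _ _ hb.symm
  · refine Finset.sum_eq_single b (fun b' _ hb => ?_) (by simp)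
    refine switchHam_mulVec_eq_zero _ _ _ (by simp) (by simp) fun h => hb ?_
    rw [← prev_next b, ← prev_next b', Site.a.inj h]

theorem ringHam_mulVec_c (G : Fin B → Gate n) (b : Fin B) (φ : Bits n → ℂ) :
    ringHam G *ᵥ posState φ (.c b) 1 =
      posState φ (.s b 6) 1 + switchHam (G b) b *ᵥ posState φ (.c b) 1 := by
  rw [ringHam_mulVec, Finset.sum_eq_single b, segTerms_sum_mulVec_c]
  · intro b' _ hb
    rw [segTerms_sum_mulVec_of_block_ne _ _ _ (show (Site.c b).block ≠ b' from hb.symm), zero_add]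
    exact switchHam_mulVec_eq_zero _ _ _ (by simp [hb.symm]) (by simp) (by simp)
  · simp

theorem ringHam_mulVec_s (G : Fin B → Gate n) (b : Fin B) (φ : Bits n → ℂ) (j : Fin 7) (α : ℕ) :
    ringHam G *ᵥ posState φ (.s b j) α =
      (segTerms (G b) b).sum *ᵥ posState φ (.s b j) α := by
  have h : ∀ b', switchHam (G b') b' *ᵥ posState φ (.s b j) α = 0 := fun b' =>
    switchHam_mulVec_eq_zero _ _ _ (by simp) (by simp) (by simp)
  rw [ringHam_mulVec, Finset.sum_eq_single b, h, add_zero]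
  · intro b' _ hb
    rw [segTerms_sum_mulVec_of_block_ne _ _ _ (show (Site.s b j).block ≠ b' from hb.symm),
      zero_add, h]
  · simp

theorem ringHam_mulVec_g (G : Fin B → Gate n) (b : Fin B) (φ : Bits n → ℂ) (u : Bool) (j : Fin 5)
    (α : ℕ) :
    ringHam G *ᵥ posState φ (.g b u j) α = switchHam (G b) b *ᵥ posState φ (.g b u j) α := by
  rw [ringHam_mulVec, Finset.sum_eq_single b, segTerms_sum_mulVec_g, zero_add]
  · intro b' _ hb
    rw [segTerms_sum_mulVec_g, zero_add]
    exact switchHam_mulVec_eq_zero _ _ _ (by simp) (by simp [hb.symm]) (by simp)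
  · simp

theorem ringHam_mulVec_segState (G : Fin B → Gate n) (b : Fin B) (φ : Bits n → ℂ) {i : Fin 9}
    (hi : i ≠ 0) :
    ringHam G *ᵥ segState (G b) b φ i =
      segPath (G b) b φ (i - 1) + segPath (G b) b φ (i + 1) := by
  rw [← if_neg (c := i = 0) (t := 0) (e := segPath (G b) b φ (i - 1)) hi,
    ← segTerms_sum_mulVec_segState]
  fin_cases i
  · exact absurd rfl hi
  iterate 8 exact ringHam_mulVec_s _ _ _ _ _

theorem ringHam_mulVec_switchState (G : Fin B → Gate n) (b : Fin B) (φ : Bits n → ℂ)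
    {i : Fin 10 ⊕ Fin 2} (hi : i ≠ .inl 0) (hi' : i ≠ .inl 9) :
    ringHam G *ᵥ switchState (G b) b φ i = switchNeighbours (G b) b φ i := by
  rw [← switchHam_mulVec_switchState]
  have h1 : ∀ ψ j α, ringHam G *ᵥ onTracks (G b) b ψ j α =
      switchHam (G b) b *ᵥ onTracks (G b) b ψ j α := fun ψ j α => by
    simp only [onTracks, Matrix.mulVec_add, ringHam_mulVec_g]
  have h2 : ∀ ψ j α, ringHam G *ᵥ offTracks (G b) b ψ j α =
      switchHam (G b) b *ᵥ offTracks (G b) b ψ j α := fun ψ j α => by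
    simp only [offTracks, Matrix.mulVec_add, ringHam_mulVec_g]
  rcases i with i | i <;> fin_cases i
  · exact absurd rfl hi
  iterate 8 exact h1 _ _ _
  · exact absurd rfl hi'
  iterate 2 exact h2 _ _ _

variable (G : Fin B → Gate n) (φ : Bits n → ℂ)

/-- The value `o = 9` is included: the qubit `c` is both the last node of this path and the first
state of the switch, so neighbours along the path need no extra case. -/
theorem legalState_inl_eq_segPath {b : Fin B} {o : ℕ} (ho : o ≤ 9) {r : Fin (9 * (2 * B))}
    (hr : r.val = 18 * b.val + o) :
    legalState G φ (.inl r) = segPath (G b) b (workAt G φ b) o := by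
  have hb : (⟨r.val / 18, by omega⟩ : Fin B) = b := Fin.ext (by simp only; omega)
  have hm : r.val % 18 = o := by omega
  by_cases h : o < 9
  · simp only [legalState, hb, hm, dif_pos h, segPath]
  · obtain rfl : o = 9 := by omega
    simp only [legalState, hb, hm]
    rfl

theorem legalState_inl_eq_switchState {b : Fin B} {t : Fin 10} (ht : t.val < 9)
    {r : Fin (9 * (2 * B))} (hr : r.val = 18 * b.val + 9 + t.val) :
    legalState G φ (.inl r) = switchState (G b) b (switchWorkAt G φ b) (.inl t) := by
  have hb : (⟨r.val / 18, by omega⟩ : Fin B) = b := Fin.ext (by simp only; omega)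
  have hm : r.val % 18 = 9 + t := by omega
  simp only [legalState, hb, hm, dif_neg (show ¬9 + t.val < 9 by omega), Nat.add_sub_cancel_left,
    Fin.eta]

theorem legalState_inr_odd {b : Fin B} {i : Fin (2 * B)} (hi : i.val = 2 * b + 1) :
    legalState G φ (.inr i) = switchState (G b) b (switchWorkAt G φ b) (.inr 0) := by
  have hb : (⟨i.val / 2, by omega⟩ : Fin B) = b := Fin.ext (by simp only; omega)
  simp only [legalState, hb, if_pos (show i.val % 2 = 1 by omega)]

theorem legalState_inr_even {b : Fin B} {i : Fin (2 * B)} (hi : i.val = 2 * (next b).val) :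
    legalState G φ (.inr i) = switchState (G b) b (switchWorkAt G φ b) (.inr 1) := by
  have hb : (⟨i.val / 2, by omega⟩ : Fin B) = next b := Fin.ext (by simp only; omega)
  simp only [legalState, hb, if_neg (show ¬i.val % 2 = 1 by omega), prev_next]

variable {G φ}

theorem next_val_of_lt {b : Fin B} (h : b.val + 1 < B) : (next b).val = b + 1 :=
  Nat.mod_eq_of_lt h

theorem next_val_of_eq {b : Fin B} (h : b.val + 1 = B) : (next b).val = 0 := by
  simp [next, h]

theorem prev_val_of_pos {b : Fin B} (h : 0 < b.val) : (prev b).val = b - 1 := by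
  simp only [prev]
  rw [show b.val + (B - 1) = b.val - 1 + B by omega, Nat.add_mod_right,
    Nat.mod_eq_of_lt (by omega)]

theorem prev_val_of_eq {b : Fin B} (h : b.val = 0) : (prev b).val = B - 1 := by
  have := b.pos
  simp only [prev, h, zero_add]
  exact Nat.mod_eq_of_lt (by omega)

/-- The end of one switch coincides with the start of the following block. Through `workAt_next`
this is where the closing of the ring enters the necklace. -/
theorem legalState_inl_eq_posState_a (hG : run (List.ofFn G) φ = φ) {b : Fin B}
    {r : Fin (9 * (2 * B))} (hr : r.val = 18 * (next b).val) :
    legalState G φ (.inl r) = switchState (G b) b (switchWorkAt G φ b) (.inl 9) := by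
  rw [legalState_inl_eq_segPath G φ (b := next b) (o := 0) (by norm_num) hr]
  change posState _ _ _ = posState _ _ _
  rw [workAt_next G φ hG b]

/-- The Hamiltonian maps a ring state to the sum of its neighbours. -/
theorem ringHam_mulVec_legalState_inl (hG : run (List.ofFn G) φ = φ) (r : Fin (9 * (2 * B))) :
    ringHam G *ᵥ legalState G φ (.inl r) =
      legalState G φ (.inl (next r)) + legalState G φ (.inl (prev r)) +
        if r.val % 9 = 0 then legalState G φ (.inr ⟨r.val / 9, by omega⟩) else 0 := by
  have hr := r.isLt
  obtain ⟨b, hb⟩ : ∃ b : Fin B, b.val = r.val / 18 := ⟨⟨r.val / 18, by omega⟩, rfl⟩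
  rcases (by omega : r.val % 18 = 0 ∨ (1 ≤ r.val % 18 ∧ r.val % 18 ≤ 8) ∨ r.val % 18 = 9 ∨
    10 ≤ r.val % 18) with h | h | h | h
  -- The node is the qubit `a` joining two blocks. The terms in front of the new switch give its
  -- successor; the switch of the previous block gives its predecessor and the pendant node, which
  -- is why a pendant node of even index belongs to the block before.
  · obtain ⟨b', rfl⟩ : ∃ b', next b' = b := ⟨prev b, next_prev b⟩
    have e1 : legalState G φ (.inl (next r)) =
        segPath (G (next b')) (next b') (workAt G φ (next b')) 1 :=
      legalState_inl_eq_segPath G φ (by norm_num) (by rw [next_val_of_lt (by omega)]; omega)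
    have e2 : legalState G φ (.inl (prev r)) =
        switchState (G b') b' (switchWorkAt G φ b') (.inl 8) := by
      refine legalState_inl_eq_switchState G φ (t := 8) (by decide) ?_
      change (prev r).val = 18 * b'.val + 9 + 8
      by_cases h' : b'.val + 1 = B
      · rw [next_val_of_eq h'] at hb
        rw [prev_val_of_eq (by omega)]
        omega
      · rw [next_val_of_lt (by omega)] at hb
        rw [prev_val_of_pos (by omega)]
        omega
    have e3 : legalState G φ (.inr ⟨r.val / 9, by omega⟩) =
        switchState (G b') b' (switchWorkAt G φ b') (.inr 1) :=
      legalState_inr_even G φ (by simp only; omega)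
    have e4 : legalState G φ (.inl r) =
        switchState (G b') b' (switchWorkAt G φ b') (.inl 9) :=
      legalState_inl_eq_posState_a hG (by omega)
    have e5 : legalState G φ (.inl r) =
        segState (G (next b')) (next b') (workAt G φ (next b')) 0 :=
      legalState_inl_eq_segPath G φ (o := 0) (by norm_num) (by omega)
    have e6 := ringHam_mulVec_a G b' (workAt G φ (next b'))
    rw [show posState (workAt G φ (next b')) (.a (next b')) 1 = legalState G φ (.inl r) from
      e5.symm] at e6
    rw [e6, if_pos (by omega), e1, e2, e3, add_assoc]
    congr 1
    · rw [e5, segTerms_sum_mulVec_segState]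
      simp
    · rw [e4, switchHam_mulVec_switchState]
      rfl
  · rw [if_neg (by omega), add_zero,
      legalState_inl_eq_segPath G φ (b := b) (o := r.val % 18) (by omega) (by omega),
      legalState_inl_eq_segPath G φ (b := b) (o := r.val % 18 + 1) (by omega)
        (by rw [next_val_of_lt (by omega)]; omega),
      legalState_inl_eq_segPath G φ (b := b) (o := r.val % 18 - 1) (by omega)
        (by rw [prev_val_of_pos (by omega)]; omega),
      segPath, dif_pos (by omega), ringHam_mulVec_segState, add_comm]
    intro h0
    have := congrArg Fin.val h0
    simp only [Fin.val_zero] at this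
    omega
  -- The node is the qubit `c`: its predecessor comes from the terms in front of the switch, its
  -- successor and its pendant node from the switch.
  · rw [if_pos (by omega),
      legalState_inl_eq_segPath G φ (b := b) (o := 9) (by omega) (by omega),
      legalState_inl_eq_switchState G φ (b := b) (t := 1) (by decide)
        (by rw [next_val_of_lt (by omega), Fin.val_one]; omega),
      legalState_inl_eq_segPath G φ (b := b) (o := 8) (by omega)
        (by rw [prev_val_of_pos (by omega)]; omega),
      legalState_inr_odd G φ (b := b) (by simp only; omega), segPath, dif_neg (by omega),
      ringHam_mulVec_c]
    rw [show posState (onQubit (G b).segQubit (G b).segMatrix *ᵥ workAt G φ b) (.c b) 1 =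
      switchState (G b) b (switchWorkAt G φ b) (.inl 0) from rfl, switchHam_mulVec_switchState]
    simp only [switchNeighbours]
    rw [show posState (onQubit (G b).segQubit (G b).segMatrix *ᵥ workAt G φ b) (.s b 6) 1 =
      segPath (G b) b (workAt G φ b) 8 from rfl]
    abel
  · obtain ⟨t, ht⟩ : ∃ t : Fin 10, t.val = r.val % 18 - 9 := ⟨⟨r.val % 18 - 9, by omega⟩, rfl⟩
    have ht' : t.val ≠ 0 := by omega
    have ht'' : t.val ≠ 9 := by omega
    have e1 : legalState G φ (.inl (next r)) =
        switchState (G b) b (switchWorkAt G φ b) (.inl (t + 1)) := by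
      by_cases h8 : t.val = 8
      · obtain rfl : t = 8 := Fin.ext h8
        refine legalState_inl_eq_posState_a hG ?_
        by_cases h' : b.val + 1 = B
        · rw [next_val_of_eq h', next_val_of_eq (by omega)]
        · rw [next_val_of_lt (by omega), next_val_of_lt (by omega)]
          omega
      · have : (t + 1).val = t.val + 1 := by
          rw [Fin.val_add_one_of_lt' (by omega)]
        exact legalState_inl_eq_switchState G φ (by omega)
          (by rw [next_val_of_lt (by omega)]; omega)
    have e2 : legalState G φ (.inl (prev r)) =
        switchState (G b) b (switchWorkAt G φ b) (.inl (t - 1)) := by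
      have : (t - 1).val = t.val - 1 := by
        rw [Fin.sub_val_of_le (Fin.one_le_of_ne_zero fun h => ht' (by simp [h]))]
        rfl
      exact legalState_inl_eq_switchState G φ (by omega)
        (by rw [prev_val_of_pos (by omega)]; omega)
    rw [if_neg (by omega), e1, e2, add_zero,
      legalState_inl_eq_switchState G φ (b := b) (t := t) (by omega) (by omega),
      ringHam_mulVec_switchState, add_comm]
    · clear e1 e2 ht
      fin_cases t <;> first | rfl | exact absurd rfl ht' | exact absurd rfl ht''
    · exact fun h => ht' (by simp [Sum.inl.inj h])
    · exact fun h => ht'' (by simp [Sum.inl.inj h])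

theorem ringHam_mulVec_legalState_inr (hG : run (List.ofFn G) φ = φ) (i : Fin (2 * B)) :
    ringHam G *ᵥ legalState G φ (.inr i) = legalState G φ (.inl ⟨9 * i.val, by omega⟩) := by
  obtain ⟨b, hb⟩ : ∃ b : Fin B, b.val = i.val / 2 := ⟨⟨i.val / 2, by omega⟩, rfl⟩
  by_cases hi : i.val % 2 = 1
  · rw [legalState_inr_odd G φ (b := b) (by omega),
      legalState_inl_eq_switchState G φ (b := b) (t := 0) (by decide)
        (by simp only [Fin.val_zero]; omega), ringHam_mulVec_switchState _ _ _ (by simp) (by simp)]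
    rfl
  · obtain ⟨b', rfl⟩ : ∃ b', next b' = b := ⟨prev b, next_prev b⟩
    rw [legalState_inr_even G φ (b := b') (by omega),
      legalState_inl_eq_posState_a hG (b := b') (by simp only; omega),
      ringHam_mulVec_switchState _ _ _ (by simp) (by simp)]
    rfl

theorem cycleGraph_adj_iff_next {N : ℕ} (hN : 3 ≤ N) (r r' : Fin N) :
    (SimpleGraph.cycleGraph N).Adj r' r ↔ r' = next r ∨ r' = prev r := by
  rw [SimpleGraph.cycleGraph_adj', Fin.ext_iff, Fin.ext_iff, Fin.val_sub, Fin.val_sub]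
  have h1 := r.isLt
  have h2 := r'.isLt
  have key : ∀ a b : ℕ, a < N → b < N → ((N - b + a) % N = 1 ↔ a = (b + 1) % N) := by
    intro a b ha hb
    rcases Nat.lt_or_ge a b with h | h
    · rw [Nat.mod_eq_of_lt (by omega)]
      rcases Nat.lt_or_ge (b + 1) N with h' | h'
      · rw [Nat.mod_eq_of_lt h']
        omega
      · rw [show b + 1 = N by omega, Nat.mod_self]
        omega
    · rw [show N - b + a = a - b + N by omega, Nat.add_mod_right, Nat.mod_eq_of_lt (by omega)]
      rcases Nat.lt_or_ge (b + 1) N with h' | h'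
      · rw [Nat.mod_eq_of_lt h']
        omega
      · rw [show b + 1 = N by omega, Nat.mod_self]
        omega
  have e : r'.val = (prev r).val ↔ r.val = (r'.val + 1) % N := by
    constructor
    · intro h
      have := congrArg Fin.val (next_prev r)
      rw [← this, h]
      rfl
    · intro h
      have : r = next r' := Fin.ext h
      rw [this, prev_next]
  rw [key _ _ h2 h1, key _ _ h1 h2, e]
  rfl

open Classical in
/-- Sums over the neighbours of a node of the necklace. -/
theorem sum_adjMatrix_necklace {R : Type*} [AddCommMonoid R] [Module ℂ R] {d M : ℕ} (hd : 0 < d)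
    (hN : 3 ≤ d * M) (f : Fin (d * M) ⊕ Fin M → R) :
    (∀ r : Fin (d * M), ∑ j, ((necklace d M).adjMatrix ℂ) j (.inl r) • f j =
      f (.inl (next r)) + f (.inl (prev r)) +
        if r.val % d = 0 then f (.inr ⟨r.val / d, Nat.div_lt_of_lt_mul r.isLt⟩) else 0) ∧
    ∀ i : Fin M, ∑ j, ((necklace d M).adjMatrix ℂ) j (.inr i) • f j =
      f (.inl ⟨d * i.val, Nat.mul_lt_mul_of_pos_left i.isLt hd⟩) := by
  constructor
  · intro r
    simp only [SimpleGraph.adjMatrix_apply, ite_smul, one_smul, zero_smul, Fintype.sum_sum_type]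
    congr 1
    -- On a ring with at least three nodes the two neighbours are different, so each contributes
    -- once to the sum.
    · have hne : next r ≠ prev r := by
        intro h
        have h1 := congrArg Fin.val h
        have hr := r.isLt
        rcases Nat.eq_zero_or_pos r.val with h0 | h0
        · rw [prev_val_of_eq h0, next_val_of_lt (by omega)] at h1
          omega
        · rw [prev_val_of_pos h0] at h1
          rcases (by omega : r.val + 1 < d * M ∨ r.val + 1 = d * M) with h2 | h2
          · rw [next_val_of_lt h2] at h1
            omega
          · rw [next_val_of_eq h2] at h1
            omega
      have h : ∀ r', (necklace d M).Adj (.inl r') (.inl r) ↔ r' = next r ∨ r' = prev r :=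
        fun r' => cycleGraph_adj_iff_next hN r r'
      simp only [h]
      rw [← Finset.sum_filter, Finset.filter_or, Finset.filter_eq', Finset.filter_eq',
        if_pos (Finset.mem_univ _), if_pos (Finset.mem_univ _), Finset.sum_union (by simpa using hne),
        Finset.sum_singleton, Finset.sum_singleton]
    · have h : ∀ k, (necklace d M).Adj (.inr k) (.inl r) ↔ r.val = d * k.val := fun k => Iff.rfl
      simp only [h]
      split_ifs with hr
      · rw [Finset.sum_eq_single ⟨r.val / d, Nat.div_lt_of_lt_mul r.isLt⟩, if_pos]
        · exact (Nat.mul_div_cancel' (Nat.dvd_of_mod_eq_zero hr)).symm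
        · intro k _ hk
          rw [if_neg]
          intro h
          apply hk
          apply Fin.ext
          simp only [h, Nat.mul_div_cancel_left _ hd]
        · simp
      · refine Finset.sum_eq_zero fun k _ => if_neg fun h => hr ?_
        rw [h, Nat.mul_mod_right]
  · intro i
    simp only [SimpleGraph.adjMatrix_apply, ite_smul, one_smul, zero_smul, Fintype.sum_sum_type]
    have h : ∀ r, (necklace d M).Adj (.inl r) (.inr i) ↔ r.val = d * i.val := fun k => Iff.rfl
    have h' : ∀ k, (necklace d M).Adj (.inr k) (.inr i) ↔ False := fun k => Iff.rfl
    simp only [h, h', if_false, Finset.sum_const_zero, add_zero]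
    rw [Finset.sum_eq_single ⟨d * i.val, Nat.mul_lt_mul_of_pos_left i.isLt hd⟩]
    · simp
    · exact fun r _ hr => if_neg fun h => hr (Fin.ext h)
    · simp

theorem actsAsAdjacency_ringHam (hG : run (List.ofFn G) φ = φ) :
    ActsAsAdjacency (ringHam G) (legalState G φ) (necklace 9 (2 * B)) := by
  rintro (r | i)
  · have := r.isLt
    rw [(sum_adjMatrix_necklace (by norm_num) (by omega) _).1, ringHam_mulVec_legalState_inl hG]
  · have := i.isLt
    rw [(sum_adjMatrix_necklace (by norm_num) (by omega) _).2, ringHam_mulVec_legalState_inr hG]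

theorem legalState_zero (G : Fin B → Gate n) (φ : Bits n → ℂ) {r : Fin (9 * (2 * B))} {b : Fin B}
    (hr : r.val = 0) (hb : b.val = 0) : legalState G φ (.inl r) = posState φ (.a b) 1 := by
  rw [legalState_inl_eq_segPath G φ (b := b) (o := 0) (by norm_num) (by omega)]
  have : workAt G φ b = φ := by simp [workAt, hb, run_nil]
  change posState _ _ _ = posState _ _ _
  rw [this]

end Necklace

/-! ### The evolution on the necklace and the output -/

section Exp

open scoped Matrix.Norms.Operator

/-- An intertwining relation passes to the exponentials. -/
theorem exp_smul_mul_eq_mul_exp_smul {m k : Type*} [Fintype m] [DecidableEq m] [Fintype k]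
    [DecidableEq k] {H : Matrix m m ℂ} {A : Matrix k k ℂ} {V : Matrix m k ℂ} (h : H * V = V * A)
    (c : ℂ) : NormedSpace.exp (c • H) * V = V * NormedSpace.exp (c • A) := by
  have hpow : ∀ N : ℕ, (c • H) ^ N * V = V * (c • A) ^ N := by
    intro N
    induction N with
    | zero => simp
    | succ N ih =>
      rw [pow_succ, Matrix.mul_assoc, Matrix.smul_mul, h, ← Matrix.mul_smul, ← Matrix.mul_assoc, ih,
        Matrix.mul_assoc, ← pow_succ]
  have h1 := (NormedSpace.exp_series_hasSum_exp' (𝕂 := ℂ) (c • H)).map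
    (AddMonoidHom.mk' (fun X : Matrix m m ℂ => X * V) fun X Y => Matrix.add_mul X Y V)
    (continuous_id.matrix_mul continuous_const)
  have h2 := (NormedSpace.exp_series_hasSum_exp' (𝕂 := ℂ) (c • A)).map
    (AddMonoidHom.mk' (fun X : Matrix k k ℂ => V * X) fun X Y => Matrix.mul_add V X Y)
    (continuous_const.matrix_mul continuous_id)
  have e : ∀ N : ℕ, ((N.factorial : ℂ)⁻¹ • (c • H) ^ N) * V =
      V * ((N.factorial : ℂ)⁻¹ • (c • A) ^ N) := by
    intro N
    rw [Matrix.smul_mul, Matrix.mul_smul, hpow]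
  refine h1.unique ?_
  simp only [Function.comp_def, AddMonoidHom.mk'_apply, e] at h2 ⊢
  exact h2

end Exp

/-! ### Measurement statistics of the evolved state. -/

section Output

open Classical in
/-- The amplitude of the node `j` of the necklace at time `τ`, if the walk starts at the node
`i`. -/
def walkAmp {ι : Type} [Fintype ι] (Γ : SimpleGraph ι) (τ : ℝ) (i j : ι) : ℂ :=
  NormedSpace.exp ((-(Complex.I * (τ : ℂ))) • Γ.adjMatrix ℂ) j i

/-- The matrix with the vectors of the family as columns intertwines `A` with the adjacency matrix,
hence also their exponentials. -/
theorem ActsAsAdjacency.exp_mulVec {ι X : Type} [Fintype ι] [Fintype X] [DecidableEq X]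
    {A : Matrix X X ℂ} {f : ι → X → ℂ} {Γ : SimpleGraph ι} (h : ActsAsAdjacency A f Γ) (τ : ℝ)
    (i : ι) : NormedSpace.exp ((-(Complex.I * (τ : ℂ))) • A) *ᵥ f i =
      fun x => ∑ j, walkAmp Γ τ i j * f j x := by
  classical
  let V : Matrix X ι ℂ := Matrix.of fun x j => f j x
  have hV : A * V = V * Γ.adjMatrix ℂ := by
    ext x j
    have := congr_fun (h j) x
    rw [Finset.sum_apply] at this
    refine this.trans (Finset.sum_congr rfl fun k _ => ?_)
    rw [Pi.smul_apply, smul_eq_mul, mul_comm]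
    rfl
  have key := exp_smul_mul_eq_mul_exp_smul hV (-(Complex.I * (τ : ℂ)))
  funext x
  refine (congr_fun (congr_fun key x) i).trans (Finset.sum_congr rfl fun k _ => ?_)
  rw [mul_comm, walkAmp]
  congr!

variable {n : ℕ}

theorem initCfg_eq_cfgOf {B : ℕ} {b : Fin B} (hb : b.val = 0) :
    initCfg n B = cfgOf 0 (.a b, 1) := by
  funext p
  rcases p with q | (b' | ⟨b', j⟩ | b' | ⟨b', u, j⟩)
  · rfl
  · apply Fin.ext
    by_cases h : b' = b
    · subst h
      simp [initCfg, cfgOf, hb, dim]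
    · have : b'.val ≠ 0 := fun h' => h (Fin.ext (h'.trans hb.symm))
      simp [initCfg, cfgOf, this, h]
  all_goals
    apply Fin.ext
    simp [initCfg, cfgOf]

theorem single_initCfg {B : ℕ} {b : Fin B} (hb : b.val = 0) :
    (Pi.single (initCfg n B) 1 : Cfg n B → ℂ) = posState (zeroState n) (.a b) 1 := by
  have hpos : IsPos n ((.a b, 1) : Site B × ℕ) := by simp [IsPos, dim]
  funext x
  rw [posState_apply, initCfg_eq_cfgOf hb, Pi.single_apply]
  by_cases h : clock x = Pi.single (.a b) 1
  · have hx := eq_cfgOf (p := (.a b, 1)) h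
    rw [if_pos h, zeroState, Pi.single_apply]
    refine if_congr ⟨fun h' => by rw [h', workBit_cfgOf], fun h' => ?_⟩ rfl rfl
    rw [hx, h']
  · rw [if_neg h, if_neg]
    rintro rfl
    exact h (clock_cfgOf _ hpos)

theorem zeroState_normalized : star (zeroState n) ⬝ᵥ zeroState n = 1 := by
  simp [zeroState, dotProduct, Pi.single_apply]

/-- The first node of the ring. -/
def firstNode {L : ℕ} (hL : 0 < L) : Fin (9 * (2 * (6 * L))) ⊕ Fin (2 * (6 * L)) :=
  .inl ⟨0, by omega⟩

/-- The block of a node of the necklace. -/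
def nodeBlock {B : ℕ} : Fin (9 * (2 * B)) ⊕ Fin (2 * B) → ℕ
  | .inl r => r / 18
  | .inr i => if i.val % 2 = 1 then i.val / 2 else prev (⟨i.val / 2, by omega⟩ : Fin B)

theorem block_legalPos_eq {B : ℕ} (G : Fin B → Gate n)
    (i : Fin (9 * (2 * B)) ⊕ Fin (2 * B)) (z : Bits n) :
    (legalPos G i z).1.block.val = nodeBlock i := by
  rcases i with r | i
  · exact block_legalPos G r z
  · by_cases h : i.val % 2 = 1
    · rw [legalPos_inr_of_odd G h, nodeBlock, if_pos h]
      rfl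
    · rw [legalPos_inr_of_not_odd G h, nodeBlock, if_neg h]
      rfl

/-- The nodes of the necklace that belong to the padding. -/
def InPadding {L : ℕ} (i : Fin (9 * (2 * (6 * L))) ⊕ Fin (2 * (6 * L))) : Prop :=
  L ≤ nodeBlock i ∧ nodeBlock i < 5 * L

variable [NeZero n] (gs : List (Gate n))

theorem stateAt_eq (hL : 0 < gs.length) (τ : ℝ) :
    stateAt gs τ = fun x => ∑ j, walkAmp (necklace 9 (2 * (6 * gs.length))) τ (firstNode hL) j *
      wave (legalWork (ringGate gs) (zeroState n) j) (legalPos (ringGate gs) j) x := by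
  have h1 : (Pi.single (initCfg n (6 * gs.length)) 1 : Cfg n (6 * gs.length) → ℂ) =
      legalState (ringGate gs) (zeroState n) (firstNode hL) := by
    rw [single_initCfg (b := ⟨0, by omega⟩) rfl]
    exact (legalState_zero _ _ rfl rfl).symm
  rw [stateAt, h1, computerHam, (actsAsAdjacency_ringHam (run_ofFn_ringGate gs _)).exp_mulVec]
  simp only [legalState_eq_wave]

theorem cfgOf_mem_success (i : Fin (9 * (2 * (6 * gs.length))) ⊕ Fin (2 * (6 * gs.length)))
    (z : Bits n) : cfgOf z (legalPos (ringGate gs) i z) ∈ success gs ↔ InPadding i := by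
  have hp := isPos_legalPos (ringGate gs) i z
  have hc := clock_cfgOf z hp
  have hb := block_legalPos_eq (ringGate gs) i z
  rw [InPadding, ← hb]
  constructor
  · rintro ⟨s, hs, h1⟩
    have : s = (legalPos (ringGate gs) i z).1 := by
      by_contra hne
      exact hs ((congr_fun hc s).trans (Pi.single_eq_of_ne hne _))
    exact this ▸ h1
  · intro h
    refine ⟨_, ?_, h⟩
    have := congr_fun hc (legalPos (ringGate gs) i z).1
    rw [Pi.single_eq_same] at this
    exact fun h0 => hp.1 (this.symm.trans h0)

theorem segWork_idle (φ : Bits n → ℂ) (i : Fin 9) : segWork Gate.idle φ i = φ := by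
  rw [segWork]
  split_ifs
  · rfl
  · simp [Gate.idle, Gate.segMatrix]

theorem switchWork_idle (φ : Bits n → ℂ) (i : Fin 10 ⊕ Fin 2) :
    switchWork Gate.idle φ i = φ := by
  rcases i with i | i <;> simp [switchWork, Gate.idle, Gate.switchUnitary]

/-- All gates of the circuit have been applied before the padding and none has been undone inside
it. The switches there are idle, so the two blind alleys carry the same work state too. -/
theorem legalWork_of_inPadding (φ : Bits n → ℂ)
    {i : Fin (9 * (2 * (6 * gs.length))) ⊕ Fin (2 * (6 * gs.length))} (hi : InPadding i) :
    legalWork (ringGate gs) φ i = run gs φ := by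
  obtain ⟨h1, h2⟩ := hi
  rcases i with r | i
  · have h1' : gs.length ≤ (⟨r.val / 18, by omega⟩ : Fin (6 * gs.length)).val := h1
    have h2' : (⟨r.val / 18, by omega⟩ : Fin (6 * gs.length)).val < 5 * gs.length := h2
    simp only [legalWork, ringGate_padding gs h1' h2', segWork_idle, switchWork_idle,
      workAt_padding gs φ h1' h2'.le, switchWorkAt_padding gs φ h1' h2']
    split_ifs <;> rfl
  · by_cases h : i.val % 2 = 1
    · rw [nodeBlock, if_pos h] at h1 h2
      have h1' : gs.length ≤ (⟨i.val / 2, by omega⟩ : Fin (6 * gs.length)).val := h1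
      have h2' : (⟨i.val / 2, by omega⟩ : Fin (6 * gs.length)).val < 5 * gs.length := h2
      simp only [legalWork, if_pos h, ringGate_padding gs h1' h2', switchWork_idle,
        switchWorkAt_padding gs φ h1' h2']
    · rw [nodeBlock, if_neg h] at h1 h2
      simp only [legalWork, if_neg h, ringGate_padding gs h1 h2, switchWork_idle,
        switchWorkAt_padding gs φ h1 h2]

open Classical in
-- Success depends only on the node and the work event only on the string. With a common work state
-- on all successful nodes, the double sum of probabilities factors.
theorem probAt_success_inter (hL : 0 < gs.length) (τ : ℝ) (Q : Set (Bits n)) :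
    probAt gs τ (success gs ∩ {x | workBit x ∈ Q}) =
      (∑ i, if InPadding i then
        ‖walkAmp (necklace 9 (2 * (6 * gs.length))) τ (firstNode hL) i‖ ^ 2 else 0) *
      ∑ z, if z ∈ Q then ‖run gs (zeroState n) z‖ ^ 2 else 0 := by
  rw [probAt, stateAt_eq gs hL, Finset.sum_mul]
  refine (sum_norm_sq_superposition (isPos_legalPos (ringGate gs)) (legalPos_injective (ringGate gs))
    (legalWork (ringGate gs) (zeroState n)) _
      fun x => x ∈ success gs ∩ {x | workBit x ∈ Q}).trans ?_
  refine Finset.sum_congr rfl fun i _ => ?_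
  rw [Finset.mul_sum]
  refine Finset.sum_congr rfl fun z _ => ?_
  simp only [Set.mem_inter_iff, cfgOf_mem_success, Set.mem_ofPred_eq, workBit_cfgOf]
  by_cases hi : InPadding i
  · by_cases hz : z ∈ Q
    · rw [if_pos ⟨hi, hz⟩, if_pos hi, if_pos hz, legalWork_of_inPadding gs _ hi]
    · rw [if_neg fun h => hz h.2, if_neg hz, mul_zero]
  · rw [if_neg fun h => hi h.1, if_neg hi, zero_mul]

theorem sum_norm_sq_of_normalized {X : Type*} [Fintype X] {φ : X → ℂ} (hφ : star φ ⬝ᵥ φ = 1) :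
    ∑ z, ‖φ z‖ ^ 2 = 1 := by
  have : ((∑ z, ‖φ z‖ ^ 2 : ℝ) : ℂ) = 1 := by
    rw [← hφ]
    push_cast
    refine Finset.sum_congr rfl fun z _ => ?_
    rw [← Complex.conj_mul']
    rfl
  exact_mod_cast this

open Classical in
theorem probAt_success (hL : 0 < gs.length) (τ : ℝ) :
    probAt gs τ (success gs) = ∑ i, if InPadding i then
      ‖walkAmp (necklace 9 (2 * (6 * gs.length))) τ (firstNode hL) i‖ ^ 2 else 0 := by
  have h := probAt_success_inter gs hL τ Set.univ
  simp only [Set.mem_univ, if_true, Set.ofPred_true, Set.inter_univ] at h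
  rw [h, sum_norm_sq_of_normalized (run_normalized gs zeroState_normalized), mul_one]

open Classical in
/-- Given success, the work register is distributed as the output of the circuit. -/
theorem probAt_success_inter_eq_mul (hL : 0 < gs.length) (τ : ℝ) (Q : Set (Bits n)) :
    probAt gs τ (success gs ∩ {x | workBit x ∈ Q}) = probAt gs τ (success gs) *
      ∑ z, if z ∈ Q then ‖run gs (zeroState n) z‖ ^ 2 else 0 := by
  rw [probAt_success_inter gs hL, probAt_success gs hL]

theorem probAt_success_inter_workIs (hL : 0 < gs.length) (τ : ℝ) (z : Bits n) :
    probAt gs τ (success gs ∩ workIs gs z) =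
      probAt gs τ (success gs) * ‖run gs (zeroState n) z‖ ^ 2 := by
  have h : workIs gs z = {x | workBit x ∈ ({z} : Set (Bits n))} := by
    ext x
    exact (funext_iff (f := workBit x) (g := z)).symm
  rw [h, probAt_success_inter_eq_mul gs hL]
  simp

theorem probAt_success_inter_outputIsOne (hL : 0 < gs.length) (τ : ℝ) :
    probAt gs τ (success gs ∩ outputIsOne gs) = probAt gs τ (success gs) * acceptProb gs := by
  have h : outputIsOne gs = {x | workBit x ∈ {z : Bits n | z 0 = 1}} := rfl
  rw [h, probAt_success_inter_eq_mul gs hL, acceptProb]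
  congr 1
  exact Finset.sum_congr rfl fun z _ => by congr

theorem avgProb_success_inter_outputIsOne (hL : 0 < gs.length) (T : ℝ) :
    avgProb gs T (success gs ∩ outputIsOne gs) = avgProb gs T (success gs) * acceptProb gs := by
  simp only [avgProb, probAt_success_inter_outputIsOne gs hL, intervalIntegral.integral_mul_const,
    mul_assoc]

end Output

/-! ### The Bloch matrices of the necklace -/

section Sylvester

open Polynomial

variable {𝔸 : Type*} [NormedRing 𝔸] [NormedAlgebra ℂ 𝔸] [NormOneClass 𝔸]

/-- The point is the order of the quantifiers: one bound serves all Bloch matrices at once. -/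
theorem exists_norm_aeval_le (q : ℂ[X]) (R : ℝ) :
    ∃ C, ∀ a : 𝔸, ‖a‖ ≤ R → ‖aeval a q‖ ≤ C := by
  induction q using Polynomial.induction_on' with
  | add p q hp hq =>
    obtain ⟨C, hC⟩ := hp
    obtain ⟨C', hC'⟩ := hq
    refine ⟨C + C', fun a ha => ?_⟩
    rw [map_add]
    exact (norm_add_le _ _).trans (add_le_add (hC a ha) (hC' a ha))
  | monomial k c =>
    refine ⟨‖c‖ * R ^ k, fun a ha => ?_⟩
    rw [aeval_monomial, ← Algebra.smul_def, norm_smul]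
    gcongr
    exact (norm_pow_le a k).trans (pow_le_pow_left₀ (norm_nonneg _) ha k)

/-- The difference of the values of a polynomial at `a` and at `b` is of the form `aX - Xb`, with a
bound on the norm of `X`. -/
theorem exists_mul_sub_mul_eq_aeval_sub_aeval (q : ℂ[X]) (R : ℝ) :
    ∃ C, ∀ a b : 𝔸, ‖a‖ ≤ R → ‖b‖ ≤ R →
      ∃ x : 𝔸, ‖x‖ ≤ C ∧ a * x - x * b = aeval a q - aeval b q := by
  induction q using Polynomial.induction_on' with
  | add p q hp hq =>
    obtain ⟨C, hC⟩ := hp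
    obtain ⟨C', hC'⟩ := hq
    refine ⟨C + C', fun a b ha hb => ?_⟩
    obtain ⟨x, hx, h⟩ := hC a b ha hb
    obtain ⟨x', hx', h'⟩ := hC' a b ha hb
    refine ⟨x + x', (norm_add_le _ _).trans (add_le_add hx hx'), ?_⟩
    rw [map_add, map_add, mul_add, add_mul, add_sub_add_comm, h, h', add_sub_add_comm]
  | monomial k c =>
    have key : ∃ C, ∀ a b : 𝔸, ‖a‖ ≤ R → ‖b‖ ≤ R →
        ∃ x : 𝔸, ‖x‖ ≤ C ∧ a * x - x * b = a ^ k - b ^ k := by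
      induction k with
      | zero => exact ⟨0, fun a b _ _ => ⟨0, by simp, by simp⟩⟩
      | succ k ih =>
        obtain ⟨C, hC⟩ := ih
        refine ⟨R * C + R ^ k, fun a b ha hb => ?_⟩
        obtain ⟨x, hx, h⟩ := hC a b ha hb
        -- The solution telescopes: `a ^ (k + 1) - b ^ (k + 1) = a (a ^ k - b ^ k) + (a b ^ k - b ^
        -- k b)`.
        refine ⟨a * x + b ^ k, (norm_add_le _ _).trans (add_le_add ?_ ?_), ?_⟩
        · exact (norm_mul_le _ _).trans (mul_le_mul ha hx (norm_nonneg _)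
            ((norm_nonneg a).trans ha))
        · exact (norm_pow_le b k).trans (pow_le_pow_left₀ (norm_nonneg _) hb k)
        · calc a * (a * x + b ^ k) - (a * x + b ^ k) * b
              = a * (a * x - x * b) + a * b ^ k - b ^ k * b := by noncomm_ring
            _ = a ^ (k + 1) - b ^ (k + 1) := by rw [h, pow_succ', pow_succ]; noncomm_ring
    obtain ⟨C, hC⟩ := key
    refine ⟨‖c‖ * C, fun a b ha hb => ?_⟩
    obtain ⟨x, hx, h⟩ := hC a b ha hb
    refine ⟨c • x, ?_, ?_⟩
    · rw [norm_smul]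
      gcongr
    · rw [aeval_monomial, aeval_monomial, ← Algebra.smul_def, ← Algebra.smul_def, ← smul_sub, ← h,
        mul_smul_comm, smul_mul_assoc, smul_sub]

end Sylvester

/-! ### The annihilating polynomial of the Bloch matrices and a Sylvester equation between two of
them. -/

section Bloch

/-- The adjacency matrix of the necklace on the functions that are multiplied by `z` under the
translation by one cell: nodes `0, …, 8` are the ring nodes of a cell, and node `9` is the pendant
node. -/
def bloch (z : ℂ) : Matrix (Fin 10) (Fin 10) ℂ :=
  !![0, 1, 0, 0, 0, 0, 0, 0, star z, 1;
     1, 0, 1, 0, 0, 0, 0, 0, 0, 0;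
     0, 1, 0, 1, 0, 0, 0, 0, 0, 0;
     0, 0, 1, 0, 1, 0, 0, 0, 0, 0;
     0, 0, 0, 1, 0, 1, 0, 0, 0, 0;
     0, 0, 0, 0, 1, 0, 1, 0, 0, 0;
     0, 0, 0, 0, 0, 1, 0, 1, 0, 0;
     0, 0, 0, 0, 0, 0, 1, 0, 1, 0;
     z, 0, 0, 0, 0, 0, 0, 1, 0, 0;
     1, 0, 0, 0, 0, 0, 0, 0, 0, 0]

theorem bloch_mulVec (z : ℂ) (v : Fin 10 → ℂ) :
    bloch z *ᵥ v = ![v 1 + star z * v 8 + v 9, v 0 + v 2, v 1 + v 3, v 2 + v 4, v 3 + v 5,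
      v 4 + v 6, v 5 + v 7, v 6 + v 8, z * v 0 + v 7, v 0] := by
  funext i
  fin_cases i <;> simp [bloch, Matrix.mulVec, dotProduct, Fin.sum_univ_succ]
  all_goals exact (add_assoc _ _ _).symm

theorem isHermitian_bloch (z : ℂ) : (bloch z).IsHermitian := by
  ext i j
  fin_cases i <;> fin_cases j <;> simp [bloch]

/-- The polynomial `q` with `q (bloch z) = 0`, where `t = z + z⁻¹`. -/
def blochPoly (t : ℂ) : Polynomial ℂ :=
  .X ^ 10 - 10 * .X ^ 8 + 34 * .X ^ 6 - 45 * .X ^ 4 + 19 * .X ^ 2 - 1 - .C t * .X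

/-- Along the path the eigenvalue equation is a three-term recursion, so `v` is determined by its
entries `1` and `9`. The remaining two equations form a 2 by 2 linear system for these, whose
determinant is the polynomial up to sign. -/
theorem eval_blochPoly_mul_eq_zero {z : ℂ} (hz : z * star z = 1) {E : ℂ} {v : Fin 10 → ℂ}
    (h : bloch z *ᵥ v = E • v) : (blochPoly (z + star z)).eval E • v = 0 := by
  rw [bloch_mulVec] at h
  have h0 := congr_fun h 0
  have h1 := congr_fun h 1
  have h2 := congr_fun h 2
  have h3 := congr_fun h 3
  have h4 := congr_fun h 4
  have h5 := congr_fun h 5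
  have h6 := congr_fun h 6
  have h7 := congr_fun h 7
  have h8 := congr_fun h 8
  have h9 := congr_fun h 9
  simp only [Pi.smul_apply, smul_eq_mul] at h0 h1 h2 h3 h4 h5 h6 h7 h8 h9
  change v 1 + star z * v 8 + v 9 = _ at h0
  change v 0 + v 2 = _ at h1
  change v 1 + v 3 = _ at h2
  change v 2 + v 4 = _ at h3
  change v 3 + v 5 = _ at h4
  change v 4 + v 6 = _ at h5
  change v 5 + v 7 = _ at h6
  change v 6 + v 8 = _ at h7
  change z * v 0 + v 7 = _ at h8
  change v 0 = _ at h9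
  have hq : (blochPoly (z + star z)).eval E =
      E ^ 10 - 10 * E ^ 8 + 34 * E ^ 6 - 45 * E ^ 4 + 19 * E ^ 2 - 1 - (z + star z) * E := by
    simp [blochPoly]
  generalize star z = w at *
  rw [hq]
  have e2 : v 2 = E * v 1 - v 0 := by linear_combination h1
  have e3 : v 3 = E * v 2 - v 1 := by linear_combination h2
  have e4 : v 4 = E * v 3 - v 2 := by linear_combination h3
  have e5 : v 5 = E * v 4 - v 3 := by linear_combination h4
  have e6 : v 6 = E * v 5 - v 4 := by linear_combination h5
  have e7 : v 7 = E * v 6 - v 5 := by linear_combination h6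
  have e8 : v 8 = E * v 7 - v 6 := by linear_combination h7
  rw [h9] at e2
  rw [e2] at e3
  rw [e3, e2] at e4
  rw [e4, e3] at e5
  rw [e5, e4] at e6
  rw [e6, e5] at e7
  rw [e7, e6] at e8
  have hA : (E ^ 8 - 7 * E ^ 6 + 15 * E ^ 4 - 10 * E ^ 2 + 1) * v 1 =
      (E ^ 7 - 6 * E ^ 5 + 10 * E ^ 3 - 4 * E + z) * E * v 9 := by
    rw [e8, e7, h9] at h8
    linear_combination -h8
  have hB : (1 + w * (E ^ 7 - 6 * E ^ 5 + 10 * E ^ 3 - 4 * E)) * v 1 =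
      (E ^ 2 - 1 + w * E * (E ^ 6 - 5 * E ^ 4 + 6 * E ^ 2 - 1)) * v 9 := by
    rw [e8, h9] at h0
    linear_combination h0
  -- Cramer's rule for `hA` and `hB`. With `U_k` the characteristic polynomial of a path of `k`
  -- nodes, `U_7 ^ 2 - U_8 U_6 = 1` and `z w = 1` reduce the determinant to `U_8 (E ^ 2 - 1) - 2 E
  -- U_7 - (z + w) E`, up to sign.
  have q9 : (E ^ 10 - 10 * E ^ 8 + 34 * E ^ 6 - 45 * E ^ 4 + 19 * E ^ 2 - 1 - (z + w) * E) *
      v 9 = 0 := by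
    linear_combination (1 + w * (E ^ 7 - 6 * E ^ 5 + 10 * E ^ 3 - 4 * E)) * hA -
      (E ^ 8 - 7 * E ^ 6 + 15 * E ^ 4 - 10 * E ^ 2 + 1) * hB +
      (E * (E ^ 7 - 6 * E ^ 5 + 10 * E ^ 3 - 4 * E) * v 9) * hz
  have q1 : (E ^ 10 - 10 * E ^ 8 + 34 * E ^ 6 - 45 * E ^ 4 + 19 * E ^ 2 - 1 - (z + w) * E) *
      v 1 = 0 := by
    linear_combination (E ^ 2 - 1 + w * E * (E ^ 6 - 5 * E ^ 4 + 6 * E ^ 2 - 1)) * hA -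
      ((E ^ 7 - 6 * E ^ 5 + 10 * E ^ 3 - 4 * E + z) * E) * hB +
      (E * (E ^ 7 - 6 * E ^ 5 + 10 * E ^ 3 - 4 * E) * v 1) * hz
  generalize E ^ 10 - 10 * E ^ 8 + 34 * E ^ 6 - 45 * E ^ 4 + 19 * E ^ 2 - 1 - (z + w) * E = q at *
  funext i
  rw [Pi.smul_apply, smul_eq_mul, Pi.zero_apply]
  fin_cases i
  · change q * v 0 = 0
    rw [h9]
    linear_combination E * q9
  · exact q1
  · change q * v 2 = 0
    rw [e2]
    linear_combination E * q1 - E * q9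
  · change q * v 3 = 0
    rw [e3]
    linear_combination (E ^ 2 - 1) * q1 - E ^ 2 * q9
  · change q * v 4 = 0
    rw [e4]
    linear_combination (E ^ 3 - 2 * E) * q1 - (E ^ 3 - E) * q9
  · change q * v 5 = 0
    rw [e5]
    linear_combination (E ^ 4 - 3 * E ^ 2 + 1) * q1 - (E ^ 4 - 2 * E ^ 2) * q9
  · change q * v 6 = 0
    rw [e6]
    linear_combination (E ^ 5 - 4 * E ^ 3 + 3 * E) * q1 - (E ^ 5 - 3 * E ^ 3 + E) * q9
  · change q * v 7 = 0
    rw [e7]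
    linear_combination (E ^ 6 - 5 * E ^ 4 + 6 * E ^ 2 - 1) * q1 -
      (E ^ 6 - 4 * E ^ 4 + 3 * E ^ 2) * q9
  · change q * v 8 = 0
    rw [e8]
    linear_combination (E ^ 7 - 6 * E ^ 5 + 10 * E ^ 3 - 4 * E) * q1 -
      (E ^ 7 - 5 * E ^ 5 + 6 * E ^ 3 - E) * q9
  · exact q9

theorem aeval_mulVec_of_mulVec_eq_smul {m : Type*} [Fintype m] [DecidableEq m] {A : Matrix m m ℂ}
    {v : m → ℂ} {E : ℂ} (h : A *ᵥ v = E • v) (q : Polynomial ℂ) :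
    Polynomial.aeval A q *ᵥ v = q.eval E • v := by
  have hpow : ∀ k : ℕ, A ^ k *ᵥ v = E ^ k • v := by
    intro k
    induction k with
    | zero => simp
    | succ k ih => rw [pow_succ, ← Matrix.mulVec_mulVec, h, Matrix.mulVec_smul, ih, smul_smul,
        pow_succ']
  induction q using Polynomial.induction_on' with
  | add p q hp hq => rw [map_add, Matrix.add_mulVec, hp, hq, Polynomial.eval_add, add_smul]
  | monomial k c =>
    rw [Polynomial.aeval_monomial, ← Algebra.smul_def, Matrix.smul_mulVec, hpow,
      Polynomial.eval_monomial, smul_smul]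

/-- A polynomial that annihilates all eigenvectors of a Hermitian matrix annihilates the matrix. -/
theorem aeval_eq_zero_of_isHermitian {m : Type*} [Fintype m] [DecidableEq m] {A : Matrix m m ℂ}
    (hA : A.IsHermitian) (q : Polynomial ℂ)
    (h : ∀ (E : ℂ) (v : m → ℂ), A *ᵥ v = E • v → q.eval E • v = 0) :
    Polynomial.aeval A q = 0 := by
  apply (Matrix.toEuclideanLin (𝕜 := ℂ)).injective
  rw [map_zero]
  -- A Hermitian matrix has a basis of eigenvectors, on which the claim is the hypothesis.
  refine hA.eigenvectorBasis.toBasis.ext fun i => ?_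
  have h1 : A *ᵥ ⇑(hA.eigenvectorBasis i) =
      ((hA.eigenvalues i : ℝ) : ℂ) • ⇑(hA.eigenvectorBasis i) := hA.mulVec_eigenvectorBasis i
  have h2 := aeval_mulVec_of_mulVec_eq_smul h1 q
  rw [h _ _ h1] at h2
  rw [OrthonormalBasis.coe_toBasis, LinearMap.zero_apply]
  ext j
  exact congr_fun h2 j

theorem aeval_blochPoly {z : ℂ} (hz : z * star z = 1) :
    Polynomial.aeval (bloch z) (blochPoly (z + star z)) = 0 :=
  aeval_eq_zero_of_isHermitian (isHermitian_bloch z) _ fun _ _ h =>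
    eval_blochPoly_mul_eq_zero hz h

open scoped Matrix.Norms.L2Operator

/-- Only two entries depend on `z`, and they have modulus `1`. -/
theorem exists_norm_bloch_le : ∃ R, ∀ z : ℂ, ‖z‖ = 1 → ‖bloch z‖ ≤ R := by
  refine ⟨‖bloch 0‖ + ‖Matrix.single (8 : Fin 10) (0 : Fin 10) (1 : ℂ)‖ +
    ‖Matrix.single (0 : Fin 10) (8 : Fin 10) (1 : ℂ)‖, fun z hz => ?_⟩
  have : bloch z = bloch 0 + z • Matrix.single (8 : Fin 10) (0 : Fin 10) (1 : ℂ) +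
      star z • Matrix.single (0 : Fin 10) (8 : Fin 10) (1 : ℂ) := by
    refine Matrix.ext_of_mulVec_single fun j => ?_
    rw [Matrix.add_mulVec, Matrix.add_mulVec, bloch_mulVec, bloch_mulVec, Matrix.smul_mulVec,
      Matrix.smul_mulVec, Matrix.single_mulVec, Matrix.single_mulVec]
    generalize (Pi.single j 1 : Fin 10 → ℂ) = v
    funext i
    rw [Pi.add_apply, Pi.add_apply, Pi.smul_apply, Pi.smul_apply, Function.update_apply,
      Function.update_apply]
    fin_cases i <;> simp
    · ring
    · ring
  rw [this]
  refine (norm_add_le _ _).trans (add_le_add ((norm_add_le _ _).trans (add_le_add le_rfl ?_)) ?_)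
  · rw [norm_smul, hz, one_mul]
  · rw [norm_smul, norm_star, hz, one_mul]

theorem mul_star_of_norm_eq_one {z : ℂ} (hz : ‖z‖ = 1) : z * star z = 1 := by
  rw [RCLike.star_def, Complex.mul_conj', hz]
  norm_num

/-- The solution of a Sylvester equation between two Bloch matrices. -/
theorem exists_bloch_sylvester : ∃ C, ∀ z w : ℂ, ‖z‖ = 1 → ‖w‖ = 1 →
    ∃ Y : Matrix (Fin 10) (Fin 10) ℂ, ‖Y‖ ≤ C ∧
      bloch w * Y - Y * bloch z = (w + star w - (z + star z)) • 1 := by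
  obtain ⟨R, hR⟩ := exists_norm_bloch_le
  -- The part of the polynomial that does not depend on `z` is written as `X r - 1`: its constant
  -- term will provide the inverse of a Bloch matrix.
  let r : Polynomial ℂ := .X ^ 9 - 10 * .X ^ 7 + 34 * .X ^ 5 - 45 * .X ^ 3 + 19 * .X
  obtain ⟨C₁, hC₁⟩ :=
    exists_norm_aeval_le (𝔸 := Matrix (Fin 10) (Fin 10) ℂ) r R
  obtain ⟨C₂, hC₂⟩ := exists_mul_sub_mul_eq_aeval_sub_aeval (𝔸 := Matrix (Fin 10) (Fin 10) ℂ)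
    (.X * r - 1) R
  have hpoly : ∀ t, blochPoly t = .X * r - 1 - .C t * .X := fun t => by
    simp only [blochPoly, r]
    ring
  have ht : ∀ z : ℂ, ‖z‖ = 1 → ‖z + star z‖ ≤ 2 := fun z hz => by
    refine (norm_add_le _ _).trans ?_
    rw [norm_star, hz]
    norm_num
  have hp : ∀ z : ℂ, ‖z‖ = 1 →
      Polynomial.aeval (bloch z) (.X * r - 1) = (z + star z) • bloch z := by
    intro z hz
    have := aeval_blochPoly (mul_star_of_norm_eq_one hz)
    rw [hpoly, map_sub, sub_eq_zero] at this
    rw [this]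
    simp [Algebra.smul_def]
  refine ⟨(C₁ + 2) * (C₂ + 2), fun z w hz hw => ?_⟩
  obtain ⟨X, hX, hX'⟩ := hC₂ (bloch w) (bloch z) (hR w hw) (hR z hz)
  rw [hp w hw, hp z hz] at hX'
  set a := bloch w
  set b := bloch z
  -- `K` is the inverse of `a`, because `a r(a) - 1 = (w + star w) a`; as a polynomial expression in
  -- `a` it is uniformly bounded.
  set K := Polynomial.aeval a r - (w + star w) • (1 : Matrix (Fin 10) (Fin 10) ℂ) with hK
  set Z := X - (z + star z) • (1 : Matrix (Fin 10) (Fin 10) ℂ) with hZ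
  have hK1 : K * a = 1 := by
    have h1 := hp w hw
    rw [map_sub, map_mul, Polynomial.aeval_X, map_one, sub_eq_iff_eq_add] at h1
    rw [hK, sub_mul, smul_mul_assoc, one_mul, sub_eq_iff_eq_add, add_comm, ← h1]
    simpa using ((Polynomial.commute_X r).map (Polynomial.aeval a)).eq.symm
  have hK2 : a * K = 1 := by
    have h1 := hp w hw
    rw [map_sub, map_mul, Polynomial.aeval_X, map_one, sub_eq_iff_eq_add] at h1
    rw [hK, mul_sub, mul_smul_comm, mul_one, sub_eq_iff_eq_add, add_comm, ← h1]
  -- The commutator with `X` equals `t_w a - t_z b`. Subtracting `t_z • 1` from `X` replaces `b` by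
  -- `a`, and `K`, which commutes with `a`, then removes the factor `a`.
  have hZ' : a * Z - Z * b = (w + star w - (z + star z)) • a := by
    have : a * Z - Z * b = (a * X - X * b) - (z + star z) • a + (z + star z) • b := by
      rw [hZ, mul_sub, sub_mul, mul_smul_comm, mul_one, smul_mul_assoc, one_mul]
      abel
    rw [this, hX', sub_smul]
    abel
  refine ⟨K * Z, ?_, ?_⟩
  · have h1 : ‖K‖ ≤ C₁ + 2 := by
      refine (norm_sub_le _ _).trans (add_le_add (hC₁ a (hR w hw)) ?_)
      rw [norm_smul, norm_one, mul_one]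
      exact ht w hw
    have h2 : ‖Z‖ ≤ C₂ + 2 := by
      refine (norm_sub_le _ _).trans (add_le_add hX ?_)
      rw [norm_smul, norm_one, mul_one]
      exact ht z hz
    exact (norm_mul_le _ _).trans (mul_le_mul h1 h2 (norm_nonneg _) ((norm_nonneg _).trans h1))
  · calc a * (K * Z) - K * Z * b = a * K * Z - K * Z * b := by rw [← mul_assoc a]
      _ = K * (a * Z - Z * b) := by rw [hK2, ← hK1]; noncomm_ring
      _ = _ := by rw [hZ', mul_smul_comm, hK1]

end Bloch

/-! ### Time integrals of overlaps of Bloch amplitudes. -/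

section BlochAmplitude

open scoped Matrix.Norms.L2Operator

/-- The amplitudes at time `τ` in a cell, if the walk with Bloch matrix `bloch z` starts at the
node `0`. -/
def blochAmp (z : ℂ) (τ : ℝ) (s : Fin 10) : ℂ :=
  NormedSpace.exp ((-(Complex.I * (τ : ℂ))) • bloch z) s 0

theorem exp_smul_mem_unitary {m : Type*} [Fintype m] [DecidableEq m] {A : Matrix m m ℂ}
    (hA : A.IsHermitian) {c : ℂ} (hc : star c = -c) :
    NormedSpace.exp (c • A) ∈ unitary (Matrix m m ℂ) := by
  let +nondep : NormedAlgebra ℚ (Matrix m m ℂ) := NormedAlgebra.restrictScalars ℚ ℂ _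
  refine NormedSpace.exp_mem_unitary_of_mem_skewAdjoint ?_
  rw [skewAdjoint.mem_iff, star_smul, hc, neg_smul]
  congr 2

theorem star_neg_I_mul (τ : ℝ) : star (-(Complex.I * (τ : ℂ))) = -(-(Complex.I * (τ : ℂ))) := by
  simp

theorem star_blochAmp_dotProduct (z w : ℂ) (τ : ℝ) :
    star (blochAmp w τ) ⬝ᵥ blochAmp z τ =
      (NormedSpace.exp ((Complex.I * (τ : ℂ)) • bloch w) *
        NormedSpace.exp ((-(Complex.I * (τ : ℂ))) • bloch z)) 0 0 := by
  have : NormedSpace.exp ((Complex.I * (τ : ℂ)) • bloch w) =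
      (NormedSpace.exp ((-(Complex.I * (τ : ℂ))) • bloch w))ᴴ := by
    rw [← Matrix.exp_conjTranspose, Matrix.conjTranspose_smul, (isHermitian_bloch w).eq,
      star_neg_I_mul, neg_neg]
  rw [this]
  rfl

theorem star_blochAmp_dotProduct_self (z : ℂ) (τ : ℝ) :
    star (blochAmp z τ) ⬝ᵥ blochAmp z τ = 1 := by
  have h := (exp_smul_mem_unitary (isHermitian_bloch z) (star_neg_I_mul τ)).1
  exact congr_fun (congr_fun h 0) 0

theorem continuous_blochAmp (z : ℂ) (s : Fin 10) : Continuous fun τ => blochAmp z τ s := by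
  let +nondep : NormedAlgebra ℚ (Matrix (Fin 10) (Fin 10) ℂ) := NormedAlgebra.restrictScalars ℚ ℂ _
  have h : Continuous fun τ : ℝ => NormedSpace.exp ((-(Complex.I * (τ : ℂ))) • bloch z) :=
    NormedSpace.exp_continuous.comp (by fun_prop)
  exact h.matrix_elem s 0

theorem norm_entry_le_l2_opNorm {m : Type*} [Fintype m] [DecidableEq m] (A : Matrix m m ℂ)
    (i j : m) : ‖A i j‖ ≤ ‖A‖ := by
  have h := Matrix.l2_opNorm_mulVec A (EuclideanSpace.single j (1 : ℂ))
  rw [PiLp.norm_single, norm_one, mul_one] at h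
  refine le_trans ?_ h
  refine le_trans (le_of_eq ?_) (PiLp.norm_apply_le _ i)
  simp

theorem norm_star_blochAmp_dotProduct_le (z w : ℂ) (τ : ℝ) :
    ‖star (blochAmp w τ) ⬝ᵥ blochAmp z τ‖ ≤ 1 := by
  rw [star_blochAmp_dotProduct]
  refine (norm_entry_le_l2_opNorm _ 0 0).trans ((norm_mul_le _ _).trans ?_)
  rw [CStarRing.norm_of_mem_unitary (exp_smul_mem_unitary (isHermitian_bloch w) (by simp)),
    CStarRing.norm_of_mem_unitary (exp_smul_mem_unitary (isHermitian_bloch z)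
      (star_neg_I_mul τ)), mul_one]

theorem continuous_star_blochAmp_dotProduct (z w : ℂ) :
    Continuous fun τ => star (blochAmp w τ) ⬝ᵥ blochAmp z τ :=
  continuous_finsetSum _ fun s _ => (continuous_blochAmp w s).star.mul (continuous_blochAmp z s)

/-- The Sylvester solution `Y` provides an explicit primitive: up to the factor `i (t_w - t_z)`, the
overlap is the derivative of an entry of `Y` between two unitary evolutions. The primitive is
bounded by the norm of `Y` at all times, so no spectral gap is needed. -/
theorem exists_norm_integral_blochAmp_le : ∃ C, 0 < C ∧ ∀ z w : ℂ, ‖z‖ = 1 → ‖w‖ = 1 → ∀ T : ℝ,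
    ‖w + star w - (z + star z)‖ *
      ‖∫ τ in (0 : ℝ)..T, star (blochAmp w τ) ⬝ᵥ blochAmp z τ‖ ≤ C := by
  obtain ⟨C, hC⟩ := exists_bloch_sylvester
  have hC0 : 0 ≤ C := by
    obtain ⟨Y, hY, -⟩ := hC 1 1 norm_one norm_one
    exact (norm_nonneg Y).trans hY
  -- Twice the bound on the primitive, one for each endpoint; the summand `1` only ensures strict
  -- positivity.
  refine ⟨2 * C + 1, by positivity, fun z w hz hw T => ?_⟩
  obtain ⟨Y, hY, hY'⟩ := hC z w hz hw
  set t : ℂ := w + star w - (z + star z)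
  let F : ℂ → Matrix (Fin 10) (Fin 10) ℂ := fun c =>
    NormedSpace.exp (c • (Complex.I • bloch w)) * Y *
      NormedSpace.exp (c • (-Complex.I • bloch z))
  have hF : ∀ c, HasDerivAt F ((Complex.I * t) •
      (NormedSpace.exp (c • (Complex.I • bloch w)) *
        NormedSpace.exp (c • (-Complex.I • bloch z)))) c := by
    intro c
    have h := ((hasDerivAt_exp_smul_const (𝕂 := ℂ) (Complex.I • bloch w) c).mul_const Y).mul
      (hasDerivAt_exp_smul_const' (𝕂 := ℂ) (-Complex.I • bloch z) c)
    refine h.congr_deriv ?_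
    generalize NormedSpace.exp (c • (Complex.I • bloch w)) = P
    generalize NormedSpace.exp (c • (-Complex.I • bloch z)) = Q
    calc P * (Complex.I • bloch w) * Y * Q + P * Y * (-Complex.I • bloch z * Q)
        = Complex.I • (P * (bloch w * Y - Y * bloch z) * Q) := by
          simp only [mul_smul_comm, smul_mul_assoc, neg_smul, neg_mul, mul_neg, ← sub_eq_add_neg,
            ← smul_sub]
          congr 1
          noncomm_ring
      _ = _ := by rw [hY', mul_smul_comm, smul_mul_assoc, mul_one, smul_smul]
  have hf : ∀ τ : ℝ, HasDerivAt (fun τ : ℝ => F τ 0 0)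
      ((Complex.I * t) * (star (blochAmp w τ) ⬝ᵥ blochAmp z τ)) τ := by
    intro τ
    let e := (Matrix.entryLinearMap ℂ ℂ (0 : Fin 10) (0 : Fin 10)).toContinuousLinearMap
    have h := (e.hasFDerivAt.comp_hasDerivAt (τ : ℂ) (hF τ)).comp_ofReal
    refine h.congr_deriv ?_
    rw [star_blochAmp_dotProduct, smul_smul, smul_smul]
    simp only [mul_comm (τ : ℂ), neg_mul]
    rfl
  have hcont : Continuous fun τ : ℝ =>
      (Complex.I * t) * (star (blochAmp w τ) ⬝ᵥ blochAmp z τ) :=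
    continuous_const.mul (continuous_star_blochAmp_dotProduct z w)
  have hint := intervalIntegral.integral_eq_sub_of_hasDerivAt (a := 0) (b := T)
    (fun τ _ => hf τ) (hcont.intervalIntegrable _ _)
  rw [intervalIntegral.integral_const_mul] at hint
  have hb : ∀ τ : ℝ, ‖F τ 0 0‖ ≤ C := by
    intro τ
    refine (norm_entry_le_l2_opNorm _ 0 0).trans ?_
    have h1 : ‖NormedSpace.exp ((τ : ℂ) • (Complex.I • bloch w))‖ = 1 := by
      rw [smul_smul]
      exact CStarRing.norm_of_mem_unitary
        (exp_smul_mem_unitary (isHermitian_bloch w) (by simp))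
    have h2 : ‖NormedSpace.exp ((τ : ℂ) • (-Complex.I • bloch z))‖ = 1 := by
      rw [smul_smul]
      exact CStarRing.norm_of_mem_unitary
        (exp_smul_mem_unitary (isHermitian_bloch z) (by simp))
    calc ‖F τ‖ ≤ 1 * ‖Y‖ * 1 := by
          refine (norm_mul_le _ _).trans ?_
          rw [h2]
          gcongr
          refine (norm_mul_le _ _).trans ?_
          rw [h1]
      _ ≤ C := by rwa [one_mul, mul_one]
  have : ‖(Complex.I * t) * ∫ τ in (0 : ℝ)..T, star (blochAmp w τ) ⬝ᵥ blochAmp z τ‖ ≤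
      2 * C + 1 := by
    rw [hint]
    refine (norm_sub_le _ _).trans ?_
    linarith [hb T, hb 0]
  rwa [norm_mul, norm_mul, Complex.norm_I, one_mul] at this

end BlochAmplitude

/-! ### Fourier analysis on the necklace -/

section Fourier

variable {M : ℕ}

/-- The cell of a node of the necklace. -/
def nodeCell : Fin (9 * M) ⊕ Fin M → ℕ
  | .inl r => r.val / 9
  | .inr i => i.val

/-- The position of a node of the necklace in its cell. -/
def nodeSlot : Fin (9 * M) ⊕ Fin M → Fin 10
  | .inl r => ⟨r.val % 9, by omega⟩
  | .inr _ => 9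

/-- The node of the necklace at a given position of a given cell. -/
def cellNode (m : Fin M) (s : Fin 10) : Fin (9 * M) ⊕ Fin M :=
  if h : s.val < 9 then .inl ⟨9 * m.val + s.val, by omega⟩ else .inr m

theorem nodeCell_cellNode (m : Fin M) (s : Fin 10) : nodeCell (cellNode m s) = m.val := by
  unfold cellNode
  split_ifs with h
  · simp only [nodeCell]
    omega
  · rfl

theorem nodeSlot_cellNode (m : Fin M) (s : Fin 10) : nodeSlot (cellNode m s) = s := by
  unfold cellNode
  split_ifs with h
  · simp only [nodeSlot]
    apply Fin.ext
    simp only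
    omega
  · apply Fin.ext
    simp only [nodeSlot]
    omega

theorem cellNode_injective : Function.Injective fun p : Fin M × Fin 10 => cellNode p.1 p.2 := by
  rintro ⟨m, s⟩ ⟨m', s'⟩ h
  have h1 := congrArg nodeCell h
  have h2 := congrArg nodeSlot h
  simp only [nodeCell_cellNode, nodeSlot_cellNode] at h1 h2
  rw [h2, Fin.ext h1]

/-- The function on the necklace that is equal to `v` in the cell `0`, and is multiplied by `z`
under the translation by one cell. -/
def blochLift (z : ℂ) (v : Fin 10 → ℂ) (i : Fin (9 * M) ⊕ Fin M) : ℂ :=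
  z ^ nodeCell i * v (nodeSlot i)

theorem blochLift_inl (z : ℂ) (v : Fin 10 → ℂ) {r : Fin (9 * M)} {m : ℕ} {s : Fin 10}
    (hr : r.val = 9 * m + s.val) (hs : s.val < 9) : blochLift z v (.inl r) = z ^ m * v s := by
  have h1 : nodeCell (.inl r : Fin (9 * M) ⊕ Fin M) = m := by
    simp only [nodeCell]
    omega
  have h2 : nodeSlot (.inl r : Fin (9 * M) ⊕ Fin M) = s := by
    apply Fin.ext
    simp only [nodeSlot]
    omega
  rw [blochLift, h1, h2]

open Classical in
theorem sum_adjMatrix_mul_blochLift (hM : 0 < M) {z : ℂ} (hz : z * star z = 1) (hzM : z ^ M = 1)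
    (v : Fin 10 → ℂ) (i : Fin (9 * M) ⊕ Fin M) :
    ∑ j, (necklace 9 M).adjMatrix ℂ j i * blochLift z v j = blochLift z (bloch z *ᵥ v) i := by
  have h := sum_adjMatrix_necklace (R := ℂ) (d := 9) (M := M) (by norm_num) (by omega)
    (blochLift z v)
  have hpred : ∀ m, z ^ (m + 1) * star z = z ^ m := fun m => by
    rw [pow_succ, mul_assoc, hz, mul_one]
  rcases i with r | i
  · refine (h.1 r).trans ?_
    have hr := r.isLt
    obtain ⟨m, s, hs⟩ : ∃ (m : ℕ) (s : Fin 9), r.val = 9 * m + s.val :=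
      ⟨r.val / 9, ⟨r.val % 9, by omega⟩, by simp only; omega⟩
    have hm : m < M := by omega
    have hpend : (blochLift z v (.inr ⟨r.val / 9, Nat.div_lt_of_lt_mul r.isLt⟩ :
        Fin (9 * M) ⊕ Fin M)) = z ^ m * v 9 := by
      have : r.val / 9 = m := by omega
      simp only [blochLift, nodeCell, nodeSlot, this]
    rw [hpend]
    have hself : ∀ (v' : Fin 10 → ℂ), blochLift z v' (.inl r) = z ^ m * v' (s.castSucc) :=
      fun v' => blochLift_inl z v' hs s.isLt
    have hnext : ∀ s' : Fin 10, s'.val = s.val + 1 → s'.val < 9 →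
        blochLift z v (.inl (next r)) = z ^ m * v s' := fun s' h1 h2 =>
      blochLift_inl z v (by rw [next_val_of_lt (by omega)]; omega) h2
    have hprev : ∀ s' : Fin 10, s'.val + 1 = s.val →
        blochLift z v (.inl (prev r)) = z ^ m * v s' := fun s' h1 =>
      blochLift_inl z v (by rw [prev_val_of_pos (by omega)]; omega) (by omega)
    rw [hself, bloch_mulVec]
    have hmod : r.val % 9 = s.val := by omega
    rw [hmod]
    fin_cases s
    · change r.val = 9 * m + 0 at hs
      rw [if_pos rfl, hnext 1 rfl (by decide)]
      -- The predecessor of the first node of a cell is the last ring node of the cell before, which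
      -- costs a factor `star z`. For cell `0` this is cell `M - 1`, and `z ^ M = 1` makes the
      -- factor the same.
      have : blochLift z v (.inl (prev r)) = z ^ m * (star z * v 8) := by
        rcases Nat.eq_zero_or_pos m with h0 | h0
        · rw [blochLift_inl z v (m := M - 1) (s := 8)
            (by rw [prev_val_of_eq (by omega)]; change _ = _ + 8; omega)
            (by decide), h0, pow_zero, one_mul]
          congr 1
          rw [← hpred (M - 1), Nat.sub_add_cancel hM, hzM, one_mul]
        · rw [blochLift_inl z v (m := m - 1) (s := 8)
            (by rw [prev_val_of_pos (by omega)]; change _ = _ + 8; omega)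
            (by decide), ← hpred (m - 1), Nat.sub_add_cancel h0, mul_assoc]
      rw [this]
      change _ = z ^ m * (v 1 + star z * v 8 + v 9)
      ring
    · rw [if_neg (by decide), hnext 2 rfl (by decide), hprev 0 rfl]
      change _ = z ^ m * (v 0 + v 2)
      ring
    · rw [if_neg (by decide), hnext 3 rfl (by decide), hprev 1 rfl]
      change _ = z ^ m * (v 1 + v 3)
      ring
    · rw [if_neg (by decide), hnext 4 rfl (by decide), hprev 2 rfl]
      change _ = z ^ m * (v 2 + v 4)
      ring
    · rw [if_neg (by decide), hnext 5 rfl (by decide), hprev 3 rfl]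
      change _ = z ^ m * (v 3 + v 5)
      ring
    · rw [if_neg (by decide), hnext 6 rfl (by decide), hprev 4 rfl]
      change _ = z ^ m * (v 4 + v 6)
      ring
    · rw [if_neg (by decide), hnext 7 rfl (by decide), hprev 5 rfl]
      change _ = z ^ m * (v 5 + v 7)
      ring
    · rw [if_neg (by decide), hnext 8 rfl (by decide), hprev 6 rfl]
      change _ = z ^ m * (v 6 + v 8)
      ring
    · have : blochLift z v (.inl (next r)) = z ^ m * (z * v 0) := by
        change r.val = 9 * m + 8 at hs
        rw [← mul_assoc, ← pow_succ]
        rcases Nat.lt_or_ge (m + 1) M with h0 | h0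
        · exact blochLift_inl z v (by rw [next_val_of_lt (by omega)]; change _ = _ + 0; omega)
            (by decide)
        · rw [show m + 1 = M by omega, hzM]
          exact blochLift_inl z v (m := 0)
            (by rw [next_val_of_eq (by omega)]; rfl) (by decide)
      rw [if_neg (by decide), hprev 7 rfl, this]
      change _ = z ^ m * (z * v 0 + v 7)
      ring
  · refine (h.2 i).trans ?_
    rw [blochLift_inl z v (m := i.val) (s := 0) rfl (by decide), bloch_mulVec]
    rfl

/-- The evolution on the necklace commutes with the Bloch lift. -/
theorem sum_walkAmp_mul_blochLift (hM : 0 < M) {z : ℂ} (hz : z * star z = 1) (hzM : z ^ M = 1)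
    (v : Fin 10 → ℂ) (τ : ℝ) (j : Fin (9 * M) ⊕ Fin M) :
    ∑ i, walkAmp (necklace 9 M) τ i j * blochLift z v i =
      blochLift z (NormedSpace.exp ((-(Complex.I * (τ : ℂ))) • bloch z) *ᵥ v) j := by
  classical
  let V : Matrix (Fin (9 * M) ⊕ Fin M) (Fin 10) ℂ :=
    Matrix.of fun i s => blochLift z (Pi.single s 1) i
  have hV : ∀ v, V *ᵥ v = blochLift z v := by
    intro v
    funext i
    simp only [V, Matrix.mulVec, dotProduct, Matrix.of_apply, blochLift, mul_assoc]
    rw [← Finset.mul_sum]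
    congr 1
    simp [Pi.single_apply]
  -- The lifts of the ten basis vectors form an intertwiner, so the exponentials are related in the
  -- same way.
  have hA : (necklace 9 M).adjMatrix ℂ * V = V * bloch z := by
    refine Matrix.ext_of_mulVec_single fun s => ?_
    rw [← Matrix.mulVec_mulVec, ← Matrix.mulVec_mulVec, hV, hV]
    funext i
    rw [← sum_adjMatrix_mul_blochLift hM hz hzM]
    change ∑ j, (necklace 9 M).adjMatrix ℂ i j * _ = _
    refine Finset.sum_congr rfl fun j _ => ?_
    rw [SimpleGraph.adjMatrix_apply, SimpleGraph.adjMatrix_apply]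
    congr 1
    exact if_congr (SimpleGraph.adj_comm _ _ _) rfl rfl
  have key := exp_smul_mul_eq_mul_exp_smul hA (-(Complex.I * (τ : ℂ)))
  have := congr_fun (congrArg (fun X : Matrix (Fin (9 * M) ⊕ Fin M) (Fin 10) ℂ => X *ᵥ v) key) j
  simp only [← Matrix.mulVec_mulVec, hV] at this
  rw [← this]
  refine Finset.sum_congr rfl fun i _ => ?_
  rw [walkAmp]
  congr!

variable [NeZero M]

theorem norm_stdAddChar (a : ZMod M) : ‖ZMod.stdAddChar a‖ = 1 := AddChar.norm_apply _ _

theorem stdAddChar_pow_card (a : ZMod M) : ZMod.stdAddChar a ^ M = 1 := by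
  rw [← AddChar.map_nsmul_eq_pow]
  simp

theorem sum_stdAddChar_pow {m : ℕ} (hm : m < M) :
    ∑ a : ZMod M, ZMod.stdAddChar a ^ m = if m = 0 then (M : ℂ) else 0 := by
  have h := AddChar.sum_mulShift (m : ZMod M) (ZMod.isPrimitive_stdAddChar M)
  simp only [ZMod.card] at h
  refine Eq.trans (Finset.sum_congr rfl fun a _ => ?_) (h.trans ?_)
  · rw [← AddChar.map_nsmul_eq_pow, nsmul_eq_mul, mul_comm]
  · have : ((m : ZMod M) = 0) ↔ m = 0 := by
      rw [ZMod.natCast_eq_zero_iff]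
      exact ⟨fun h => Nat.eq_zero_of_dvd_of_lt h hm, fun h => h ▸ dvd_zero _⟩
    simp [this]

/-- The amplitudes on the necklace in terms of those of the Bloch matrices. -/
theorem walkAmp_necklace (τ : ℝ) (j : Fin (9 * M) ⊕ Fin M) :
    walkAmp (necklace 9 M) τ (.inl ⟨0, Nat.mul_pos (by norm_num) (NeZero.pos M)⟩) j =
      (M : ℂ)⁻¹ * ∑ a : ZMod M, ZMod.stdAddChar a ^ nodeCell j *
        blochAmp (ZMod.stdAddChar a) τ (nodeSlot j) := by
  have hM : (M : ℂ) ≠ 0 := NeZero.ne _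
  have hcol : ∀ z, NormedSpace.exp ((-(Complex.I * (τ : ℂ))) • bloch z) *ᵥ Pi.single 0 1 =
      blochAmp z τ := fun z => by
    rw [Matrix.mulVec_single_one]
    rfl
  -- By orthogonality of characters the starting node is the average of the Bloch lifts of the first
  -- basis vector over all momenta.
  have hsum : ∀ i : Fin (9 * M) ⊕ Fin M,
      ∑ a : ZMod M, blochLift (ZMod.stdAddChar a) (Pi.single 0 1) i =
        if i = .inl ⟨0, Nat.mul_pos (by norm_num) (NeZero.pos M)⟩ then (M : ℂ) else 0 := by
    intro i
    simp only [blochLift]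
    rw [← Finset.sum_mul, sum_stdAddChar_pow]
    · rcases i with r | i
      · have hc : nodeCell (.inl r : Fin (9 * M) ⊕ Fin M) = r.val / 9 := rfl
        have hs : (nodeSlot (.inl r : Fin (9 * M) ⊕ Fin M)).val = r.val % 9 := rfl
        by_cases h : r.val = 0
        · rw [if_pos (show nodeCell _ = 0 by rw [hc, h]),
            show nodeSlot (.inl r : Fin (9 * M) ⊕ Fin M) = 0 from Fin.ext (by rw [hs, h]; rfl),
            Pi.single_eq_same, mul_one, if_pos (congrArg Sum.inl (Fin.ext h))]
        · rw [if_neg fun e => h (congrArg Fin.val (Sum.inl_injective e))]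
          by_cases h1 : r.val % 9 = 0
          · rw [if_neg (show ¬nodeCell _ = 0 by rw [hc]; omega), zero_mul]
          · rw [Pi.single_eq_of_ne fun e => h1 (hs.symm.trans (congrArg Fin.val e)), mul_zero]
      · have : (9 : Fin 10) ≠ 0 := by decide
        simp [nodeSlot, this]
    · rcases i with r | i
      · exact Nat.div_lt_of_lt_mul r.isLt
      · exact i.isLt
  calc _ = (M : ℂ)⁻¹ * ∑ i, walkAmp (necklace 9 M) τ i j *
        ∑ a : ZMod M, blochLift (ZMod.stdAddChar a) (Pi.single 0 1) i := by
        simp only [hsum]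
        simp [mul_comm, hM]
    _ = (M : ℂ)⁻¹ * ∑ a : ZMod M, ∑ i, walkAmp (necklace 9 M) τ i j *
        blochLift (ZMod.stdAddChar a) (Pi.single 0 1) i := by
        simp only [Finset.mul_sum]
        rw [Finset.sum_comm]
    _ = _ := by
        congr 1
        refine Finset.sum_congr rfl fun a _ => ?_
        rw [sum_walkAmp_mul_blochLift (NeZero.pos M) (mul_star_of_norm_eq_one (norm_stdAddChar a))
          (stdAddChar_pow_card a), hcol]
        rfl

end Fourier

/-! ### Sums over roots of unity -/

section RootsOfUnity

variable {M : ℕ} [NeZero M]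

/-- The distance of a root of unity from `1`. -/
def chord (j : ZMod M) : ℝ := ‖ZMod.stdAddChar j - 1‖

theorem chord_nonneg (j : ZMod M) : 0 ≤ chord j := norm_nonneg _

theorem chord_pos {j : ZMod M} (hj : j ≠ 0) : 0 < chord j := by
  rw [chord, norm_pos_iff, sub_ne_zero]
  intro h
  exact hj (ZMod.injective_stdAddChar (h.trans (AddChar.map_zero_eq_one _).symm))

theorem chord_neg (j : ZMod M) : chord (-j) = chord j := by
  have h : ZMod.stdAddChar (-j) - 1 = -ZMod.stdAddChar (-j) * (ZMod.stdAddChar j - 1) := by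
    rw [mul_sub, neg_mul, ← AddChar.map_add_eq_mul, neg_add_cancel, AddChar.map_zero_eq_one]
    ring
  rw [chord, h, norm_mul, norm_neg, norm_stdAddChar, one_mul, chord]

/-- The chord is `2 sin (π j / M)`, and `sin x ≥ 2 x / π` up to the right angle. -/
theorem four_mul_val_le_chord {j : ZMod M} (hj : 2 * j.val ≤ M) : 4 * j.val / M ≤ chord j := by
  have hM : (0 : ℝ) < M := by exact_mod_cast NeZero.pos M
  have h : chord j = ‖2 * Real.sin (2 * Real.pi * j.val / M / 2)‖ := by
    rw [← Complex.norm_exp_I_mul_ofReal_sub_one, chord, ZMod.stdAddChar_apply, ZMod.toCircle_apply]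
    congr 3
    push_cast
    ring
  have hx : (j.val : ℝ) / M ≤ 1 / 2 := by
    rw [div_le_div_iff₀ hM two_pos]
    exact_mod_cast (by omega : j.val * 2 ≤ 1 * M)
  have hs := Real.mul_le_sin (x := Real.pi * (j.val / M)) (by positivity)
    (by have := mul_le_mul_of_nonneg_left hx Real.pi_pos.le; linarith)
  have e1 : 2 / Real.pi * (Real.pi * (j.val / M)) = 2 * (j.val / M) := by
    field_simp
  have e2 : 2 * Real.pi * (j.val : ℝ) / M / 2 = Real.pi * (j.val / M) := by ring
  rw [h, e2]
  refine le_trans ?_ (le_abs_self _)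
  rw [e1] at hs
  calc 4 * (j.val : ℝ) / M = 2 * (2 * (j.val / M)) := by ring
    _ ≤ _ := by linarith

/-- One of `j` and `-j` has a representative of size at most `M / 2`. Adding both bounds avoids a
case distinction in the later sum. -/
theorem inv_chord_sq_le (j : ZMod M) :
    (chord j ^ 2)⁻¹ ≤ M ^ 2 / 16 * (((j.val : ℝ) ^ 2)⁻¹ + (((-j).val : ℝ) ^ 2)⁻¹) := by
  have key : ∀ {j : ZMod M}, j ≠ 0 → 2 * j.val ≤ M →
      (chord j ^ 2)⁻¹ ≤ M ^ 2 / 16 * ((j.val : ℝ) ^ 2)⁻¹ := by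
    intro j h0 hj
    have hM : (0 : ℝ) < M := by exact_mod_cast NeZero.pos M
    have hv : (0 : ℝ) < j.val := by exact_mod_cast ZMod.val_pos.mpr h0
    have h1 : (4 * j.val / M : ℝ) ^ 2 ≤ chord j ^ 2 :=
      pow_le_pow_left₀ (by positivity) (four_mul_val_le_chord hj) 2
    refine (inv_anti₀ (by positivity) h1).trans (le_of_eq ?_)
    field_simp
    norm_num
  by_cases h0 : j = 0
  · subst h0
    simp [chord]
  · have hv : (-j).val = M - j.val := by rw [ZMod.neg_val, if_neg h0]
    rcases le_total (2 * j.val) M with h | h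
    · refine (key h0 h).trans ?_
      gcongr
      exact le_add_of_nonneg_right (by positivity)
    · have := key (neg_ne_zero.mpr h0) (by omega)
      rw [chord_neg] at this
      refine this.trans ?_
      gcongr
      exact le_add_of_nonneg_left (by positivity)

theorem sum_zmod_val (f : ℕ → ℝ) : ∑ j : ZMod M, f j.val = ∑ k ∈ Finset.range M, f k := by
  obtain ⟨N, rfl⟩ : ∃ N, M = N + 1 := ⟨M - 1, (Nat.succ_pred_eq_of_pos (NeZero.pos M)).symm⟩
  exact Fin.sum_univ_eq_sum_range f (N + 1)

theorem sum_inv_chord_sq_le : ∑ j : ZMod M, (chord j ^ 2)⁻¹ ≤ (M : ℝ) ^ 2 / 4 := by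
  have h1 : ∑ j : ZMod M, ((j.val : ℝ) ^ 2)⁻¹ ≤ 2 := by
    rw [sum_zmod_val fun k => ((k : ℝ) ^ 2)⁻¹]
    have h := sum_Ioo_inv_sq_le (α := ℝ) 0 M
    -- The term with `k = 0` vanishes, since the inverse of `0` is `0` by convention.
    have e : Finset.range M = insert 0 (Finset.Ioo 0 M) := by
      have := NeZero.pos M
      ext k
      simp only [Finset.mem_range, Finset.mem_insert, Finset.mem_Ioo]
      omega
    rw [e, Finset.sum_insert (by simp)]
    norm_num at h ⊢
    exact h
  have h2 : ∑ j : ZMod M, (((-j).val : ℝ) ^ 2)⁻¹ = ∑ j : ZMod M, ((j.val : ℝ) ^ 2)⁻¹ :=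
    Equiv.sum_comp (Equiv.neg (ZMod M)) fun j => ((j.val : ℝ) ^ 2)⁻¹
  calc ∑ j : ZMod M, (chord j ^ 2)⁻¹
      ≤ ∑ j : ZMod M, (M : ℝ) ^ 2 / 16 * (((j.val : ℝ) ^ 2)⁻¹ + (((-j).val : ℝ) ^ 2)⁻¹) :=
        Finset.sum_le_sum fun j _ => inv_chord_sq_le j
    _ = (M : ℝ) ^ 2 / 16 * (2 * ∑ j : ZMod M, ((j.val : ℝ) ^ 2)⁻¹) := by
        rw [← Finset.mul_sum, Finset.sum_add_distrib, h2, two_mul]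
    _ ≤ (M : ℝ) ^ 2 / 16 * (2 * 2) := by gcongr
    _ = (M : ℝ) ^ 2 / 4 := by ring

/-- From `z ^ 2 - 1 = (z - 1) (z + 1)` the chord of `2a` is the product of those of `a` and of its
antipode, whose squares `x`, `y` add up to `4`. Then `1 / (x y) = (1 / x + 1 / y) / 4`; if a chord
vanishes, the left side is `0` by convention. -/
theorem inv_chord_add_self_sq_le {h : ZMod M} (hh : ZMod.stdAddChar h = -1) (a : ZMod M) :
    (chord (a + a) ^ 2)⁻¹ ≤ 1 / 4 * ((chord a ^ 2)⁻¹ + (chord (a + h) ^ 2)⁻¹) := by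
  have h1 : ZMod.stdAddChar (a + a) - 1 =
      -((ZMod.stdAddChar a - 1) * (ZMod.stdAddChar (a + h) - 1)) := by
    rw [AddChar.map_add_eq_mul, AddChar.map_add_eq_mul, hh]
    ring
  have h2 : chord (a + a) = chord a * chord (a + h) := by
    rw [chord, h1, norm_neg, norm_mul, chord, chord]
  have h3 : chord a ^ 2 + chord (a + h) ^ 2 = 4 := by
    have := parallelogram_law_with_norm ℝ (ZMod.stdAddChar a) 1
    rw [norm_stdAddChar, norm_one] at this
    have h4 : chord (a + h) = ‖ZMod.stdAddChar a + 1‖ := by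
      rw [chord, AddChar.map_add_eq_mul, hh, ← norm_neg]
      congr 1
      ring
    rw [h4, chord]
    linarith
  rw [h2, mul_pow]
  have hx := sq_nonneg (chord a)
  have hy := sq_nonneg (chord (a + h))
  generalize chord a ^ 2 = x at *
  generalize chord (a + h) ^ 2 = y at *
  rcases hx.eq_or_lt with hx0 | hx0
  · rw [← hx0, zero_mul, inv_zero]
    positivity
  rcases hy.eq_or_lt with hy0 | hy0
  · rw [← hy0, mul_zero, inv_zero]
    positivity
  refine le_of_eq ?_
  field_simp
  linarith

/-- The sum of inverse chords is controlled by that of their squares through the inequality of means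
`2 / d ≤ r / 2 + (2 / r) / d ^ 2`, with `r = √M`. This crude bound replaces the true order `M log
M`, which is not needed. -/
theorem sum_two_mul_inv_chord_add_self_le {h : ZMod M} (hh : ZMod.stdAddChar h = -1) :
    ∑ a : ZMod M, 2 * (chord (a + a))⁻¹ ≤ M * Real.sqrt M := by
  have hM : (0 : ℝ) < M := by exact_mod_cast NeZero.pos M
  set r := Real.sqrt M with hr
  have hr0 : 0 < r := Real.sqrt_pos.mpr hM
  have hr2 : r * r = M := Real.mul_self_sqrt hM.le
  have h1 : ∑ a : ZMod M, (chord (a + a) ^ 2)⁻¹ ≤ (M : ℝ) ^ 2 / 8 := by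
    calc ∑ a : ZMod M, (chord (a + a) ^ 2)⁻¹
        ≤ ∑ a : ZMod M, 1 / 4 * ((chord a ^ 2)⁻¹ + (chord (a + h) ^ 2)⁻¹) :=
          Finset.sum_le_sum fun a _ => inv_chord_add_self_sq_le hh a
      _ = 1 / 4 * (2 * ∑ a : ZMod M, (chord a ^ 2)⁻¹) := by
          rw [← Finset.mul_sum, Finset.sum_add_distrib, two_mul]
          congr 2
          exact Equiv.sum_comp (Equiv.addRight h) fun a => (chord a ^ 2)⁻¹
      _ ≤ 1 / 4 * (2 * ((M : ℝ) ^ 2 / 4)) := by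
          gcongr
          exact sum_inv_chord_sq_le
      _ = (M : ℝ) ^ 2 / 8 := by ring
  calc ∑ a : ZMod M, 2 * (chord (a + a))⁻¹
      ≤ ∑ a : ZMod M, (r / 2 + 2 / r * (chord (a + a) ^ 2)⁻¹) := by
        refine Finset.sum_le_sum fun a _ => ?_
        generalize chord (a + a) = d
        have : r / 2 + 2 / r * (d ^ 2)⁻¹ - 2 * d⁻¹ = (r - 2 * d⁻¹) ^ 2 / (2 * r) := by
          rw [← inv_pow]
          field_simp
          ring
        have h2 : 0 ≤ (r - 2 * d⁻¹) ^ 2 / (2 * r) := by positivity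
        linarith
    _ = M * (r / 2) + 2 / r * ∑ a : ZMod M, (chord (a + a) ^ 2)⁻¹ := by
        rw [Finset.sum_add_distrib, ← Finset.mul_sum, Finset.sum_const, Finset.card_univ, ZMod.card,
          nsmul_eq_mul]
    _ ≤ M * (r / 2) + 2 / r * ((M : ℝ) ^ 2 / 8) := by gcongr
    _ = M * r * (3 / 4) := by
        rw [← hr2]
        field_simp
        ring
    _ ≤ M * r := by nlinarith [mul_pos hM hr0]

theorem norm_geom_sum_le_sub (j : ZMod M) {p q : ℕ} (hpq : p ≤ q) :
    ‖∑ m ∈ Finset.Ico p q, ZMod.stdAddChar j ^ m‖ ≤ q - p := by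
  refine (norm_sum_le _ _).trans ?_
  simp [Nat.cast_sub hpq]

theorem norm_geom_sum_le_inv_chord {j : ZMod M} (hj : j ≠ 0) {p q : ℕ} (hpq : p ≤ q) :
    ‖∑ m ∈ Finset.Ico p q, ZMod.stdAddChar j ^ m‖ ≤ 2 * (chord j)⁻¹ := by
  have h0 := chord_pos hj
  have h1 : ZMod.stdAddChar j ≠ 1 := by
    rw [chord, norm_pos_iff, sub_ne_zero] at h0
    exact h0
  rw [geom_sum_Ico h1 hpq, norm_div, div_eq_mul_inv, ← chord]
  refine mul_le_mul_of_nonneg_right ((norm_sub_le _ _).trans ?_) (inv_nonneg.mpr h0.le)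
  rw [norm_pow, norm_pow, norm_stdAddChar, one_pow, one_pow]
  norm_num

/-- For `z`, `w` on the unit circle, `(z w̄ - 1) (z w - 1) = z (z + z̄ - w - w̄)`. -/
theorem norm_two_re_sub_two_re (a b : ZMod M) :
    ‖ZMod.stdAddChar b + star (ZMod.stdAddChar b) -
      (ZMod.stdAddChar a + star (ZMod.stdAddChar a))‖ = chord (a - b) * chord (a + b) := by
  have ha := mul_star_of_norm_eq_one (norm_stdAddChar a)
  have hb := mul_star_of_norm_eq_one (norm_stdAddChar b)
  have hsub : ZMod.stdAddChar (a - b) = ZMod.stdAddChar a * star (ZMod.stdAddChar b) := by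
    have h : ZMod.stdAddChar (a - b) * ZMod.stdAddChar b = ZMod.stdAddChar a := by
      rw [← AddChar.map_add_eq_mul, sub_add_cancel]
    rw [← h, mul_assoc, hb, mul_one]
  rw [chord, chord, ← norm_mul, ← one_mul ‖_ + _ - _‖, ← norm_stdAddChar a, ← norm_mul, ← norm_neg,
    hsub, AddChar.map_add_eq_mul]
  congr 1
  linear_combination ha - ZMod.stdAddChar a ^ 2 * hb

end RootsOfUnity

/-! ### Mixing on the necklace -/

section Mixing

variable {M : ℕ} [NeZero M]

/-- The overlap of two Bloch amplitudes. -/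
def overlap (a b : ZMod M) (τ : ℝ) : ℂ :=
  star (blochAmp (ZMod.stdAddChar b) τ) ⬝ᵥ blochAmp (ZMod.stdAddChar a) τ

theorem continuous_overlap (a b : ZMod M) : Continuous (overlap a b) :=
  continuous_star_blochAmp_dotProduct _ _

/-- The probability of finding the walk on the necklace in the cells `p, …, q - 1`. -/
def cellsProb (M : ℕ) [NeZero M] (p q : ℕ) (τ : ℝ) : ℝ :=
  ∑ m ∈ Finset.Ico p q, ∑ s, ‖(M : ℂ)⁻¹ * ∑ a : ZMod M, ZMod.stdAddChar a ^ m *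
    blochAmp (ZMod.stdAddChar a) τ s‖ ^ 2

theorem continuous_cellsProb (p q : ℕ) : Continuous (cellsProb M p q) := by
  refine continuous_finsetSum _ fun m _ => continuous_finsetSum _ fun s _ => ?_
  refine (Continuous.norm (continuous_const.mul (continuous_finsetSum _ fun a _ => ?_))).pow 2
  exact continuous_const.mul (continuous_blochAmp _ s)

theorem sum_norm_sq_sum {α β : Type*} [Fintype α] [Fintype β] (f : α → β → ℂ) :
    ((∑ s, ‖∑ a, f a s‖ ^ 2 : ℝ) : ℂ) = ∑ a, ∑ b, star (f b) ⬝ᵥ f a := by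
  calc ((∑ s, ‖∑ a, f a s‖ ^ 2 : ℝ) : ℂ) = ∑ s, (∑ b, star (f b s)) * ∑ a, f a s := by
        push_cast
        refine Finset.sum_congr rfl fun s _ => ?_
        rw [← Complex.conj_mul', map_sum]
        rfl
    _ = ∑ s, ∑ a, ∑ b, star (f b s) * f a s := by
        refine Finset.sum_congr rfl fun s _ => ?_
        rw [Finset.sum_mul_sum, Finset.sum_comm]
    _ = _ := by
        rw [Finset.sum_comm]
        refine Finset.sum_congr rfl fun a _ => ?_
        rw [Finset.sum_comm]
        rfl

theorem star_stdAddChar_mul (a b : ZMod M) :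
    star (ZMod.stdAddChar b) * ZMod.stdAddChar a = ZMod.stdAddChar (a - b) := by
  have h : ZMod.stdAddChar (a - b) * ZMod.stdAddChar b = ZMod.stdAddChar a := by
    rw [← AddChar.map_add_eq_mul, sub_add_cancel]
  rw [← h, mul_comm, mul_assoc, mul_star_of_norm_eq_one (norm_stdAddChar b), mul_one]

/-- Expanding the square gives pairs of momenta. The cell number enters only through the phase of `a
- b`, so summing over the cells produces a geometric sum. -/
theorem cellsProb_eq (p q : ℕ) (τ : ℝ) :
    (cellsProb M p q τ : ℂ) = ((M : ℂ) ^ 2)⁻¹ * ∑ a : ZMod M, ∑ b : ZMod M,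
      (∑ m ∈ Finset.Ico p q, ZMod.stdAddChar (a - b) ^ m) * overlap a b τ := by
  have h : ∀ m, ((∑ s, ‖(M : ℂ)⁻¹ * ∑ a : ZMod M, ZMod.stdAddChar a ^ m *
      blochAmp (ZMod.stdAddChar a) τ s‖ ^ 2 : ℝ) : ℂ) = ((M : ℂ) ^ 2)⁻¹ *
      ∑ a : ZMod M, ∑ b : ZMod M, ZMod.stdAddChar (a - b) ^ m * overlap a b τ := by
    intro m
    have := sum_norm_sq_sum fun (a : ZMod M) (s : Fin 10) =>
      ZMod.stdAddChar a ^ m * blochAmp (ZMod.stdAddChar a) τ s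
    have e : ∑ s, ‖(M : ℂ)⁻¹ * ∑ a : ZMod M, ZMod.stdAddChar a ^ m *
        blochAmp (ZMod.stdAddChar a) τ s‖ ^ 2 = ((M : ℝ) ^ 2)⁻¹ * ∑ s, ‖∑ a : ZMod M,
        ZMod.stdAddChar a ^ m * blochAmp (ZMod.stdAddChar a) τ s‖ ^ 2 := by
      rw [Finset.mul_sum]
      refine Finset.sum_congr rfl fun s _ => ?_
      rw [norm_mul, mul_pow, norm_inv, Complex.norm_natCast, inv_pow]
    rw [e, Complex.ofReal_mul, this]
    push_cast
    congr 1
    refine Finset.sum_congr rfl fun a _ => Finset.sum_congr rfl fun b _ => ?_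
    rw [← star_stdAddChar_mul, mul_pow, ← star_pow, overlap, dotProduct, dotProduct,
      Finset.mul_sum]
    refine Finset.sum_congr rfl fun s _ => ?_
    simp only [Pi.star_apply, star_mul']
    ring
  rw [cellsProb, Complex.ofReal_sum]
  simp only [h]
  rw [← Finset.mul_sum, Finset.sum_comm]
  congr 1
  refine Finset.sum_congr rfl fun a _ => ?_
  rw [Finset.sum_comm]
  refine Finset.sum_congr rfl fun b _ => ?_
  rw [Finset.sum_mul]

theorem integral_cellsProb_eq (p q : ℕ) (T : ℝ) :
    ((∫ τ in (0 : ℝ)..T, cellsProb M p q τ : ℝ) : ℂ) =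
      ((M : ℂ) ^ 2)⁻¹ * ∑ a : ZMod M, ∑ b : ZMod M,
        (∑ m ∈ Finset.Ico p q, ZMod.stdAddChar (a - b) ^ m) *
          ∫ τ in (0 : ℝ)..T, overlap a b τ := by
  rw [← intervalIntegral.integral_ofReal]
  simp only [cellsProb_eq]
  rw [intervalIntegral.integral_const_mul, intervalIntegral.integral_finsetSum]
  · congr 1
    refine Finset.sum_congr rfl fun a _ => ?_
    rw [intervalIntegral.integral_finsetSum]
    · simp only [intervalIntegral.integral_const_mul]
    · exact fun b _ => (continuous_const.mul (continuous_overlap a b)).intervalIntegrable _ _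
  · exact fun a _ => (continuous_finsetSum _ fun b _ =>
      continuous_const.mul (continuous_overlap a b)).intervalIntegrable _ _

/-- The bound on the contribution of a pair of momenta to the deviation of the time average of
`cellsProb` from its limit. -/
theorem norm_pair_sub_le {C : ℝ} (hC : ∀ z w : ℂ, ‖z‖ = 1 → ‖w‖ = 1 → ∀ T : ℝ,
      ‖w + star w - (z + star z)‖ *
        ‖∫ τ in (0 : ℝ)..T, star (blochAmp w τ) ⬝ᵥ blochAmp z τ‖ ≤ C) {p q : ℕ} (hpq : p ≤ q)
    (hq : q ≤ M) {T : ℝ} (hT : 0 < T) (a b : ZMod M) :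
    ‖(∑ m ∈ Finset.Ico p q, ZMod.stdAddChar (a - b) ^ m) *
        (∫ τ in (0 : ℝ)..T, overlap a b τ) - if b = a then ((q : ℂ) - p) * T else 0‖ ≤
      (if b = -a then 2 * (chord (a + a))⁻¹ * T else 0) +
        M * (C / 2) * ((chord (a - b) ^ 2)⁻¹ + (chord (a + b) ^ 2)⁻¹) := by
  have hC0 : 0 ≤ C := le_trans (by positivity) (hC 1 1 norm_one norm_one 0)
  have h1 : 0 ≤ if b = -a then 2 * (chord (a + a))⁻¹ * T else 0 := by
    have := chord_nonneg (a + a)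
    split_ifs
    · positivity
    · rfl
  have h2 : 0 ≤ M * (C / 2) * ((chord (a - b) ^ 2)⁻¹ + (chord (a + b) ^ 2)⁻¹) := by positivity
  -- For equal momenta the overlap is identically `1` by unitarity and the geometric sum is `q - p`,
  -- so the subtracted limit is exact.
  by_cases hba : b = a
  · subst hba
    have e : ∀ τ, overlap b b τ = 1 := star_blochAmp_dotProduct_self _
    rw [if_pos rfl]
    simp only [e]
    rw [intervalIntegral.integral_const, sub_self, AddChar.map_zero_eq_one]
    simp only [one_pow, Finset.sum_const, Nat.card_Ico, nsmul_eq_mul, mul_one, sub_zero,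
      Complex.real_smul, Nat.cast_sub hpq]
    rw [sub_self (((q : ℂ) - p) * T), norm_zero]
    rw [sub_self] at h2
    exact add_nonneg h1 h2
  rw [if_neg hba, sub_zero, norm_mul]
  have hab : a - b ≠ 0 := sub_ne_zero.mpr (Ne.symm hba)
  by_cases hb : b = -a
  -- Opposite momenta have equal `t`, so the overlap need not average out: it is bounded by `1`, and
  -- the decay comes from the geometric sum.
  · rw [if_pos hb]
    refine le_add_of_le_of_nonneg (mul_le_mul ?_ ?_ (norm_nonneg _) ?_) h2
    · have := norm_geom_sum_le_inv_chord hab hpq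
      rwa [hb, sub_neg_eq_add] at this ⊢
    · refine (intervalIntegral.norm_integral_le_of_norm_le_const (C := 1) fun τ _ =>
        norm_star_blochAmp_dotProduct_le _ _ τ).trans ?_
      rw [sub_zero, abs_of_pos hT, one_mul]
    · exact mul_nonneg two_pos.le (inv_nonneg.mpr (chord_nonneg _))
  · rw [if_neg hb, zero_add, mul_assoc]
    have hab' : a + b ≠ 0 := fun h => hb (eq_neg_of_add_eq_zero_right h)
    have d1 := chord_pos hab
    have d2 := chord_pos hab'
    refine mul_le_mul ?_ ?_ (norm_nonneg _) (Nat.cast_nonneg _)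
    · refine (norm_geom_sum_le_sub _ hpq).trans ?_
      have : (q : ℝ) ≤ M := by exact_mod_cast hq
      linarith [(Nat.cast_nonneg p : (0 : ℝ) ≤ p)]
    · have h := hC _ _ (norm_stdAddChar a) (norm_stdAddChar b) T
      rw [norm_two_re_sub_two_re] at h
      change _ * ‖∫ τ in (0 : ℝ)..T, overlap a b τ‖ ≤ C at h
      rw [← le_div_iff₀' (by positivity)] at h
      refine h.trans ?_
      generalize chord (a - b) = x at *
      generalize chord (a + b) = y at *
      -- The inequality of means separates the two chords, so that each can be summed over a
      -- translate of the whole group.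
      have : C / 2 * ((x ^ 2)⁻¹ + (y ^ 2)⁻¹) - C / (x * y) = C / 2 * (x⁻¹ - y⁻¹) ^ 2 := by
        field_simp
        ring
      have h3 : 0 ≤ C / 2 * (x⁻¹ - y⁻¹) ^ 2 := by positivity
      linarith

/-- The time average of the probability of finding the walk in a given set of consecutive cells. -/
theorem exists_le_avg_cellsProb : ∃ C, 0 < C ∧ ∀ (N : ℕ) [NeZero (2 * N)] (p q : ℕ), p ≤ q →
    q ≤ 2 * N → ∀ T : ℝ, 0 < T →
      ((q : ℝ) - p) / (2 * N) - 1 / Real.sqrt (2 * N) - C * (2 * N) ^ 2 / T ≤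
        T⁻¹ * ∫ τ in (0 : ℝ)..T, cellsProb (2 * N) p q τ := by
  obtain ⟨C, hC0, hC⟩ := exists_norm_integral_blochAmp_le
  refine ⟨C / 4, by positivity, fun N _ p q hpq hq T hT => ?_⟩
  -- The number of cells is even, so `-1` is among the roots of unity; this provides the antipodal
  -- shift for the pairs `b = -a`.
  have hh : ZMod.stdAddChar ((N : ℕ) : ZMod (2 * N)) = -1 := by
    have hN : (N : ℂ) ≠ 0 := by
      have := NeZero.ne (2 * N)
      exact_mod_cast (by omega : N ≠ 0)
    have := ZMod.stdAddChar_coe (N := 2 * N) (N : ℤ)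
    rw [Int.cast_natCast] at this
    rw [this, ← Complex.exp_pi_mul_I]
    congr 1
    push_cast
    field_simp
  have hcast : ((2 * N : ℕ) : ℝ) = 2 * (N : ℝ) := by push_cast; ring
  rw [← hcast]
  generalize hM : 2 * N = M at *
  have hM0 : (0 : ℝ) < M := by exact_mod_cast NeZero.pos M
  have hM0' : (M : ℂ) ≠ 0 := NeZero.ne _
  set J := ∫ τ in (0 : ℝ)..T, cellsProb M p q τ with hJ
  have hsum : ∑ a : ZMod M, ∑ b : ZMod M, (if b = a then ((q : ℂ) - p) * T else 0) =
      M * ((q - p) * T) := by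
    simp
  have hmain : ‖((J - (q - p) / M * T : ℝ) : ℂ)‖ ≤
      ((M : ℝ) ^ 2)⁻¹ * (M * Real.sqrt M * T + M * (C / 2) * (2 * (M * ((M : ℝ) ^ 2 / 4)))) := by
    have e : ((J - (q - p) / M * T : ℝ) : ℂ) = ((M : ℂ) ^ 2)⁻¹ * ∑ a : ZMod M, ∑ b : ZMod M,
        ((∑ m ∈ Finset.Ico p q, ZMod.stdAddChar (a - b) ^ m) *
        (∫ τ in (0 : ℝ)..T, overlap a b τ) - if b = a then ((q : ℂ) - p) * T else 0) := by
      simp only [Finset.sum_sub_distrib]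
      rw [hsum, mul_sub, ← integral_cellsProb_eq]
      push_cast
      congr 1
      field_simp
    rw [e, norm_mul, norm_inv, norm_pow, Complex.norm_natCast]
    refine mul_le_mul_of_nonneg_left ?_ (by positivity)
    calc _ ≤ ∑ a : ZMod M, ∑ b : ZMod M, ((if b = -a then 2 * (chord (a + a))⁻¹ * T else 0) +
          M * (C / 2) * ((chord (a - b) ^ 2)⁻¹ + (chord (a + b) ^ 2)⁻¹)) := by
          refine (norm_sum_le _ _).trans (Finset.sum_le_sum fun a _ => ?_)
          refine (norm_sum_le _ _).trans (Finset.sum_le_sum fun b _ => ?_)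
          exact norm_pair_sub_le hC hpq hq hT a b
      _ = (∑ a : ZMod M, 2 * (chord (a + a))⁻¹) * T +
          M * (C / 2) * (2 * (M * ∑ j : ZMod M, (chord j ^ 2)⁻¹)) := by
          have e1 : ∀ a : ZMod M, ∑ b : ZMod M, (chord (a - b) ^ 2)⁻¹ =
              ∑ j : ZMod M, (chord j ^ 2)⁻¹ := fun a =>
            Equiv.sum_comp (Equiv.subLeft a) fun j => (chord j ^ 2)⁻¹
          have e2 : ∀ a : ZMod M, ∑ b : ZMod M, (chord (a + b) ^ 2)⁻¹ =
              ∑ j : ZMod M, (chord j ^ 2)⁻¹ := fun a =>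
            Equiv.sum_comp (Equiv.addLeft a) fun j => (chord j ^ 2)⁻¹
          simp only [Finset.sum_add_distrib, ← Finset.mul_sum, e1, e2, Finset.sum_ite_eq',
            Finset.mem_univ, if_true, Finset.sum_const, Finset.card_univ,
            ZMod.card, nsmul_eq_mul, ← Finset.sum_mul]
          ring
      _ ≤ _ := by
          gcongr
          · exact sum_two_mul_inv_chord_add_self_le hh
          · exact sum_inv_chord_sq_le
  rw [Complex.norm_real] at hmain
  have h1 := (abs_le.mp hmain).1
  have hr : 0 < Real.sqrt M := Real.sqrt_pos.mpr hM0
  have e2 : ((M : ℝ) ^ 2)⁻¹ * (M * Real.sqrt M * T + M * (C / 2) * (2 * (M * ((M : ℝ) ^ 2 / 4)))) =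
      T * (1 / Real.sqrt M + C / 4 * M ^ 2 / T) := by
    have hs : (M : ℝ) = Real.sqrt M * Real.sqrt M := (Real.mul_self_sqrt hM0.le).symm
    generalize Real.sqrt M = r at *
    rw [hs]
    field_simp
  rw [e2] at h1
  rw [inv_mul_eq_div, le_div_iff₀ hT]
  linarith

end Mixing

/-! ### The success probability -/

section Success

variable {n : ℕ} [NeZero n] (gs : List (Gate n))

/-- A block consists of two cells, but the pendant node of an even cell belongs to the block before.
Cell `2 * L` is therefore left out: its pendant node lies in the last block of the circuit. -/
theorem inPadding_cellNode {L : ℕ} {m : Fin (2 * (6 * L))} (h1 : 2 * L + 1 ≤ m.val)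
    (h2 : m.val < 10 * L) (s : Fin 10) : InPadding (cellNode m s) := by
  unfold InPadding cellNode
  split_ifs with h
  · simp only [nodeBlock]
    omega
  · simp only [nodeBlock]
    split_ifs with hm
    · omega
    · have : (prev (⟨m.val / 2, by omega⟩ : Fin (6 * L))).val = m.val / 2 - 1 :=
        prev_val_of_pos (by simp only; omega)
      rw [this]
      omega

theorem walkAmp_cellNode {M : ℕ} [NeZero M] (τ : ℝ) (m : Fin M) (s : Fin 10) :
    walkAmp (necklace 9 M) τ (.inl ⟨0, Nat.mul_pos (by norm_num) (NeZero.pos M)⟩) (cellNode m s) =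
      (M : ℂ)⁻¹ * ∑ a : ZMod M, ZMod.stdAddChar a ^ m.val *
        blochAmp (ZMod.stdAddChar a) τ s := by
  rw [walkAmp_necklace, nodeCell_cellNode, nodeSlot_cellNode]

/-- The nodes of these cells are distinct nodes of the padding, and the padding nodes that are
dropped contribute nonnegatively. -/
theorem cellsProb_le_probAt_success (hL : 0 < gs.length) [NeZero (2 * (6 * gs.length))] (τ : ℝ) :
    cellsProb (2 * (6 * gs.length)) (2 * gs.length + 1) (10 * gs.length) τ ≤
      probAt gs τ (success gs) := by
  classical
  rw [probAt_success gs hL]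
  set M := 2 * (6 * gs.length) with hM
  let f : ℕ → ℝ := fun m => ∑ s, ‖(M : ℂ)⁻¹ * ∑ a : ZMod M, ZMod.stdAddChar a ^ m *
    blochAmp (ZMod.stdAddChar a) τ s‖ ^ 2
  let g : Fin (9 * M) ⊕ Fin M → ℝ := fun i => if InPadding i then
    ‖walkAmp (necklace 9 M) τ (firstNode hL) i‖ ^ 2 else 0
  have hg : ∀ i, 0 ≤ g i := fun i => by
    simp only [g]
    split_ifs
    · positivity
    · rfl
  calc cellsProb M (2 * gs.length + 1) (10 * gs.length) τ
      = ∑ m ∈ Finset.Ico (2 * gs.length + 1) (10 * gs.length), f m := rfl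
    _ = ∑ m ∈ Finset.range M,
        if 2 * gs.length + 1 ≤ m ∧ m < 10 * gs.length then f m else 0 := by
        rw [← Finset.sum_filter]
        refine Finset.sum_congr ?_ fun _ _ => rfl
        ext m
        simp only [Finset.mem_Ico, Finset.mem_filter, Finset.mem_range]
        omega
    _ = ∑ m : Fin M, if 2 * gs.length + 1 ≤ m.val ∧ m.val < 10 * gs.length then f m else 0 :=
        (Fin.sum_univ_eq_sum_range
          (fun m => if 2 * gs.length + 1 ≤ m ∧ m < 10 * gs.length then f m else 0) M).symm
    _ ≤ ∑ m : Fin M, ∑ s : Fin 10, g (cellNode m s) := by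
        refine Finset.sum_le_sum fun m _ => ?_
        split_ifs with h
        · refine Finset.sum_le_sum fun s _ => ?_
          simp only [g]
          rw [if_pos (inPadding_cellNode h.1 h.2 s), ← walkAmp_cellNode]
          exact le_rfl
        · exact Finset.sum_nonneg fun s _ => hg _
    _ = ∑ i ∈ Finset.univ.image fun p : Fin M × Fin 10 => cellNode p.1 p.2, g i := by
        rw [Finset.sum_image cellNode_injective.injOn, Fintype.sum_prod_type]
    _ ≤ ∑ i, g i := Finset.sum_le_univ_sum_of_nonneg hg

theorem continuous_probAt_success (hL : 0 < gs.length) :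
    Continuous fun τ => probAt gs τ (success gs) := by
  classical
  have : NeZero (2 * (6 * gs.length)) := ⟨by omega⟩
  simp only [probAt_success gs hL]
  refine continuous_finsetSum _ fun i _ => ?_
  split_ifs
  · refine (Continuous.norm ?_).pow 2
    have h := fun τ => walkAmp_necklace (M := 2 * (6 * gs.length)) τ i
    change Continuous fun τ => walkAmp (necklace 9 (2 * (6 * gs.length))) τ (.inl ⟨0, _⟩) i
    simp only [h]
    exact continuous_const.mul (continuous_finsetSum _ fun a _ =>
      continuous_const.mul (continuous_blochAmp _ _))
  · exact continuous_const

theorem exists_le_avgProb_success : ∃ C : ℝ, 0 < C ∧ ∀ (n : ℕ) [NeZero n] (gs : List (Gate n)),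
    gs ≠ [] → ∀ T : ℝ, 0 < T →
      2 / 3 - 1 / (12 * (gs.length : ℝ)) - 1 / Real.sqrt (12 * gs.length) -
        C * (gs.length : ℝ) ^ 2 / T ≤ avgProb gs T (success gs) := by
  obtain ⟨C, hC, h⟩ := exists_le_avg_cellsProb
  -- There are `12L` cells, whence the factor `12 ^ 2`. The range has `8L - 1` of them, a fraction
  -- `2 / 3 - 1 / (12 L)`.
  refine ⟨144 * C, by positivity, fun n _ gs hgs T hT => ?_⟩
  have hL : 0 < gs.length := List.length_pos_iff.mpr hgs
  have : NeZero (2 * (6 * gs.length)) := ⟨by omega⟩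
  have h1 := h (6 * gs.length) (2 * gs.length + 1) (10 * gs.length) (by omega) (by omega) T hT
  have h2 : T⁻¹ * ∫ τ in (0 : ℝ)..T,
      cellsProb (2 * (6 * gs.length)) (2 * gs.length + 1) (10 * gs.length) τ ≤
        avgProb gs T (success gs) := by
    rw [avgProb]
    refine mul_le_mul_of_nonneg_left ?_ (inv_nonneg.mpr hT.le)
    refine intervalIntegral.integral_mono hT.le ?_ ?_ fun τ => cellsProb_le_probAt_success gs hL τ
    · exact (continuous_cellsProb _ _).intervalIntegrable _ _
    · exact (continuous_probAt_success gs hL).intervalIntegrable _ _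
  refine le_trans (le_of_eq ?_) (h1.trans h2)
  have hL' : (0 : ℝ) < gs.length := by exact_mod_cast hL
  push_cast
  have e1 : (2 : ℝ) * (6 * gs.length) = 12 * gs.length := by ring
  rw [e1]
  congr 1
  · congr 1
    field_simp
    ring
  · ring

theorem timeBound_zero (C : ℝ) (L : ℕ) : timeBound C 0 L = C * (L : ℝ) ^ 2 := by
  rw [timeBound, pow_zero, mul_one]

/-- The success probability is bounded below by a constant. -/
theorem exists_const_le_avgProb_success : ∃ C δ : ℝ, 0 < C ∧ 0 < δ ∧
    ∀ (n : ℕ) [NeZero n] (gs : List (Gate n)), gs ≠ [] →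
      ∀ T : ℝ, timeBound C 0 gs.length ≤ T → δ ≤ avgProb gs T (success gs) := by
  obtain ⟨C, hC, h⟩ := exists_le_avgProb_success
  -- The worst case `L = 1` leaves `2/3 - 1/12 - 1/3 - 1/8 = 1/8`, using `√12 ≥ 3`.
  refine ⟨8 * C, 1 / 8, by positivity, by norm_num, fun n _ gs hgs T hT => ?_⟩
  have hL : (1 : ℝ) ≤ gs.length := by exact_mod_cast List.length_pos_iff.mpr hgs
  rw [timeBound_zero] at hT
  have hT0 : 0 < T := lt_of_lt_of_le (by positivity) hT
  refine le_trans ?_ (h n gs hgs T hT0)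
  have h1 : 1 / (12 * (gs.length : ℝ)) ≤ 1 / 12 :=
    one_div_le_one_div_of_le (by norm_num) (by linarith)
  have h2 : 1 / Real.sqrt (12 * gs.length) ≤ 1 / 3 :=
    one_div_le_one_div_of_le (by norm_num) (Real.le_sqrt_of_sq_le (by linarith))
  have h3 : C * (gs.length : ℝ) ^ 2 / T ≤ 1 / 8 := by
    rw [div_le_iff₀ hT0]
    linarith
  linarith

/-- The success probability is close to `2 / 3` for long circuits. -/
theorem exists_sub_le_avgProb_success {ε : ℝ} (hε : 0 < ε) : ∃ (C : ℝ) (L₀ : ℕ), 0 < C ∧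
    ∀ (n : ℕ) [NeZero n] (gs : List (Gate n)), gs ≠ [] → L₀ ≤ gs.length →
      ∀ T : ℝ, timeBound C 0 gs.length ≤ T → 2 / 3 - ε ≤ avgProb gs T (success gs) := by
  obtain ⟨C, hC, h⟩ := exists_le_avgProb_success
  -- The error budget is `ε / 4` for each of the two terms depending on `L` alone and `ε / 2` for
  -- the one with `T`.
  refine ⟨2 * C / ε, ⌈(4 / ε) ^ 2⌉₊, by positivity, fun n _ gs hgs hL₀ T hT => ?_⟩
  have hL : (1 : ℝ) ≤ gs.length := by exact_mod_cast List.length_pos_iff.mpr hgs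
  rw [timeBound_zero] at hT
  have hT0 : 0 < T := lt_of_lt_of_le (by positivity) hT
  refine le_trans ?_ (h n gs hgs T hT0)
  have h2 : 1 / Real.sqrt (12 * gs.length) ≤ ε / 4 := by
    rw [show ε / 4 = 1 / (4 / ε) from (one_div_div 4 ε).symm]
    refine one_div_le_one_div_of_le (by positivity) (Real.le_sqrt_of_sq_le ?_)
    have := (Nat.le_ceil _).trans (Nat.cast_le (α := ℝ).mpr hL₀)
    linarith
  have h1 : 1 / (12 * (gs.length : ℝ)) ≤ 1 / Real.sqrt (12 * gs.length) := by
    refine one_div_le_one_div_of_le (Real.sqrt_pos.mpr (by linarith)) ?_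
    rw [Real.sqrt_le_left (by linarith)]
    nlinarith
  have h3 : C * (gs.length : ℝ) ^ 2 / T ≤ ε / 2 := by
    rw [div_le_iff₀ hT0]
    calc C * (gs.length : ℝ) ^ 2 = ε / 2 * (2 * C / ε * (gs.length : ℝ) ^ 2) := by field_simp
      _ ≤ ε / 2 * T := by gcongr
  linarith

/-- The computer runs the given circuits unchanged. Conditioned on success its output has exactly
the acceptance probability of the circuit, so the thresholds carry over without amplification. -/
theorem decidedByHamiltonianComputer_of_inBQP {A : Language Bool} (hA : InBQP A) :
    DecidedByHamiltonianComputer A := by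
  obtain ⟨P, hP, hA⟩ := hA
  obtain ⟨C, δ, hC, hδ, h⟩ := exists_const_le_avgProb_success
  refine ⟨P, C, δ, 0, hP, hC, hδ, fun x => ?_⟩
  have hlen : (P x).toGates.length = (P x).gates.length := List.length_map _
  have hne : (P x).toGates ≠ [] := fun h0 => (P x).ne (List.map_eq_nil_iff.mp h0)
  have h1 := h _ _ hne _ (le_refl (timeBound C 0 (P x).toGates.length))
  rw [hlen] at h1
  rw [avgProb_success_inter_outputIsOne _ (List.length_pos_iff.mpr hne)]
  refine ⟨h1, fun hx => ?_, fun hx => ?_⟩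
  · rw [mul_comm]
    exact mul_le_mul_of_nonneg_left ((hA x).1 hx) (hδ.le.trans h1)
  · rw [mul_comm]
    exact mul_le_mul_of_nonneg_right ((hA x).2 hx) (hδ.le.trans h1)

end Success

end Railroad

end

theorem mainTheorem4 :
    -- the Hamiltonian: 2-local qubit-qutrit terms of constant norm, linearly many in the number
    -- of gates, on a clock register of linear size
    (∀ (n : ℕ) [NeZero n] (gs : List (Railroad.Gate n)), gs ≠ [] →
      Fintype.card (Railroad.Site (6 * gs.length)) = 114 * gs.length ∧
      (Railroad.ringTerms (Railroad.ringGate gs)).length = 162 * gs.length ∧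
      ∀ A ∈ Railroad.ringTerms (Railroad.ringGate gs),
        A.IsHermitian ∧ ‖Matrix.toEuclideanCLM (𝕜 := ℂ) A‖ ≤ 1 ∧
          Railroad.IsTwoLocalQubitQutrit A) ∧
    -- the switch gadget: an invariant 12-dimensional subspace, adjacency matrix of the comb, CNOT
    (∀ (n : ℕ) [NeZero n] (gs : List (Railroad.Gate n)), gs ≠ [] →
      ∀ (b : Fin (6 * gs.length)) (φ : Railroad.Bits n → ℂ), star φ ⬝ᵥ φ = 1 →
        Railroad.IsOrthonormal (Railroad.switchState (Railroad.ringGate gs b) b φ) ∧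
        Railroad.ActsAsAdjacency (Railroad.switchHam (Railroad.ringGate gs b) b)
          (Railroad.switchState (Railroad.ringGate gs b) b φ) Railroad.comb ∧
        Module.finrank ℂ (Submodule.span ℂ
          (Set.range (Railroad.switchState (Railroad.ringGate gs b) b φ))) = 12 ∧
        (∀ v ∈ Submodule.span ℂ
            (Set.range (Railroad.switchState (Railroad.ringGate gs b) b φ)),
          Railroad.switchHam (Railroad.ringGate gs b) b *ᵥ v ∈ Submodule.span ℂ
            (Set.range (Railroad.switchState (Railroad.ringGate gs b) b φ))) ∧
        Railroad.switchState (Railroad.ringGate gs b) b φ (.inl 0) =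
          Railroad.posState φ (.c b) 1 ∧
        ∀ (q₁ q₂ : Fin n) (h : q₁ ≠ q₂), Railroad.ringGate gs b = .cnot q₁ q₂ h →
          Railroad.switchState (Railroad.ringGate gs b) b φ (.inl 9) =
            Railroad.posState (Railroad.cnotMatrix q₁ q₂ *ᵥ φ) (.a (Railroad.next b)) 1) ∧
    -- the full Hamiltonian is the adjacency matrix of a necklace
    (∀ (n : ℕ) [NeZero n] (gs : List (Railroad.Gate n)), gs ≠ [] →
      ∀ φ : Railroad.Bits n → ℂ, star φ ⬝ᵥ φ = 1 →
        Railroad.IsOrthonormal (Railroad.legalState (Railroad.ringGate gs) φ) ∧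
        Railroad.ActsAsAdjacency (Railroad.computerHam gs)
          (Railroad.legalState (Railroad.ringGate gs) φ)
          (Railroad.necklace 9 (2 * (6 * gs.length))) ∧
        (∀ (r : Fin (9 * (2 * (6 * gs.length)))) (b : Fin (6 * gs.length)),
          r.val = 0 → b.val = 0 →
          Railroad.legalState (Railroad.ringGate gs) φ (.inl r) =
            Railroad.posState φ (.a b) 1)) ∧
    -- given success, the work register is distributed as the output of the circuit
    (∀ (n : ℕ) [NeZero n] (gs : List (Railroad.Gate n)), gs ≠ [] →
      ∀ (τ : ℝ) (z : Railroad.Bits n),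
        Railroad.probAt gs τ (Railroad.success gs ∩ Railroad.workIs gs z) =
          Railroad.probAt gs τ (Railroad.success gs) *
            ‖Railroad.run gs (Railroad.zeroState n) z‖ ^ 2) ∧
    -- the running time
    (∃ k : ℕ,
      (∃ C δ : ℝ, 0 < C ∧ 0 < δ ∧
        ∀ (n : ℕ) [NeZero n] (gs : List (Railroad.Gate n)), gs ≠ [] →
          ∀ T : ℝ, Railroad.timeBound C k gs.length ≤ T →
            δ ≤ Railroad.avgProb gs T (Railroad.success gs)) ∧
      ∀ ε : ℝ, 0 < ε → ∃ (C : ℝ) (L₀ : ℕ), 0 < C ∧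
        ∀ (n : ℕ) [NeZero n] (gs : List (Railroad.Gate n)), gs ≠ [] → L₀ ≤ gs.length →
          ∀ T : ℝ, Railroad.timeBound C k gs.length ≤ T →
            2 / 3 - ε ≤ Railroad.avgProb gs T (Railroad.success gs)) ∧
    -- universality for BQP
    (∀ A : Language Bool, Railroad.InBQP A → Railroad.DecidedByHamiltonianComputer A) := by
  open Railroad in
  refine ⟨fun n _ gs _ => ⟨?_, ?_, isGoodTerm_ringTerms _⟩,
    fun n _ gs _ b φ hφ => ⟨isOrthonormal_switchState _ b hφ, actsAsAdjacency_switch _ b φ, ?_,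
      fun v hv => (actsAsAdjacency_switch _ b φ).mulVec_mem_span hv, rfl, ?_⟩,
    fun n _ gs _ φ hφ => ⟨isOrthonormal_legalState _ hφ,
      actsAsAdjacency_ringHam (run_ofFn_ringGate gs φ), fun r b hr hb => legalState_zero _ φ hr hb⟩,
    fun n _ gs hgs τ z => probAt_success_inter_workIs gs (List.length_pos_iff.mpr hgs) τ z,
    ⟨0, exists_const_le_avgProb_success, fun ε hε => exists_sub_le_avgProb_success hε⟩,
    fun A hA => decidedByHamiltonianComputer_of_inBQP hA⟩
  · rw [card_site]
    ring
  · rw [length_ringTerms]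
    ring
  · rw [finrank_span_eq_card (isOrthonormal_switchState _ b hφ).linearIndependent]
    rfl
  · intro q₁ q₂ h hg
    rw [hg]
    rfl
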